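/- For a finite group $G$ let $\alpha_{G,n}$ (resp. $\beta_{G,n}$) be the number of orbits of $G$, acting by simultaneous conjugation, on $n$-tuples (resp. on $n$-tuples of pairwise commuting elements) of $G$, and put $A_G(t)=\sum_{n\ge 0}\alpha_{G,n}t^n$, $B_G(t)=\sum_{n\ge 0}\beta_{G,n}t^n$ in $\mathbb Q[[t]]$. Groups $G,H$ are isoclinic if there are isomorphisms $\theta:G/Z(G)\to H/Z(H)$ and $\varphi:G'\to H'$ such that $\varphi([g_1,g_2])=[h_1,h_2]$ whenever $\theta(g_iZ(G))=h_iZ(H)$; the classes are called families. A stem group is a group $H$ with $Z(H)\le H'$. A family has rank $r$ (with respect to a prime $p$) if it contains a stem group of order $p^r$. Notation for the presentations: $[x,y]=x^{-1}y^{-1}xy$; any two listed generators for which no commutator or conjugation relation is displayed commute (except in $\Phi_8$, where $\beta$ is only a name for $\alpha_1^p$); $\alpha_i^{(p)}=\prod_{k=1}^{p}\alpha_{i+k-1}^{\binom pk}$ (factors in increasing order of $k$), where $\alpha_j=1$ if $\alpha_j$ is not a generator. For an odd prime $p$ let $\Phi_k$ be the family of the following group: - $\Phi_2$: $\langle\alpha,\alpha_1,\alpha_2\mid[\alpha_1,\alpha]=\alpha_2,\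 \alpha^p=\alpha_1^p=\alpha_2^p=1\rangle$; - $\Phi_3$: $\langle\alpha,\alpha_1,\alpha_2,\alpha_3\mid[\alpha_i,\alpha]=\alpha_{i+1}\ (i=1,2),\ \alpha^p=\alpha_1^{(p)}=\alpha_2^{(p)}=\alpha_3^{(p)}=1\rangle$; - $\Phi_4$: $\langle\alpha,\alpha_1,\alpha_2,\beta_1,\beta_2\mid[\alpha_i,\alpha]=\beta_i,\ \alpha^p=\alpha_i^p=\beta_i^p=1\ (i=1,2)\rangle$; - $\Phi_5$: $\langle\alpha_1,\dots,\alpha_4,\beta\mid[\alpha_1,\alpha_2]=[\alpha_3,\alpha_4]=\beta,\ \alpha_i^p=\beta^p=1\rangle$; - $\Phi_6$: $\langle\alpha_1,\alpha_2,\beta,\beta_1,\beta_2\mid[\alpha_1,\alpha_2]=\beta,\ [\beta,\alpha_i]=\beta_i,\ \alpha_i^p=\beta^p=\beta_i^p=1\ (i=1,2)\rangle$; - $\Phi_7$: $\langle\alpha,\alpha_1,\alpha_2,\alpha_3,\beta\mid[\alpha_i,\alpha]=\alpha_{i+1}\ (i=1,2),\ [\alpha_1,\beta]=\alpha_3,\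 \alpha^p=\alpha_1^{(p)}=\alpha_2^p=\alpha_3^p=\beta^p=1\rangle$; - $\Phi_8$: $\langle\alpha_1,\alpha_2,\beta\mid[\alpha_1,\alpha_2]=\beta=\alpha_1^p,\ \beta^{p^2}=\alpha_2^{p^2}=1\rangle$; - $\Phi_9$: $\langle\alpha,\alpha_1,\dots,\alpha_4\mid[\alpha_i,\alpha]=\alpha_{i+1}\ (i=1,2,3),\ \alpha^p=\alpha_1^{(p)}=\dots=\alpha_4^{(p)}=1\rangle$; - $\Phi_{10}$: as $\Phi_9$, with the additional relation $[\alpha_1,\alpha_2]=\alpha_4$ (in place of $[\alpha_1,\alpha_2]=1$). For $p=2$ let $\Gamma_k$ be the family of the following group: - $\Gamma_2,\Gamma_3,\Gamma_8$: the dihedral group of order $8$, $16$, $32$ respectively; - $\Gamma_4$: $\langle\alpha_1,\alpha_2,\beta\mid\alpha_1^4=\alpha_2^4=\beta^2=1,\ \beta\alpha_i\beta^{-1}=\alpha_i^{-1}\ (i=1,2)\rangle$; - $\Gamma_5$: $\langle\alpha_1,\dots,\alpha_4,\beta\mid\alpha_i^2=\beta^2=1,\ \alpha_1\alpha_2\alpha_1^{-1}=\beta\alpha_2^{-1},\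 \alpha_1\alpha_4\alpha_1^{-1}=\beta\alpha_4^{-1},\ \alpha_2\alpha_3\alpha_2^{-1}=\beta\alpha_3^{-1}\rangle$; - $\Gamma_6$: $\langle\alpha,\beta_1,\beta_2\mid\alpha^8=\beta_1^2=\beta_2^2=1,\ \beta_1\alpha\beta_1^{-1}=\alpha^{-1},\ \beta_2\alpha\beta_2^{-1}=\alpha^5\rangle$; - $\Gamma_7$: $\langle\alpha,\beta_1,\beta_2,\beta_3\mid\beta_1^2=\beta_2^2=\beta_3^2=\alpha^4=1,\ \alpha\beta_2\alpha^{-1}=\beta_1\beta_2,\ \alpha\beta_3\alpha^{-1}=\beta_2\beta_3\rangle$. The families $\Phi_2,\Gamma_2$ have rank $3$, the families $\Phi_3,\Gamma_3$ have rank $4$, and the remaining ones have rank $5$. For every finite group $G$ in one of these families (in particular for every such $p$-group) the functions $A_G(t/|G|)$ and $B_G(t/|G|)$ are as follows, with $p=2$ for the families $\Gamma_k$: - $\Phi_2,\Gamma_2$: $A=\frac{1-p^{-2}}{1-p^{-1}t}+\frac{p^{-2}}{1-t}$, $\ B=\frac{-p^{-1}}{1-p^{-2}t}+\frac{1+p^{-1}}{1-p^{-1}t}$;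 - $\Phi_3,\Phi_4,\Gamma_3,\Gamma_4$: $A=\frac{1-p^{-1}}{1-p^{-2}t}+\frac{p^{-1}-p^{-3}}{1-p^{-1}t}+\frac{p^{-3}}{1-t}$, $\ B=\frac{-p^{-1}}{1-p^{-3}t}+\frac{1}{1-p^{-2}t}+\frac{p^{-1}}{1-p^{-1}t}$; - $\Phi_5,\Gamma_5$: $A=\frac{1-p^{-4}}{1-p^{-1}t}+\frac{p^{-4}}{1-t}$, $\ B=\frac{1}{1-p^{-4}t}+\frac{-p-1-p^{-1}-p^{-2}}{1-p^{-3}t}+\frac{p+1+p^{-1}+p^{-2}}{1-p^{-2}t}$; - $\Phi_6$: $A=\frac{1-p^{-3}}{1-p^{-2}t}+\frac{p^{-3}}{1-t}$, $\ B=\frac{-p^{-1}-p^{-2}}{1-p^{-3}t}+\frac{1+p^{-1}+p^{-2}}{1-p^{-2}t}$; - $\Phi_7,\Phi_8,\Gamma_6,\Gamma_7$: $A=\frac{1-p^{-2}}{1-p^{-2}t}+\frac{p^{-2}-p^{-4}}{1-p^{-1}t}+\frac{p^{-4}}{1-t}$, $\ B=\frac{-p^{-1}-p^{-2}}{1-p^{-3}t}+\frac{1+p^{-1}+p^{-2}}{1-p^{-2}t}$;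 - $\Phi_9,\Gamma_8$: $A=\frac{1-p^{-1}}{1-p^{-3}t}+\frac{p^{-1}-p^{-4}}{1-p^{-1}t}+\frac{p^{-4}}{1-t}$, $\ B=\frac{-p^{-1}}{1-p^{-4}t}+\frac{1}{1-p^{-3}t}+\frac{p^{-1}}{1-p^{-1}t}$; - $\Phi_{10}$: $A=\frac{1-p^{-1}}{1-p^{-3}t}+\frac{p^{-1}-p^{-3}}{1-p^{-2}t}+\frac{p^{-3}-p^{-4}}{1-p^{-1}t}+\frac{p^{-4}}{1-t}$, $\ B=\frac{-p^{-1}}{1-p^{-4}t}+\frac{1-p^{-2}}{1-p^{-3}t}+\frac{p^{-1}+p^{-2}}{1-p^{-2}t}$. For every finite abelian group $G$ both functions are $\frac1{1-t}$. Moreover, for every prime $p$ (including $2$), every finite group whose family has rank $3$ (resp. rank $4$) with respect to $p$ has the invariants in the row of $\Phi_2,\Gamma_2$ (resp. the row of $\Phi_3,\Phi_4,\Gamma_3,\Gamma_4$). Consequently $\Phi_3$ and $\Phi_4$ have the same normalized invariants, and so do $\Phi_7$ and $\Phi_8$, $\Gamma_3$ and $\Gamma_4$, and $\Gamma_6$ and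 $\Gamma_7$; finite groups $G,H$ of the same order, one in each family of such a pair, satisfy $A_G=A_H$ and $B_G=B_H$. -/

import Mathlib

universe u v

/-! ### The counting series of a finite group -/

section CountingSeries

variable (G : Type u) [Group G]

/-- The orbit relation of the action of `G` on `G ^ n` by simultaneous conjugation,
`g • (x₁, …, xₙ) = (g x₁ g⁻¹, …, g xₙ g⁻¹)`. -/
def simConj (n : ℕ) : Setoid (Fin n → G) :=
  MulAction.orbitRel (ConjAct G) (Fin n → G)

/-- The set `G⁽ⁿ⁾` of `n`-tuples of pairwise commuting elements of `G`. -/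
def CommTuple (n : ℕ) : Type u :=
  {x : Fin n → G // ∀ i j, Commute (x i) (x j)}

/-- The orbit relation of simultaneous conjugation on the invariant subset `G⁽ⁿ⁾` of `G ^ n`. -/
def simConjComm (n : ℕ) : Setoid (CommTuple G n) :=
  (simConj G n).comap Subtype.val

/-- `α_{G,n}`: the number of simultaneous conjugacy classes of `n`-tuples. -/
noncomputable def alphaCount (n : ℕ) : ℕ :=
  Nat.card (Quotient (simConj G n))

/-- `β_{G,n}`: the number of simultaneous conjugacy classes of commuting `n`-tuples. -/
noncomputable def betaCount (n : ℕ) : ℕ :=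
  Nat.card (Quotient (simConjComm G n))

/-- `A_G(t) = ∑ₙ α_{G,n} tⁿ`. -/
noncomputable def seriesA : PowerSeries ℚ :=
  PowerSeries.mk fun n => (alphaCount G n : ℚ)

/-- `B_G(t) = ∑ₙ β_{G,n} tⁿ`. -/
noncomputable def seriesB : PowerSeries ℚ :=
  PowerSeries.mk fun n => (betaCount G n : ℚ)

/-- The normalized series `A_G(t / |G|)`. -/
noncomputable def normA : PowerSeries ℚ :=
  PowerSeries.rescale ((Nat.card G : ℚ)⁻¹) (seriesA G)

/-- The normalized series `B_G(t / |G|)`. -/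
noncomputable def normB : PowerSeries ℚ :=
  PowerSeries.rescale ((Nat.card G : ℚ)⁻¹) (seriesB G)

end CountingSeries

/-! ### Isoclinism, stem groups and rank -/

section Isoclinism

open scoped commutatorElement

/-- An isoclinism of `G` onto `H`: isomorphisms `θ : G / Z(G) ≃ H / Z(H)` and `φ : G' ≃ H'`
that are compatible with the commutator maps. -/
structure Isoclinism (G : Type u) (H : Type v) [Group G] [Group H] where
  /-- the isomorphism of the central quotients -/
  θ : (G ⧸ Subgroup.center G) ≃* (H ⧸ Subgroup.center H)
  /-- the isomorphism of the derived subgroups -/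
  φ : commutator G ≃* commutator H
  compat : ∀ (g₁ g₂ : G) (h₁ h₂ : H),
    θ (QuotientGroup.mk g₁) = QuotientGroup.mk h₁ →
    θ (QuotientGroup.mk g₂) = QuotientGroup.mk h₂ →
    (φ ⟨⁅g₁, g₂⁆,
      Subgroup.commutator_mem_commutator (Subgroup.mem_top g₁) (Subgroup.mem_top g₂)⟩ : H)
      = ⁅h₁, h₂⁆

end Isoclinism

/-- `G` and `H` belong to the same isoclinism family. -/
def Isoclinic (G : Type u) (H : Type v) [Group G] [Group H] : Prop :=
  Nonempty (Isoclinism G H)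

/-- A stem group is a group whose center is contained in its derived subgroup. -/
def IsStemGroup (G : Type u) [Group G] : Prop :=
  Subgroup.center G ≤ commutator G

/-- The isoclinism family of `G` has rank `r` (with respect to the prime `p`): its stem groups
have order `p ^ r`. (All finite stem groups of one family have the same order.) -/
def HasFamilyRank (p : ℕ) (G : Type u) [Group G] (r : ℕ) : Prop :=
  ∃ (H : Type) (_ : Group H), Isoclinic G H ∧ IsStemGroup H ∧ Nat.card H = p ^ r

/-! ### Stem groups representing the families `Φ₂, …, Φ₁₀` (odd `p`) and `Γ₂, …, Γ₈` (`p = 2`)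

The representatives are given by polycyclic presentations. A relation `x = y` is recorded as the
word `x * y⁻¹`. -/

/-- The commutator `[x, y] = x⁻¹ y⁻¹ x y` used in the presentations. -/
def pcComm {F : Type u} [Group F] (x y : F) : F := x⁻¹ * y⁻¹ * x * y

/-- `Φ₂(1³) = ⟨α, α₁, α₂ | [α₁, α] = α₂, αᵖ = α₁ᵖ = α₂ᵖ = 1⟩`
(all other pairs of generators commute). -/
def Phi2Rels (p : ℕ) : Set (FreeGroup (Fin 3)) :=
  let a : FreeGroup (Fin 3) := FreeGroup.of 0
  let a1 : FreeGroup (Fin 3) := FreeGroup.of 1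
  let a2 : FreeGroup (Fin 3) := FreeGroup.of 2
  {pcComm a1 a * a2⁻¹, a ^ p, a1 ^ p, a2 ^ p,
    pcComm a2 a, pcComm a1 a2}

/-- `Φ₃(1⁴) = ⟨α, α₁, α₂, α₃ | [αᵢ, α] = αᵢ₊₁, αᵖ = α₁⁽ᵖ⁾ = αᵢ₊₁⁽ᵖ⁾ = 1 (i = 1, 2)⟩`, where
`αᵢ⁽ᵖ⁾ = αᵢᵖ αᵢ₊₁^(p choose 2) ⋯ αᵢ₊ₚ₋₁^(p choose p)` and `αⱼ = 1` for `j > 3`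
(all other pairs of generators commute). -/
def Phi3Rels (p : ℕ) : Set (FreeGroup (Fin 4)) :=
  let a : FreeGroup (Fin 4) := FreeGroup.of 0
  let a1 : FreeGroup (Fin 4) := FreeGroup.of 1
  let a2 : FreeGroup (Fin 4) := FreeGroup.of 2
  let a3 : FreeGroup (Fin 4) := FreeGroup.of 3
  {pcComm a1 a * a2⁻¹, pcComm a2 a * a3⁻¹,
    a ^ p, a1 ^ p * a2 ^ p.choose 2 * a3 ^ p.choose 3, a2 ^ p * a3 ^ p.choose 2, a3 ^ p,
    pcComm a3 a, pcComm a1 a2, pcComm a1 a3, pcComm a2 a3}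

/-- `Φ₄(1⁵) = ⟨α, α₁, α₂, β₁, β₂ | [αᵢ, α] = βᵢ, αᵖ = αᵢᵖ = βᵢᵖ = 1 (i = 1, 2)⟩`
(all other pairs of generators commute). -/
def Phi4Rels (p : ℕ) : Set (FreeGroup (Fin 5)) :=
  let a : FreeGroup (Fin 5) := FreeGroup.of 0
  let a1 : FreeGroup (Fin 5) := FreeGroup.of 1
  let a2 : FreeGroup (Fin 5) := FreeGroup.of 2
  let b1 : FreeGroup (Fin 5) := FreeGroup.of 3
  let b2 : FreeGroup (Fin 5) := FreeGroup.of 4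
  {pcComm a1 a * b1⁻¹, pcComm a2 a * b2⁻¹,
    a ^ p, a1 ^ p, a2 ^ p, b1 ^ p, b2 ^ p,
    pcComm a b1, pcComm a b2, pcComm a1 a2, pcComm a1 b1, pcComm a1 b2,
    pcComm a2 b1, pcComm a2 b2, pcComm b1 b2}

/-- `Φ₅(1⁵) = ⟨α₁, α₂, α₃, α₄, β | [α₁, α₂] = [α₃, α₄] = β, αᵢᵖ = βᵖ = 1⟩`
(all other pairs of generators commute). -/
def Phi5Rels (p : ℕ) : Set (FreeGroup (Fin 5)) :=
  let a1 : FreeGroup (Fin 5) := FreeGroup.of 0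
  let a2 : FreeGroup (Fin 5) := FreeGroup.of 1
  let a3 : FreeGroup (Fin 5) := FreeGroup.of 2
  let a4 : FreeGroup (Fin 5) := FreeGroup.of 3
  let b : FreeGroup (Fin 5) := FreeGroup.of 4
  {pcComm a1 a2 * b⁻¹, pcComm a3 a4 * b⁻¹,
    a1 ^ p, a2 ^ p, a3 ^ p, a4 ^ p, b ^ p,
    pcComm a1 a3, pcComm a1 a4, pcComm a2 a3, pcComm a2 a4,
    pcComm a1 b, pcComm a2 b, pcComm a3 b, pcComm a4 b}

/-- `Φ₆(1⁵) = ⟨α₁, α₂, β, β₁, β₂ | [α₁, α₂] = β, [β, αᵢ] = βᵢ, αᵢᵖ = βᵖ = βᵢᵖ = 1 (i = 1, 2)⟩`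
(all other pairs of generators commute). -/
def Phi6Rels (p : ℕ) : Set (FreeGroup (Fin 5)) :=
  let a1 : FreeGroup (Fin 5) := FreeGroup.of 0
  let a2 : FreeGroup (Fin 5) := FreeGroup.of 1
  let b : FreeGroup (Fin 5) := FreeGroup.of 2
  let b1 : FreeGroup (Fin 5) := FreeGroup.of 3
  let b2 : FreeGroup (Fin 5) := FreeGroup.of 4
  {pcComm a1 a2 * b⁻¹, pcComm b a1 * b1⁻¹, pcComm b a2 * b2⁻¹,
    a1 ^ p, a2 ^ p, b ^ p, b1 ^ p, b2 ^ p,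
    pcComm a1 b1, pcComm a1 b2, pcComm a2 b1, pcComm a2 b2,
    pcComm b b1, pcComm b b2, pcComm b1 b2}

/-- `Φ₇(1⁵) = ⟨α, α₁, α₂, α₃, β | [αᵢ, α] = αᵢ₊₁, [α₁, β] = α₃,
αᵖ = α₁⁽ᵖ⁾ = αᵢ₊₁ᵖ = βᵖ = 1 (i = 1, 2)⟩`, where `α₁⁽ᵖ⁾ = α₁ᵖ α₂^(p choose 2) α₃^(p choose 3)`
(all other pairs of generators commute). -/
def Phi7Rels (p : ℕ) : Set (FreeGroup (Fin 5)) :=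
  let a : FreeGroup (Fin 5) := FreeGroup.of 0
  let a1 : FreeGroup (Fin 5) := FreeGroup.of 1
  let a2 : FreeGroup (Fin 5) := FreeGroup.of 2
  let a3 : FreeGroup (Fin 5) := FreeGroup.of 3
  let b : FreeGroup (Fin 5) := FreeGroup.of 4
  {pcComm a1 a * a2⁻¹, pcComm a2 a * a3⁻¹, pcComm a1 b * a3⁻¹,
    a ^ p, a1 ^ p * a2 ^ p.choose 2 * a3 ^ p.choose 3, a2 ^ p, a3 ^ p, b ^ p,
    pcComm a a3, pcComm a b, pcComm a1 a2, pcComm a1 a3, pcComm a2 a3,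
    pcComm a2 b, pcComm a3 b}

/-- `Φ₈(32) = ⟨α₁, α₂, β | [α₁, α₂] = β = α₁ᵖ, β^(p²) = α₂^(p²) = 1⟩`. Here `β` is only a name for
`α₁ᵖ`, and no relation between `β` and `α₂` is imposed: `[β, α₂] = βᵖ` follows. -/
def Phi8Rels (p : ℕ) : Set (FreeGroup (Fin 3)) :=
  let a1 : FreeGroup (Fin 3) := FreeGroup.of 0
  let a2 : FreeGroup (Fin 3) := FreeGroup.of 1
  let b : FreeGroup (Fin 3) := FreeGroup.of 2
  {pcComm a1 a2 * b⁻¹, b * (a1 ^ p)⁻¹, b ^ p ^ 2, a2 ^ p ^ 2}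

/-- `Φ₉(1⁵) = ⟨α, α₁, α₂, α₃, α₄ | [αᵢ, α] = αᵢ₊₁, αᵖ = α₁⁽ᵖ⁾ = αᵢ₊₁⁽ᵖ⁾ = 1 (i = 1, 2, 3)⟩`, where
`αᵢ⁽ᵖ⁾ = αᵢᵖ αᵢ₊₁^(p choose 2) ⋯ αᵢ₊ₚ₋₁^(p choose p)` and `αⱼ = 1` for `j > 4`
(all other pairs of generators commute). -/
def Phi9Rels (p : ℕ) : Set (FreeGroup (Fin 5)) :=
  let a : FreeGroup (Fin 5) := FreeGroup.of 0
  let a1 : FreeGroup (Fin 5) := FreeGroup.of 1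
  let a2 : FreeGroup (Fin 5) := FreeGroup.of 2
  let a3 : FreeGroup (Fin 5) := FreeGroup.of 3
  let a4 : FreeGroup (Fin 5) := FreeGroup.of 4
  {pcComm a1 a * a2⁻¹, pcComm a2 a * a3⁻¹, pcComm a3 a * a4⁻¹,
    a ^ p,
    a1 ^ p * a2 ^ p.choose 2 * a3 ^ p.choose 3 * a4 ^ p.choose 4,
    a2 ^ p * a3 ^ p.choose 2 * a4 ^ p.choose 3,
    a3 ^ p * a4 ^ p.choose 2,
    a4 ^ p,
    pcComm a a4, pcComm a1 a2, pcComm a1 a3, pcComm a1 a4,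
    pcComm a2 a3, pcComm a2 a4, pcComm a3 a4}

/-- `Φ₁₀(1⁵) = ⟨α, α₁, α₂, α₃, α₄ | [αᵢ, α] = αᵢ₊₁, [α₁, α₂] = α₄,
αᵖ = α₁⁽ᵖ⁾ = αᵢ₊₁⁽ᵖ⁾ = 1 (i = 1, 2, 3)⟩`, with `αᵢ⁽ᵖ⁾` as for `Φ₉(1⁵)`
(all other pairs of generators commute). -/
def Phi10Rels (p : ℕ) : Set (FreeGroup (Fin 5)) :=
  let a : FreeGroup (Fin 5) := FreeGroup.of 0
  let a1 : FreeGroup (Fin 5) := FreeGroup.of 1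
  let a2 : FreeGroup (Fin 5) := FreeGroup.of 2
  let a3 : FreeGroup (Fin 5) := FreeGroup.of 3
  let a4 : FreeGroup (Fin 5) := FreeGroup.of 4
  {pcComm a1 a * a2⁻¹, pcComm a2 a * a3⁻¹, pcComm a3 a * a4⁻¹, pcComm a1 a2 * a4⁻¹,
    a ^ p,
    a1 ^ p * a2 ^ p.choose 2 * a3 ^ p.choose 3 * a4 ^ p.choose 4,
    a2 ^ p * a3 ^ p.choose 2 * a4 ^ p.choose 3,
    a3 ^ p * a4 ^ p.choose 2,
    a4 ^ p,
    pcComm a a4, pcComm a1 a3, pcComm a1 a4,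
    pcComm a2 a3, pcComm a2 a4, pcComm a3 a4}

abbrev Phi2 (p : ℕ) : Type := PresentedGroup (Phi2Rels p)
abbrev Phi3 (p : ℕ) : Type := PresentedGroup (Phi3Rels p)
abbrev Phi4 (p : ℕ) : Type := PresentedGroup (Phi4Rels p)
abbrev Phi5 (p : ℕ) : Type := PresentedGroup (Phi5Rels p)
abbrev Phi6 (p : ℕ) : Type := PresentedGroup (Phi6Rels p)
abbrev Phi7 (p : ℕ) : Type := PresentedGroup (Phi7Rels p)
abbrev Phi8 (p : ℕ) : Type := PresentedGroup (Phi8Rels p)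
abbrev Phi9 (p : ℕ) : Type := PresentedGroup (Phi9Rels p)
abbrev Phi10 (p : ℕ) : Type := PresentedGroup (Phi10Rels p)

/-- `⟨α₁, α₂, β | α₁⁴ = α₂⁴ = β² = 1, β α₁ β⁻¹ = α₁⁻¹, β α₂ β⁻¹ = α₂⁻¹⟩`
(the generators `α₁`, `α₂` commute). -/
def Gamma4Rels : Set (FreeGroup (Fin 3)) :=
  let a1 : FreeGroup (Fin 3) := FreeGroup.of 0
  let a2 : FreeGroup (Fin 3) := FreeGroup.of 1
  let b : FreeGroup (Fin 3) := FreeGroup.of 2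
  {a1 ^ 4, a2 ^ 4, b ^ 2, b * a1 * b⁻¹ * (a1⁻¹)⁻¹, b * a2 * b⁻¹ * (a2⁻¹)⁻¹, pcComm a1 a2}

/-- `⟨α₁, α₂, α₃, α₄, β | αᵢ² = β² = 1, α₁ α₂ α₁⁻¹ = β α₂⁻¹, α₁ α₄ α₁⁻¹ = β α₄⁻¹,
α₂ α₃ α₂⁻¹ = β α₃⁻¹⟩` (all other pairs of generators commute). -/
def Gamma5Rels : Set (FreeGroup (Fin 5)) :=
  let a1 : FreeGroup (Fin 5) := FreeGroup.of 0
  let a2 : FreeGroup (Fin 5) := FreeGroup.of 1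
  let a3 : FreeGroup (Fin 5) := FreeGroup.of 2
  let a4 : FreeGroup (Fin 5) := FreeGroup.of 3
  let b : FreeGroup (Fin 5) := FreeGroup.of 4
  {a1 ^ 2, a2 ^ 2, a3 ^ 2, a4 ^ 2, b ^ 2,
    a1 * a2 * a1⁻¹ * (b * a2⁻¹)⁻¹, a1 * a4 * a1⁻¹ * (b * a4⁻¹)⁻¹,
    a2 * a3 * a2⁻¹ * (b * a3⁻¹)⁻¹,
    pcComm a1 a3, pcComm a2 a4, pcComm a3 a4,
    pcComm a1 b, pcComm a2 b, pcComm a3 b, pcComm a4 b}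

/-- `⟨α, β₁, β₂ | α⁸ = β₁² = β₂² = 1, β₁ α β₁⁻¹ = α⁻¹, β₂ α β₂⁻¹ = α⁵⟩`
(the generators `β₁`, `β₂` commute). -/
def Gamma6Rels : Set (FreeGroup (Fin 3)) :=
  let a : FreeGroup (Fin 3) := FreeGroup.of 0
  let b1 : FreeGroup (Fin 3) := FreeGroup.of 1
  let b2 : FreeGroup (Fin 3) := FreeGroup.of 2
  {a ^ 8, b1 ^ 2, b2 ^ 2, b1 * a * b1⁻¹ * (a⁻¹)⁻¹, b2 * a * b2⁻¹ * (a ^ 5)⁻¹, pcComm b1 b2}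

/-- `⟨α, β₁, β₂, β₃ | β₁² = β₂² = β₃² = α⁴ = 1, α β₂ α⁻¹ = β₁ β₂, α β₃ α⁻¹ = β₂ β₃⟩`
(all other pairs of generators commute). -/
def Gamma7Rels : Set (FreeGroup (Fin 4)) :=
  let a : FreeGroup (Fin 4) := FreeGroup.of 0
  let b1 : FreeGroup (Fin 4) := FreeGroup.of 1
  let b2 : FreeGroup (Fin 4) := FreeGroup.of 2
  let b3 : FreeGroup (Fin 4) := FreeGroup.of 3
  {b1 ^ 2, b2 ^ 2, b3 ^ 2, a ^ 4, a * b2 * a⁻¹ * (b1 * b2)⁻¹, a * b3 * a⁻¹ * (b2 * b3)⁻¹,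
    pcComm a b1, pcComm b1 b2, pcComm b1 b3, pcComm b2 b3}

/-- The dihedral group of order `8`. -/
abbrev Gamma2 : Type := DihedralGroup 4
/-- The dihedral group of order `16`. -/
abbrev Gamma3 : Type := DihedralGroup 8
abbrev Gamma4 : Type := PresentedGroup Gamma4Rels
abbrev Gamma5 : Type := PresentedGroup Gamma5Rels
abbrev Gamma6 : Type := PresentedGroup Gamma6Rels
abbrev Gamma7 : Type := PresentedGroup Gamma7Rels
/-- The dihedral group of order `32`. -/
abbrev Gamma8 : Type := DihedralGroup 16

/-! ### The rational functions in the table of normalized invariants -/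

/-- The rational function `c / (1 - r t)`, expanded as a power series. -/
noncomputable def pole (c r : ℚ) : PowerSeries ℚ :=
  PowerSeries.C c * (1 - PowerSeries.C r * PowerSeries.X)⁻¹

section Table

variable (p : ℚ)

/-- `A`-invariant of `Φ₂`, `Γ₂`. -/
noncomputable def rowA2 : PowerSeries ℚ :=
  pole (1 - p ^ (-2 : ℤ)) (p ^ (-1 : ℤ)) + pole (p ^ (-2 : ℤ)) 1

/-- `B`-invariant of `Φ₂`, `Γ₂`. -/
noncomputable def rowB2 : PowerSeries ℚ :=
  pole (-p ^ (-1 : ℤ)) (p ^ (-2 : ℤ)) + pole (1 + p ^ (-1 : ℤ)) (p ^ (-1 : ℤ))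

/-- `A`-invariant of `Φ₃`, `Φ₄`, `Γ₃`, `Γ₄`. -/
noncomputable def rowA3 : PowerSeries ℚ :=
  pole (1 - p ^ (-1 : ℤ)) (p ^ (-2 : ℤ)) + pole (p ^ (-1 : ℤ) - p ^ (-3 : ℤ)) (p ^ (-1 : ℤ))
    + pole (p ^ (-3 : ℤ)) 1

/-- `B`-invariant of `Φ₃`, `Φ₄`, `Γ₃`, `Γ₄`. -/
noncomputable def rowB3 : PowerSeries ℚ :=
  pole (-p ^ (-1 : ℤ)) (p ^ (-3 : ℤ)) + pole 1 (p ^ (-2 : ℤ))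
    + pole (p ^ (-1 : ℤ)) (p ^ (-1 : ℤ))

/-- `A`-invariant of `Φ₅`, `Γ₅`. -/
noncomputable def rowA5 : PowerSeries ℚ :=
  pole (1 - p ^ (-4 : ℤ)) (p ^ (-1 : ℤ)) + pole (p ^ (-4 : ℤ)) 1

/-- `B`-invariant of `Φ₅`, `Γ₅`. -/
noncomputable def rowB5 : PowerSeries ℚ :=
  pole 1 (p ^ (-4 : ℤ)) + pole (-p - 1 - p ^ (-1 : ℤ) - p ^ (-2 : ℤ)) (p ^ (-3 : ℤ))
    + pole (p + 1 + p ^ (-1 : ℤ) + p ^ (-2 : ℤ)) (p ^ (-2 : ℤ))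

/-- `A`-invariant of `Φ₆`. -/
noncomputable def rowA6 : PowerSeries ℚ :=
  pole (1 - p ^ (-3 : ℤ)) (p ^ (-2 : ℤ)) + pole (p ^ (-3 : ℤ)) 1

/-- `B`-invariant of `Φ₆`. -/
noncomputable def rowB6 : PowerSeries ℚ :=
  pole (-p ^ (-1 : ℤ) - p ^ (-2 : ℤ)) (p ^ (-3 : ℤ))
    + pole (1 + p ^ (-1 : ℤ) + p ^ (-2 : ℤ)) (p ^ (-2 : ℤ))

/-- `A`-invariant of `Φ₇`, `Φ₈`, `Γ₆`, `Γ₇`. -/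
noncomputable def rowA7 : PowerSeries ℚ :=
  pole (1 - p ^ (-2 : ℤ)) (p ^ (-2 : ℤ)) + pole (p ^ (-2 : ℤ) - p ^ (-4 : ℤ)) (p ^ (-1 : ℤ))
    + pole (p ^ (-4 : ℤ)) 1

/-- `B`-invariant of `Φ₇`, `Φ₈`, `Γ₆`, `Γ₇`. -/
noncomputable def rowB7 : PowerSeries ℚ :=
  pole (-p ^ (-1 : ℤ) - p ^ (-2 : ℤ)) (p ^ (-3 : ℤ))
    + pole (1 + p ^ (-1 : ℤ) + p ^ (-2 : ℤ)) (p ^ (-2 : ℤ))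

/-- `A`-invariant of `Φ₉`, `Γ₈`. -/
noncomputable def rowA9 : PowerSeries ℚ :=
  pole (1 - p ^ (-1 : ℤ)) (p ^ (-3 : ℤ)) + pole (p ^ (-1 : ℤ) - p ^ (-4 : ℤ)) (p ^ (-1 : ℤ))
    + pole (p ^ (-4 : ℤ)) 1

/-- `B`-invariant of `Φ₉`, `Γ₈`. -/
noncomputable def rowB9 : PowerSeries ℚ :=
  pole (-p ^ (-1 : ℤ)) (p ^ (-4 : ℤ)) + pole 1 (p ^ (-3 : ℤ))
    + pole (p ^ (-1 : ℤ)) (p ^ (-1 : ℤ))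

/-- `A`-invariant of `Φ₁₀`. -/
noncomputable def rowA10 : PowerSeries ℚ :=
  pole (1 - p ^ (-1 : ℤ)) (p ^ (-3 : ℤ)) + pole (p ^ (-1 : ℤ) - p ^ (-3 : ℤ)) (p ^ (-2 : ℤ))
    + pole (p ^ (-3 : ℤ) - p ^ (-4 : ℤ)) (p ^ (-1 : ℤ)) + pole (p ^ (-4 : ℤ)) 1

/-- `B`-invariant of `Φ₁₀`. -/
noncomputable def rowB10 : PowerSeries ℚ :=
  pole (-p ^ (-1 : ℤ)) (p ^ (-4 : ℤ)) + pole (1 - p ^ (-2 : ℤ)) (p ^ (-3 : ℤ))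
    + pole (p ^ (-1 : ℤ) + p ^ (-2 : ℤ)) (p ^ (-2 : ℤ))

end Table

/-- Every finite group `G` isoclinic to `K` satisfies `A_G(t/|G|) = a` and `B_G(t/|G|) = b`. -/
def FamilyHasInvariants (K : Type) [Group K] (a b : PowerSeries ℚ) : Prop :=
  ∀ (G : Type u) [Group G] [Finite G], Isoclinic G K → normA G = a ∧ normB G = b

/-- The isoclinism families of `K` and `L` have the same normalized invariants; in particular
finite groups of the same order in the two families have equal series `A` and equal series `B`. -/
def FamiliesAgree (K L : Type) [Group K] [Group L] : Prop :=
  ∀ (G : Type u) (H : Type v) [Group G] [Finite G] [Group H] [Finite H],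
    Isoclinic G K → Isoclinic H L →
      normA G = normA H ∧ normB G = normB H ∧
        (Nat.card G = Nat.card H → seriesA G = seriesA H ∧ seriesB G = seriesB H)

/-! ### Burnside's lemma and densities of commuting tuples -/

section Counting

/-! By Burnside's lemma, `α_n |G|` counts the `(n+1)`-tuples whose zeroth entry commutes with all
entries, and `β_n |G|` counts the commuting `(n+1)`-tuples. The substitution `t / |G|` turns these
counts into proportions among all `(n+1)`-tuples. Such proportions depend only on the commuting
relation induced on `G / Z(G)`, which an isoclinism preserves (`Isoclinic.norm_eq`), so one group
per family has to be computed.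

For a single group, `A` needs only the distribution of the relative centralizer orders
(`coeff_normA`). `B` obeys a recursion (`commDensity_succ`): the density of commuting `(m+1)`-tuples
is the average over `x` of `(|C(x)| / |G|)^m` times the density of commuting `m`-tuples in `C(x)`.
In the groups at hand there is a chain `Z ≤ Y ≤ M ≤ G` on whose layers the size and the densities of
`C(x)` are constant (`coeffs_of_chain`). The centralizer of a noncentral element is either abelian
or has centre of index `p ^ 2`, so the recursion becomes a linear recurrence solved by sums of
geometric sequences, that is, by the partial fractions of the table.

The layers are found from three facts about a finite `p`-group. The centre of `C(x)` is strictly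
larger than `Z` when `x` is not central, so small centralizers are abelian (`centralizer_commute`).
If all commutators `[g, x]` lie in `N`, then `C(x)` has index at most `|N|`
(`card_le_card_centralizer_mul`), which is applied with `N` the centre or the derived subgroup. If
`A` is an abelian subgroup of index `p` in a nonabelian group, then `|G'| |Z| ≤ |A|`
(`card_commutator_mul_card_center_le`). Hence the orders of `Z`, of the second centre and of `G'`,
together with the presence or absence of an abelian subgroup of index `p`, decide the row.

For a presented group, adjoining the generators one at a time bounds the order from above
(`card_closure_insert_dvd`). An explicit model shows that certain words are nontrivial, and the
resulting chains of subgroups bound the order from below; the two bounds meet and fix all the data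
above. The models are groups of affine maps `y ↦ u y + v` of a commutative ring, central products of
such groups, and for `p = 2` small dihedral or permutation groups. -/

theorem card_pi_succ_subtype {G : Type u} {n : ℕ} (T : (Fin (n + 1) → G) → Prop) :
    Nat.card {x : Fin (n + 1) → G // T x} =
      Nat.card (Σ g : G, {y : Fin n → G // T (Fin.cons g y)}) :=
  Nat.card_congr
    { toFun := fun x => ⟨x.1 0, Fin.tail x.1, by rw [Fin.cons_self_tail]; exact x.2⟩
      invFun := fun y => ⟨Fin.cons y.1 y.2.1, y.2.2⟩
      left_inv := fun x => Subtype.ext (Fin.cons_self_tail x.1)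
      right_inv := fun y => by
        obtain ⟨g, y, hy⟩ := y
        rfl }

variable (G : Type u) [Group G]

/-- Burnside's lemma, with the fixed-point sets collected in one sigma type so that they can be
matched with tuples. -/
theorem card_orbits_mul_card {A : Type u} {X : Type v} [Group A] [MulAction A X] :
    Nat.card (Quotient (MulAction.orbitRel A X)) * Nat.card A =
      Nat.card (Σ g : A, MulAction.fixedBy X g) := by
  rw [← Nat.card_prod]
  exact (Nat.card_congr (MulAction.sigmaFixedByEquivOrbitsProdGroup A X)).symm

theorem ConjAct.smul_eq_self_iff_commute {G : Type u} [Group G] (g : ConjAct G) (x : G) :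
    g • x = x ↔ Commute (ConjAct.ofConjAct g) x := by
  rw [ConjAct.smul_def, mul_inv_eq_iff_eq_mul]; rfl

/-- Tuples whose zeroth entry commutes with all entries. -/
abbrev StarTuple (n : ℕ) : Type u :=
  {x : Fin (n + 1) → G // ∀ i, Commute (x 0) (x i)}

/-- An `n`-tuple fixed under conjugation by `g` becomes a star tuple once `g` is put in front of it.
-/
theorem alphaCount_mul_card (n : ℕ) :
    alphaCount G n * Nat.card G = Nat.card (StarTuple G n) := by
  rw [card_pi_succ_subtype]
  refine (card_orbits_mul_card (A := ConjAct G) (X := Fin n → G)).trans (Nat.card_congr ?_)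
  refine Equiv.sigmaCongr ConjAct.ofConjAct.toEquiv fun g => Equiv.subtypeEquivRight fun y => ?_
  rw [MulAction.mem_fixedBy, Fin.forall_fin_succ, funext_iff]
  simp only [Pi.smul_apply, ConjAct.smul_eq_self_iff_commute, Fin.cons_zero, Fin.cons_succ,
    Commute.refl, true_and]
  rfl

instance conjActCommTuple (n : ℕ) : MulAction (ConjAct G) (CommTuple G n) where
  smul g x := ⟨g • x.1, fun i j => by
    have h := (x.2 i j).map (MulDistribMulAction.toMonoidHom G g)
    exact h⟩
  one_smul x := Subtype.ext (one_smul _ x.1)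
  mul_smul g h x := Subtype.ext (mul_smul g h x.1)

theorem simConjComm_eq_orbitRel (n : ℕ) :
    simConjComm G n = MulAction.orbitRel (ConjAct G) (CommTuple G n) := by
  ext x y
  change (∃ g : ConjAct G, g • y.1 = x.1) ↔ ∃ g : ConjAct G, g • y = x
  exact exists_congr fun g => ⟨fun h => Subtype.ext h, fun h => congrArg Subtype.val h⟩

/-- Putting the fixing element `g` in front of a commuting `n`-tuple gives a commuting tuple of
length `n + 1`; this is the source of the index shift in `coeff_normB`. -/
theorem betaCount_mul_card (n : ℕ) :
    betaCount G n * Nat.card G = Nat.card (CommTuple G (n + 1)) := by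
  have h1 : Nat.card (CommTuple G (n + 1)) = _ :=
    card_pi_succ_subtype (G := G) fun x : Fin (n + 1) → G => ∀ i j, Commute (x i) (x j)
  rw [h1, betaCount, simConjComm_eq_orbitRel]
  refine (card_orbits_mul_card (A := ConjAct G) (X := CommTuple G n)).trans (Nat.card_congr ?_)
  refine Equiv.sigmaCongr ConjAct.ofConjAct.toEquiv fun g => ?_
  refine Equiv.trans ?_ ((Equiv.subtypeSubtypeEquivSubtypeInter
    (fun x : Fin n → G => ∀ i j, Commute (x i) (x j)) (fun x => g • x = x)).trans
      (Equiv.subtypeEquivRight fun y => ?_))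
  · exact Equiv.subtypeEquivRight fun y => by
      rw [MulAction.mem_fixedBy]
      exact ⟨fun h => congrArg Subtype.val h, fun h => Subtype.ext h⟩
  · simp only [Fin.forall_fin_succ, funext_iff, Pi.smul_apply, ConjAct.smul_eq_self_iff_commute,
      Fin.cons_zero, Fin.cons_succ, Commute.refl, true_and, forall_and]
    constructor
    · rintro ⟨h, h'⟩
      exact ⟨fun i => (h' i).symm, h', h⟩
    · rintro ⟨-, h', h⟩
      exact ⟨h, h'⟩

/-- The proportion of commuting `m`-tuples among all `m`-tuples of elements of `G`. -/
noncomputable def commDensity (m : ℕ) : ℚ :=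
  Nat.card (CommTuple G m) / (Nat.card G : ℚ) ^ m

variable {G}

theorem card_ne_zero_rat (G : Type u) [Group G] [Finite G] : (Nat.card G : ℚ) ≠ 0 :=
  Nat.cast_ne_zero.2 Nat.card_pos.ne'

theorem coeff_normB [Finite G] (n : ℕ) :
    PowerSeries.coeff n (normB G) = commDensity G (n + 1) := by
  have h := congrArg (Nat.cast (R := ℚ)) (betaCount_mul_card G n)
  have h0 := card_ne_zero_rat G
  push_cast at h
  rw [normB, PowerSeries.coeff_rescale, seriesB, PowerSeries.coeff_mk, commDensity, ← h,
    inv_pow, pow_succ]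
  field_simp

theorem coeff_normA_star [Finite G] (n : ℕ) :
    PowerSeries.coeff n (normA G) = Nat.card (StarTuple G n) / (Nat.card G : ℚ) ^ (n + 1) := by
  have h := congrArg (Nat.cast (R := ℚ)) (alphaCount_mul_card G n)
  have h0 := card_ne_zero_rat G
  push_cast at h
  rw [normA, PowerSeries.coeff_rescale, seriesA, PowerSeries.coeff_mk, ← h, inv_pow, pow_succ]
  field_simp

/-- Once the zeroth entry `x` of a star tuple is fixed, the other `n` entries range freely over the
centralizer of `x`. -/
theorem coeff_normA [Fintype G] (n : ℕ) :
    PowerSeries.coeff n (normA G) =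
      (∑ x : G, ((Nat.card (Subgroup.centralizer {x}) : ℚ) / Nat.card G) ^ n) / Nat.card G := by
  have h0 := card_ne_zero_rat G
  rw [coeff_normA_star, card_pi_succ_subtype, Nat.card_sigma]
  have : ∀ g : G, Nat.card {y : Fin n → G //
      ∀ i, Commute ((Fin.cons g y : Fin (n + 1) → G) 0) ((Fin.cons g y : Fin (n + 1) → G) i)} =
      Nat.card (Subgroup.centralizer {g}) ^ n := by
    intro g
    have e : Nat.card (Fin n → Subgroup.centralizer {g}) = _ := Nat.card_fun
    rw [Nat.card_fin] at e
    rw [← e]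
    refine Nat.card_congr ((Equiv.subtypeEquivRight fun y => ?_).trans
      (Equiv.subtypePiEquivPi (p := fun _ x => x ∈ Subgroup.centralizer {g})))
    simp only [Fin.forall_fin_succ, Fin.cons_zero, Fin.cons_succ, Commute.refl, true_and,
      Subgroup.mem_centralizer_singleton_iff]
    exact forall_congr' fun i => ⟨fun h => h.symm, fun h => Commute.symm h⟩
  simp only [this]
  push_cast
  simp only [div_pow, ← Finset.sum_div, pow_succ]
  field_simp

/-- Fixing the zeroth entry `x` leaves an arbitrary commuting `m`-tuple inside the centralizer of
`x`. Every `B`-series is computed from this recursion. -/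
theorem commDensity_succ [Fintype G] (m : ℕ) :
    commDensity G (m + 1) =
      (∑ x : G, ((Nat.card (Subgroup.centralizer {x}) : ℚ) / Nat.card G) ^ m *
        commDensity (Subgroup.centralizer {x}) m) / Nat.card G := by
  have h0 := card_ne_zero_rat G
  have h1 : Nat.card (CommTuple G (m + 1)) = _ :=
    card_pi_succ_subtype (G := G) fun x : Fin (m + 1) → G => ∀ i j, Commute (x i) (x j)
  rw [commDensity, h1, Nat.card_sigma]
  have : ∀ g : G, Nat.card {y : Fin m → G // ∀ i j,
      Commute ((Fin.cons g y : Fin (m + 1) → G) i) ((Fin.cons g y : Fin (m + 1) → G) j)} =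
      Nat.card (CommTuple (Subgroup.centralizer {g}) m) := by
    intro g
    refine Nat.card_congr
      { toFun := fun y => ⟨fun i => ⟨y.1 i, ?_⟩, fun i j => ?_⟩
        invFun := fun y => ⟨fun i => (y.1 i : G), ?_⟩
        left_inv := fun y => rfl
        right_inv := fun y => rfl }
    · rw [Subgroup.mem_centralizer_singleton_iff]
      exact y.2 i.succ 0
    · exact Subtype.ext (y.2 i.succ j.succ)
    · have hy : ∀ i, Commute g (y.1 i : G) := fun i =>
        (Subgroup.mem_centralizer_singleton_iff.1 (y.1 i).2 : _ * _ = _ * _).symm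
      simp only [Fin.forall_fin_succ, Fin.cons_zero, Fin.cons_succ, Commute.refl, true_and]
      exact ⟨hy, fun i => ⟨(hy i).symm, fun j => congrArg Subtype.val (y.2 i j)⟩⟩
  simp only [this]
  push_cast
  rw [Finset.sum_div, Finset.sum_div]
  refine Finset.sum_congr rfl fun x _ => ?_
  have := card_ne_zero_rat (Subgroup.centralizer {x})
  rw [commDensity, div_pow, pow_succ]
  field_simp

theorem commDensity_zero [Finite G] : commDensity G 0 = 1 := by
  have : Nat.card (CommTuple G 0) = 1 := by
    rw [Nat.card_eq_one_iff_unique]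
    exact ⟨⟨fun x y => Subtype.ext (Subsingleton.elim _ _)⟩, ⟨⟨Fin.elim0, fun i => i.elim0⟩⟩⟩
  simp [commDensity, this]

theorem commDensity_of_comm [Finite G] (h : ∀ x y : G, Commute x y) (m : ℕ) :
    commDensity G m = 1 := by
  have e : Nat.card (CommTuple G m) = Nat.card G ^ m := by
    have e : Nat.card (Fin m → G) = _ := Nat.card_fun
    rw [Nat.card_fin] at e
    rw [← e]
    exact Nat.card_congr (Equiv.subtypeUnivEquiv fun x i j => h _ _)
  have h0 := card_ne_zero_rat G
  rw [commDensity, e]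
  push_cast
  exact div_self (pow_ne_zero _ h0)

theorem commDensity_congr {H : Type v} [Group H] (e : G ≃* H) (m : ℕ) :
    commDensity G m = commDensity H m := by
  have : Nat.card (CommTuple G m) = Nat.card (CommTuple H m) := by
    refine Nat.card_congr (Equiv.subtypeEquiv (Equiv.arrowCongr (Equiv.refl _) e.toEquiv) ?_)
    intro x
    refine forall_congr' fun i => forall_congr' fun j => ?_
    exact ⟨fun h => h.map e, fun h => by simpa using h.map e.symm⟩
  rw [commDensity, commDensity, this, Nat.card_congr e.toEquiv]

end Counting

/-! ### Invariance of the normalized series under isoclinism -/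

section IsoclinismInvariance

open scoped commutatorElement

variable {G : Type u} {H : Type v} [Group G] [Group H]

/-- The condition sees only the `Y`-components, so the `W`-components are free and contribute the
power of `|W|`. -/
theorem card_subtype_comp_fst {X Y W : Type*} [Finite W] (e : X ≃ Y × W) (k : ℕ)
    (T : (Fin k → Y) → Prop) :
    Nat.card {x : Fin k → X // T fun i => (e (x i)).1} =
      Nat.card {y : Fin k → Y // T y} * Nat.card W ^ k := by
  have h : Nat.card (Fin k → W) = _ := Nat.card_fun
  rw [Nat.card_fin] at h
  rw [← h, ← Nat.card_prod]
  exact Nat.card_congr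
    { toFun := fun x => (⟨fun i => (e (x.1 i)).1, x.2⟩, fun i => (e (x.1 i)).2)
      invFun := fun y => ⟨fun i => e.symm (y.1.1 i, y.2 i), by simpa using y.1.2⟩
      left_inv := fun x => by ext i; simp
      right_inv := fun y => by ext i <;> simp }

/-- Since `φ` is injective, a commutator in `G` vanishes exactly when its counterpart in `H` does.
-/
theorem Isoclinism.commute_iff (I : Isoclinism G H) {g₁ g₂ : G} {h₁ h₂ : H}
    (e₁ : I.θ (QuotientGroup.mk g₁) = QuotientGroup.mk h₁)
    (e₂ : I.θ (QuotientGroup.mk g₂) = QuotientGroup.mk h₂) :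
    Commute g₁ g₂ ↔ Commute h₁ h₂ := by
  rw [← commutatorElement_eq_one_iff_commute, ← commutatorElement_eq_one_iff_commute,
    ← I.compat g₁ g₂ h₁ h₂ e₁ e₂, OneMemClass.coe_eq_one,
    MulEquiv.map_eq_one_iff, ← OneMemClass.coe_eq_one]

/-- The commuting relation induced on the central quotient. -/
def QuotCommute (G : Type u) [Group G] (a b : G ⧸ Subgroup.center G) : Prop :=
  Commute a.out b.out

/-- Central factors cancel in a commutator. This makes `QuotCommute` independent of the chosen
representatives. -/
theorem commutatorElement_eq_of_mk_eq {g₁ g₂ h₁ h₂ : G}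
    (e₁ : (g₁ : G ⧸ Subgroup.center G) = h₁) (e₂ : (g₂ : G ⧸ Subgroup.center G) = h₂) :
    ⁅g₁, g₂⁆ = ⁅h₁, h₂⁆ := by
  rw [QuotientGroup.eq] at e₁ e₂
  obtain ⟨z, hz, rfl⟩ : ∃ z ∈ Subgroup.center G, h₁ = g₁ * z := ⟨_, e₁, by group⟩
  obtain ⟨w, hw, rfl⟩ : ∃ z ∈ Subgroup.center G, h₂ = g₂ * z := ⟨_, e₂, by group⟩
  have hz := Subgroup.mem_center_iff.1 hz
  have hw := Subgroup.mem_center_iff.1 hw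
  rw [commutatorElement_def, commutatorElement_def, mul_inv_rev, mul_inv_rev,
    show g₁ * z * (g₂ * w) * (z⁻¹ * g₁⁻¹) * (w⁻¹ * g₂⁻¹) =
      g₁ * (z * (g₂ * w)) * z⁻¹ * g₁⁻¹ * w⁻¹ * g₂⁻¹ by group, ← hz,
    show g₁ * (g₂ * w * z) * z⁻¹ * g₁⁻¹ * w⁻¹ * g₂⁻¹ =
      g₁ * g₂ * (w * g₁⁻¹) * w⁻¹ * g₂⁻¹ by group, ← hw]
  group

theorem quotCommute_mk (g h : G) :
    QuotCommute G (QuotientGroup.mk g) (QuotientGroup.mk h) ↔ Commute g h := by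
  rw [QuotCommute, ← commutatorElement_eq_one_iff_commute, ← commutatorElement_eq_one_iff_commute,
    commutatorElement_eq_of_mk_eq (QuotientGroup.out_eq' _) (QuotientGroup.out_eq' _)]

/-- Each `k`-tuple of cosets has `|Z| ^ k` lifts, and this factor cancels in the proportion. -/
theorem card_subtype_quotient [Finite G] (k : ℕ)
    (T : (Fin k → G ⧸ Subgroup.center G) → Prop) :
    (Nat.card {x : Fin k → G // T fun i => QuotientGroup.mk (x i)} : ℚ) / (Nat.card G : ℚ) ^ k =
      Nat.card {y : Fin k → G ⧸ Subgroup.center G // T y} /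
        (Nat.card (G ⧸ Subgroup.center G) : ℚ) ^ k := by
  have hz := card_ne_zero_rat (Subgroup.center G)
  have hq := card_ne_zero_rat (G ⧸ Subgroup.center G)
  have e := card_subtype_comp_fst
    (Subgroup.groupEquivQuotientProdSubgroup (s := Subgroup.center G)) k T
  have e' : Nat.card {x : Fin k → G // T fun i => QuotientGroup.mk (x i)} = _ := e
  rw [e', Subgroup.card_eq_card_quotient_mul_card_subgroup (Subgroup.center G)]
  push_cast
  rw [mul_pow]
  field_simp

/-- The coefficients are proportions of tuples defined by commuting alone. They can be computed in
the central quotient, where `θ` preserves and reflects that relation. -/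
theorem Isoclinic.norm_eq [Finite G] [Finite H] (h : Isoclinic G H) :
    normA G = normA H ∧ normB G = normB H := by
  obtain ⟨I⟩ := h
  have key : ∀ a b : G ⧸ Subgroup.center G,
      QuotCommute G a b ↔ QuotCommute H (I.θ a) (I.θ b) := fun a b =>
    I.commute_iff (by simp) (by simp)
  have hcard : Nat.card (G ⧸ Subgroup.center G) = Nat.card (H ⧸ Subgroup.center H) :=
    Nat.card_congr I.θ.toEquiv
  constructor <;> ext n
  · have hG := card_subtype_quotient (G := G) (n + 1) fun y => ∀ i, QuotCommute G (y 0) (y i)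
    have hH := card_subtype_quotient (G := H) (n + 1) fun y => ∀ i, QuotCommute H (y 0) (y i)
    simp only [quotCommute_mk] at hG hH
    rw [coeff_normA_star, coeff_normA_star, hG, hH, hcard]
    congr 2
    refine Nat.card_congr (Equiv.subtypeEquiv (Equiv.arrowCongr (Equiv.refl _) I.θ.toEquiv) ?_)
    exact fun x => forall_congr' fun i => key _ _
  · have hG := card_subtype_quotient (G := G) (n + 1) fun y => ∀ i j, QuotCommute G (y i) (y j)
    have hH := card_subtype_quotient (G := H) (n + 1) fun y => ∀ i j, QuotCommute H (y i) (y j)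
    simp only [quotCommute_mk] at hG hH
    rw [coeff_normB, coeff_normB]
    refine hG.trans (Eq.trans ?_ hH.symm)
    rw [hcard]
    congr 2
    refine Nat.card_congr (Equiv.subtypeEquiv (Equiv.arrowCongr (Equiv.refl _) I.θ.toEquiv) ?_)
    exact fun x => forall_congr' fun i => forall_congr' fun j => key _ _

end IsoclinismInvariance

/-! ### Power series coefficients of a simple pole -/

section Poles

theorem coeff_pole (c r : ℚ) (n : ℕ) : PowerSeries.coeff n (pole c r) = c * r ^ n := by
  have h : (1 - PowerSeries.C r * PowerSeries.X : PowerSeries ℚ)⁻¹ =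
      PowerSeries.mk fun n => r ^ n := by
    symm
    rw [PowerSeries.eq_inv_iff_mul_eq_one (by simp), mul_sub, mul_one]
    ext n
    cases n with
    | zero => simp
    | succ n =>
      rw [map_sub, PowerSeries.coeff_mk, mul_comm (PowerSeries.C r), ← mul_assoc,
        PowerSeries.coeff_mul_C, PowerSeries.coeff_succ_mul_X, PowerSeries.coeff_mk,
        PowerSeries.coeff_one, if_neg (Nat.succ_ne_zero n), pow_succ, sub_self]
  rw [pole, h, PowerSeries.coeff_C_mul, PowerSeries.coeff_mk]

end Poles

/-! ### Averages over a group stratified by a chain of subgroups -/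

section Chains

variable {G : Type u} [Group G]

theorem sum_of_chain [Fintype G] {Z Y M : Subgroup G} (hZY : Z ≤ Y) (hYM : Y ≤ M) {F : G → ℚ}
    {a b c d : ℚ} (ha : ∀ x ∈ Z, F x = a) (hb : ∀ x ∈ Y, x ∉ Z → F x = b)
    (hc : ∀ x ∈ M, x ∉ Y → F x = c) (hd : ∀ x, x ∉ M → F x = d) :
    ∑ x, F x = Nat.card Z * a + (Nat.card Y - Nat.card Z) * b +
      (Nat.card M - Nat.card Y) * c + (Nat.card G - Nat.card M) * d := by
  classical
  have hind : ∀ (H : Subgroup G) (e : ℚ), ∑ x : G, (if x ∈ H then e else 0) = Nat.card H * e := by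
    intro H e
    rw [← Finset.sum_filter, Finset.sum_const, nsmul_eq_mul, Nat.card_eq_fintype_card,
      Fintype.card_subtype]
  -- Writing the layered function as a telescoping combination of indicators of nested subgroups
  -- reduces its sum to their orders.
  have hF : ∀ x, F x = (if x ∈ Z then a - b else 0) + (if x ∈ Y then b - c else 0) +
      (if x ∈ M then c - d else 0) + (if x ∈ (⊤ : Subgroup G) then d else 0) := by
    intro x
    rw [if_pos (Subgroup.mem_top x)]
    by_cases hM : x ∈ M
    · by_cases hY : x ∈ Y
      · by_cases hZ : x ∈ Z
        · rw [if_pos hZ, if_pos hY, if_pos hM, ha x hZ]; ring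
        · rw [if_neg hZ, if_pos hY, if_pos hM, hb x hY hZ]; ring
      · rw [if_neg fun h => hY (hZY h), if_neg hY, if_pos hM, hc x hM hY]; ring
    · have hY : x ∉ Y := fun h => hM (hYM h)
      rw [if_neg fun h => hY (hZY h), if_neg hY, if_neg hM, hd x hM]; ring
  simp only [hF, Finset.sum_add_distrib, hind, Subgroup.card_top]
  ring

/-- The centralizer of `x` has relative size `r` and densities of commuting tuples `D`. -/
def CentralizerType (x : G) (r : ℚ) (D : ℕ → ℚ) : Prop :=
  (Nat.card (Subgroup.centralizer {x}) : ℚ) / Nat.card G = r ∧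
    ∀ m, commDensity (Subgroup.centralizer {x}) m = D m

theorem centralizerType_of_mem_center [Finite G] {x : G} (hx : x ∈ Subgroup.center G) :
    CentralizerType x 1 (commDensity G) := by
  have h : Subgroup.centralizer {x} = ⊤ := by
    rw [Subgroup.centralizer_eq_top_iff_subset, Set.singleton_subset_iff]
    exact hx
  have h0 := card_ne_zero_rat G
  refine ⟨by rw [h, Subgroup.card_top, div_self h0], fun m => ?_⟩
  rw [h, commDensity_congr Subgroup.topEquiv]

/-- A central element has all of `G` as centralizer, so the centre feeds `commDensity G k` back into
the formula and a linear recurrence results. Shorter chains are covered by letting consecutive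
subgroups coincide. -/
theorem coeffs_of_chain [Finite G] {Y M : Subgroup G} (hZY : Subgroup.center G ≤ Y)
    (hYM : Y ≤ M) {r₁ r₂ r₃ : ℚ} {D₁ D₂ D₃ : ℕ → ℚ}
    (h₁ : ∀ x ∈ Y, x ∉ Subgroup.center G → CentralizerType x r₁ D₁)
    (h₂ : ∀ x ∈ M, x ∉ Y → CentralizerType x r₂ D₂)
    (h₃ : ∀ x, x ∉ M → CentralizerType x r₃ D₃) {z y m : ℚ}
    (hz : (Nat.card (Subgroup.center G) : ℚ) = z * Nat.card G)
    (hy : (Nat.card Y : ℚ) = y * Nat.card G) (hm : (Nat.card M : ℚ) = m * Nat.card G) :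
    (∀ n, PowerSeries.coeff n (normA G) =
      z + (y - z) * r₁ ^ n + (m - y) * r₂ ^ n + (1 - m) * r₃ ^ n) ∧
    ∀ k, commDensity G (k + 1) = z * commDensity G k + (y - z) * (r₁ ^ k * D₁ k) +
      (m - y) * (r₂ ^ k * D₂ k) + (1 - m) * (r₃ ^ k * D₃ k) := by
  have := Fintype.ofFinite G
  have h0 := card_ne_zero_rat G
  constructor
  · intro n
    rw [coeff_normA, sum_of_chain hZY hYM
      (fun x hx => by rw [(centralizerType_of_mem_center hx).1])
      (fun x hx hx' => by rw [(h₁ x hx hx').1]) (fun x hx hx' => by rw [(h₂ x hx hx').1])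
      (fun x hx => by rw [(h₃ x hx).1]), hz, hy, hm]
    field_simp
    ring
  · intro k
    rw [commDensity_succ, sum_of_chain hZY hYM
      (fun x hx => by rw [(centralizerType_of_mem_center hx).1,
        (centralizerType_of_mem_center hx).2 k])
      (fun x hx hx' => by rw [(h₁ x hx hx').1, (h₁ x hx hx').2 k])
      (fun x hx hx' => by rw [(h₂ x hx hx').1, (h₂ x hx hx').2 k])
      (fun x hx => by rw [(h₃ x hx).1, (h₃ x hx).2 k]), hz, hy, hm]
    field_simp
    ring

end Chains

/-! ### Solving the recurrences: the rows of the table -/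

section Rows

variable {G : Type u} [Group G] [Finite G]

/-- The density of commuting `m`-tuples in a group whose centre has index `p ^ 2`. -/
noncomputable def heisDensity (p : ℚ) (m : ℕ) : ℚ :=
  (p + 1) * (p⁻¹) ^ m - p * ((p⁻¹) ^ m) ^ 2

theorem zpow_neg_eq_inv_pow (p : ℚ) (k : ℕ) : p ^ (-(k : ℤ)) = (p⁻¹) ^ k := by
  rw [zpow_neg, zpow_natCast, inv_pow]

theorem zpow_neg_table (p : ℚ) : p ^ (-1 : ℤ) = p⁻¹ ∧ p ^ (-2 : ℤ) = p⁻¹ ^ 2 ∧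
    p ^ (-3 : ℤ) = p⁻¹ ^ 3 ∧ p ^ (-4 : ℤ) = p⁻¹ ^ 4 :=
  ⟨by simp, zpow_neg_eq_inv_pow p 2, zpow_neg_eq_inv_pow p 3,
    zpow_neg_eq_inv_pow p 4⟩

/-- An abelian subgroup `A` of index `p` containing the centre, which has index `p * (p * q)`. -/
theorem coeffs_of_abelian_index {A : Subgroup G} (hZA : Subgroup.center G ≤ A) {p q : ℚ}
    (hp : p ≠ 0) (hq : q ≠ 0)
    (h₁ : ∀ x ∈ A, x ∉ Subgroup.center G → CentralizerType x p⁻¹ fun _ => 1)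
    (h₂ : ∀ x, x ∉ A → CentralizerType x q⁻¹ fun _ => 1)
    (hz : (Nat.card (Subgroup.center G) : ℚ) = p⁻¹ * q⁻¹ * Nat.card G)
    (hA : (Nat.card A : ℚ) = p⁻¹ * Nat.card G) :
    (∀ n, PowerSeries.coeff n (normA G) =
      p⁻¹ * q⁻¹ + (p⁻¹ - p⁻¹ * q⁻¹) * p⁻¹ ^ n + (1 - p⁻¹) * q⁻¹ ^ n) ∧
    ∀ k, commDensity G k = p⁻¹ ^ k + q * q⁻¹ ^ k - q * (p⁻¹ * q⁻¹) ^ k := by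
  -- With `Y = M = A` the middle layer is empty, so `r₂` and `D₂` are arbitrary fillers. By `hz` the
  -- centre has index `p * q` in `G`.
  obtain ⟨h, h'⟩ := coeffs_of_chain (M := A) hZA le_rfl (r₂ := 0) (D₂ := fun _ => 1) h₁
    (fun x hx hx' => absurd hx hx') h₂ hz hA hA
  refine ⟨fun n => by rw [h]; ring, fun k => ?_⟩
  induction k with
  | zero => rw [commDensity_zero]; ring
  | succ k ih =>
    rw [h', ih, pow_succ, pow_succ, pow_succ, mul_pow]
    field_simp
    ring

theorem row2_of_abelian {p : ℚ} (hp : p ≠ 0)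
    (h₁ : ∀ x : G, x ∉ Subgroup.center G → CentralizerType x p⁻¹ fun _ => 1)
    (hz : (Nat.card (Subgroup.center G) : ℚ) = p⁻¹ ^ 2 * Nat.card G) :
    normA G = rowA2 p ∧ normB G = rowB2 p ∧ ∀ k, commDensity G k = heisDensity p k := by
  -- All noncentral elements form one layer; the two outer layers are empty and carry filler values.
  obtain ⟨h, h'⟩ := coeffs_of_chain (Y := ⊤) (M := ⊤) le_top le_rfl (r₂ := 0) (D₂ := fun _ => 1)
    (r₃ := 0) (D₃ := fun _ => 1) (fun x _ => h₁ x) (fun x hx hx' => absurd hx hx')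
    (fun x hx => absurd (Subgroup.mem_top x) hx) hz (y := 1) (m := 1) (by simp) (by simp)
  obtain ⟨e1, e2, e3, e4⟩ := zpow_neg_table p
  have key : ∀ k, commDensity G k = heisDensity p k := by
    intro k
    induction k with
    | zero => rw [commDensity_zero, heisDensity]; ring
    | succ k ih =>
      rw [h', ih, heisDensity, heisDensity, pow_succ p⁻¹ k]
      field_simp
      ring
  refine ⟨?_, ?_, key⟩
  · ext n
    rw [h, rowA2, map_add, coeff_pole, coeff_pole, e1, e2, one_pow]; ring
  · ext n
    rw [coeff_normB, key, heisDensity, rowB2, map_add, coeff_pole, coeff_pole, e1, e2,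
      pow_succ p⁻¹ n, ← pow_mul, mul_comm 2 n, pow_mul]
    field_simp
    ring

theorem row3_of_abelian_index {A : Subgroup G} (hZA : Subgroup.center G ≤ A) {p : ℚ} (hp : p ≠ 0)
    (h₁ : ∀ x ∈ A, x ∉ Subgroup.center G → CentralizerType x p⁻¹ fun _ => 1)
    (h₂ : ∀ x, x ∉ A → CentralizerType x (p⁻¹ ^ 2) fun _ => 1)
    (hz : (Nat.card (Subgroup.center G) : ℚ) = p⁻¹ ^ 3 * Nat.card G)
    (hA : (Nat.card A : ℚ) = p⁻¹ * Nat.card G) :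
    normA G = rowA3 p ∧ normB G = rowB3 p := by
  obtain ⟨h, h'⟩ := coeffs_of_abelian_index hZA hp (pow_ne_zero 2 hp) h₁
    (by rwa [← inv_pow]) (by rw [hz]; ring) hA
  obtain ⟨e1, e2, e3, e4⟩ := zpow_neg_table p
  constructor <;> ext n
  · rw [h, rowA3]
    simp only [map_add, coeff_pole, e1, e2, e3, one_pow, inv_pow]
    ring
  · rw [coeff_normB, h', rowB3]
    simp only [map_add, coeff_pole, e1, e2, e3, ← pow_mul, inv_pow, mul_pow]
    field_simp
    ring

theorem row9_of_abelian_index {A : Subgroup G} (hZA : Subgroup.center G ≤ A) {p : ℚ} (hp : p ≠ 0)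
    (h₁ : ∀ x ∈ A, x ∉ Subgroup.center G → CentralizerType x p⁻¹ fun _ => 1)
    (h₂ : ∀ x, x ∉ A → CentralizerType x (p⁻¹ ^ 3) fun _ => 1)
    (hz : (Nat.card (Subgroup.center G) : ℚ) = p⁻¹ ^ 4 * Nat.card G)
    (hA : (Nat.card A : ℚ) = p⁻¹ * Nat.card G) :
    normA G = rowA9 p ∧ normB G = rowB9 p := by
  obtain ⟨h, h'⟩ := coeffs_of_abelian_index hZA hp (pow_ne_zero 3 hp) h₁
    (by rwa [← inv_pow]) (by rw [hz]; ring) hA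
  obtain ⟨e1, e2, e3, e4⟩ := zpow_neg_table p
  constructor <;> ext n
  · rw [h, rowA9]
    simp only [map_add, coeff_pole, e1, e3, e4, one_pow, inv_pow]
    ring
  · rw [coeff_normB, h', rowB9]
    simp only [map_add, coeff_pole, e1, e3, e4, ← pow_mul, inv_pow, mul_pow]
    field_simp
    ring

theorem row5_of_centralizers {p : ℚ} (hp : p ≠ 0)
    (h₁ : ∀ x : G, x ∉ Subgroup.center G → CentralizerType x p⁻¹ (heisDensity p))
    (hz : (Nat.card (Subgroup.center G) : ℚ) = p⁻¹ ^ 4 * Nat.card G) :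
    normA G = rowA5 p ∧ normB G = rowB5 p := by
  obtain ⟨h, h'⟩ := coeffs_of_chain (Y := ⊤) (M := ⊤) le_top le_rfl (r₂ := 0) (D₂ := fun _ => 1)
    (r₃ := 0) (D₃ := fun _ => 1) (fun x _ => h₁ x) (fun x hx hx' => absurd hx hx')
    (fun x hx => absurd (Subgroup.mem_top x) hx) hz (y := 1) (m := 1) (by simp) (by simp)
  obtain ⟨e1, e2, e3, e4⟩ := zpow_neg_table p
  -- This is the `B`-row shifted by one: since `coeff n` of `normB` is the density at `n + 1`, a
  -- pole with numerator `c` and ratio `r` contributes `c r⁻¹ r ^ k` to the density at `k`.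
  have key : ∀ k, commDensity G k = p ^ 4 * (p⁻¹ ^ k) ^ 4 -
      (p ^ 4 + p ^ 3 + p ^ 2 + p) * (p⁻¹ ^ k) ^ 3 +
      (p ^ 3 + p ^ 2 + p + 1) * (p⁻¹ ^ k) ^ 2 := by
    intro k
    induction k with
    | zero => rw [commDensity_zero]; ring
    | succ k ih =>
      rw [h', ih, heisDensity, pow_succ p⁻¹ k]
      generalize p⁻¹ ^ k = w
      field_simp
      ring
  constructor <;> ext n
  · rw [h, rowA5]
    simp only [map_add, coeff_pole, e1, e4, one_pow]
    ring
  · rw [coeff_normB, key, rowB5, pow_succ p⁻¹ n]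
    simp only [map_add, coeff_pole, e1, e2, e3, e4, ← pow_mul _ _ n, mul_comm _ n]
    simp only [pow_mul]
    generalize p⁻¹ ^ n = w
    field_simp
    ring

theorem row6_of_centralizers {p : ℚ} (hp : p ≠ 0)
    (h₁ : ∀ x : G, x ∉ Subgroup.center G → CentralizerType x (p⁻¹ ^ 2) fun _ => 1)
    (hz : (Nat.card (Subgroup.center G) : ℚ) = p⁻¹ ^ 3 * Nat.card G) :
    normA G = rowA6 p ∧ normB G = rowB6 p := by
  obtain ⟨h, h'⟩ := coeffs_of_chain (Y := ⊤) (M := ⊤) le_top le_rfl (r₂ := 0) (D₂ := fun _ => 1)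
    (r₃ := 0) (D₃ := fun _ => 1) (fun x _ => h₁ x) (fun x hx hx' => absurd hx hx')
    (fun x hx => absurd (Subgroup.mem_top x) hx) hz (y := 1) (m := 1) (by simp) (by simp)
  obtain ⟨e1, e2, e3, e4⟩ := zpow_neg_table p
  have key : ∀ k, commDensity G k = (p ^ 2 + p + 1) * (p⁻¹ ^ k) ^ 2 -
      (p ^ 2 + p) * (p⁻¹ ^ k) ^ 3 := by
    intro k
    induction k with
    | zero => rw [commDensity_zero]; ring
    | succ k ih =>
      rw [h', ih, pow_succ p⁻¹ k, ← pow_mul _ 2 k, mul_comm 2 k, pow_mul]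
      generalize p⁻¹ ^ k = w
      field_simp
      ring
  constructor <;> ext n
  · rw [h, rowA6]
    simp only [map_add, coeff_pole, e2, e3, one_pow]
    ring
  · rw [coeff_normB, key, rowB6, pow_succ p⁻¹ n]
    simp only [map_add, coeff_pole, e1, e2, e3, ← pow_mul _ _ n, mul_comm _ n]
    simp only [pow_mul]
    generalize p⁻¹ ^ n = w
    field_simp
    ring

theorem row7_of_centralizers {Y : Subgroup G} (hZY : Subgroup.center G ≤ Y) {p : ℚ} (hp : p ≠ 0)
    (h₁ : ∀ x ∈ Y, x ∉ Subgroup.center G → CentralizerType x p⁻¹ (heisDensity p))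
    (h₂ : ∀ x, x ∉ Y → CentralizerType x (p⁻¹ ^ 2) fun _ => 1)
    (hz : (Nat.card (Subgroup.center G) : ℚ) = p⁻¹ ^ 4 * Nat.card G)
    (hY : (Nat.card Y : ℚ) = p⁻¹ ^ 2 * Nat.card G) :
    normA G = rowA7 p ∧ normB G = rowB7 p := by
  obtain ⟨h, h'⟩ := coeffs_of_chain (M := Y) hZY le_rfl (r₂ := 0) (D₂ := fun _ => 1) h₁
    (fun x hx hx' => absurd hx hx') h₂ hz hY hY
  obtain ⟨e1, e2, e3, e4⟩ := zpow_neg_table p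
  -- The recurrence differs from the one in `row6_of_centralizers`, but the solution is the same;
  -- hence equal `B`-rows beside different `A`-rows.
  have key : ∀ k, commDensity G k = (p ^ 2 + p + 1) * (p⁻¹ ^ k) ^ 2 -
      (p ^ 2 + p) * (p⁻¹ ^ k) ^ 3 := by
    intro k
    induction k with
    | zero => rw [commDensity_zero]; ring
    | succ k ih =>
      rw [h', ih, heisDensity, pow_succ p⁻¹ k, ← pow_mul _ 2 k, mul_comm 2 k, pow_mul]
      generalize p⁻¹ ^ k = w
      field_simp
      ring
  constructor <;> ext n
  · rw [h, rowA7]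
    simp only [map_add, coeff_pole, e1, e2, e4, one_pow]
    ring
  · rw [coeff_normB, key, rowB7, pow_succ p⁻¹ n]
    simp only [map_add, coeff_pole, e1, e2, e3, ← pow_mul _ _ n, mul_comm _ n]
    simp only [pow_mul]
    generalize p⁻¹ ^ n = w
    field_simp
    ring

theorem row10_of_centralizers {Y M : Subgroup G} (hZY : Subgroup.center G ≤ Y) (hYM : Y ≤ M)
    {p : ℚ} (hp : p ≠ 0)
    (h₁ : ∀ x ∈ Y, x ∉ Subgroup.center G → CentralizerType x p⁻¹ (heisDensity p))
    (h₂ : ∀ x ∈ M, x ∉ Y → CentralizerType x (p⁻¹ ^ 2) fun _ => 1)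
    (h₃ : ∀ x, x ∉ M → CentralizerType x (p⁻¹ ^ 3) fun _ => 1)
    (hz : (Nat.card (Subgroup.center G) : ℚ) = p⁻¹ ^ 4 * Nat.card G)
    (hY : (Nat.card Y : ℚ) = p⁻¹ ^ 3 * Nat.card G)
    (hM : (Nat.card M : ℚ) = p⁻¹ * Nat.card G) :
    normA G = rowA10 p ∧ normB G = rowB10 p := by
  obtain ⟨h, h'⟩ := coeffs_of_chain hZY hYM h₁ h₂ h₃ hz hY hM
  obtain ⟨e1, e2, e3, e4⟩ := zpow_neg_table p
  have key : ∀ k, commDensity G k = (p + 1) * (p⁻¹ ^ k) ^ 2 +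
      (p ^ 3 - p) * (p⁻¹ ^ k) ^ 3 - p ^ 3 * (p⁻¹ ^ k) ^ 4 := by
    intro k
    induction k with
    | zero => rw [commDensity_zero]; ring
    | succ k ih =>
      rw [h', ih, heisDensity, pow_succ p⁻¹ k]
      simp only [← pow_mul _ _ k, mul_comm _ k]
      simp only [pow_mul]
      generalize p⁻¹ ^ k = w
      field_simp
      ring
  constructor <;> ext n
  · rw [h, rowA10]
    simp only [map_add, coeff_pole, e1, e2, e3, e4, one_pow]
    ring
  · rw [coeff_normB, key, rowB10, pow_succ p⁻¹ n]
    simp only [map_add, coeff_pole, e1, e2, e3, e4, ← pow_mul _ _ n, mul_comm _ n]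
    simp only [pow_mul]
    generalize p⁻¹ ^ n = w
    field_simp
    ring

theorem norm_of_comm (h : ∀ x y : G, Commute x y) : normA G = pole 1 1 ∧ normB G = pole 1 1 := by
  have hc : Subgroup.center G = ⊤ := by
    rw [eq_top_iff]
    exact fun x _ => Subgroup.mem_center_iff.2 fun y => h y x
  constructor <;> ext n
  · have := Fintype.ofFinite G
    have h0 := card_ne_zero_rat G
    have h1 : ∀ x : G, (Nat.card (Subgroup.centralizer {x}) : ℚ) / Nat.card G = 1 := fun x =>
      (centralizerType_of_mem_center (by rw [hc]; exact Subgroup.mem_top x)).1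
    rw [coeff_normA, coeff_pole]
    simp only [h1, one_pow, Finset.sum_const, Finset.card_univ, nsmul_eq_mul, mul_one,
      ← Nat.card_eq_fintype_card]
    exact div_self h0
  · rw [coeff_normB, commDensity_of_comm h, coeff_pole, one_pow, mul_one]

end Rows

/-! ### Centres, centralizers and second centres of finite p-groups -/

section PGroups

open Subgroup
open scoped commutatorElement

variable {G : Type u} [Group G] {p n : ℕ} [hp : Fact p.Prime]

theorem Subgroup.card_pos_exponent (hG : Nat.card G = p ^ n) (H : Subgroup G) :
    ∃ k ≤ n, Nat.card H = p ^ k :=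
  (Nat.dvd_prime_pow hp.out).1 (hG ▸ card_subgroup_dvd_card H)

theorem Subgroup.index_eq_pow {H : Subgroup G} {a b : ℕ} (hG : Nat.card G = p ^ (a + b))
    (hH : Nat.card H = p ^ a) : H.index = p ^ b := by
  have := H.card_mul_index
  rw [hG, hH, pow_add] at this
  exact Nat.eq_of_mul_eq_mul_left (pow_pos hp.out.pos a) this

theorem Subgroup.self_mem_centralizer (x : G) : x ∈ centralizer {x} :=
  mem_centralizer_singleton_iff.2 rfl

theorem Subgroup.centralizer_ne_top {x : G} (hx : x ∉ center G) : centralizer {x} ≠ ⊤ := by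
  intro h
  rw [centralizer_eq_top_iff_subset, Set.singleton_subset_iff] at h
  exact hx h

theorem Subgroup.center_lt_centralizer {x : G} (hx : x ∉ center G) :
    center G < centralizer {x} :=
  lt_of_le_of_ne (center_le_centralizer _) fun h => hx (h ▸ self_mem_centralizer x)

/-- The elements that are central modulo the centre. -/
def Subgroup.secondCenter (G : Type u) [Group G] : Subgroup G :=
  (center (G ⧸ center G)).comap (QuotientGroup.mk' (center G))

theorem Subgroup.mem_secondCenter_iff {x : G} :
    x ∈ secondCenter G ↔ ∀ g : G, ⁅g, x⁆ ∈ center G := by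
  rw [secondCenter, mem_comap, mem_center_iff]
  constructor
  · intro h g
    rw [← QuotientGroup.eq_one_iff, QuotientGroup.mk'_apply] at *
    have := h g
    rw [commutatorElement_def, QuotientGroup.mk_mul, QuotientGroup.mk_mul, QuotientGroup.mk_mul,
      this,
      QuotientGroup.mk_inv, QuotientGroup.mk_inv, mul_inv_cancel_right, mul_inv_cancel]
  · intro h g
    obtain ⟨g, rfl⟩ := QuotientGroup.mk_surjective g
    have := h g
    rw [← QuotientGroup.eq_one_iff, commutatorElement_def, QuotientGroup.mk_mul,
      QuotientGroup.mk_mul,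
      QuotientGroup.mk_mul, QuotientGroup.mk_inv, QuotientGroup.mk_inv] at this
    rw [QuotientGroup.mk'_apply]
    rwa [mul_inv_eq_one, mul_inv_eq_iff_eq_mul] at this

theorem Subgroup.center_le_secondCenter : center G ≤ secondCenter G := by
  intro x hx
  rw [mem_secondCenter_iff]
  intro g
  rw [commutatorElement_eq_one_iff_mul_comm.2 (mem_center_iff.1 hx g)]
  exact one_mem _

theorem commute_of_mem_center_or (h : ∀ x : G, x ∈ center G) (x y : G) :
    Commute x y :=
  mem_center_iff.1 (h y) x

theorem card_cast_eq {H : Subgroup G} {a b : ℕ} (hG : Nat.card G = p ^ (a + b))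
    (hH : Nat.card H = p ^ a) : (Nat.card H : ℚ) = (p : ℚ)⁻¹ ^ b * Nat.card G := by
  have h0 : (p : ℚ) ≠ 0 := Nat.cast_ne_zero.2 hp.out.ne_zero
  rw [hG, hH]
  push_cast
  rw [pow_add, inv_pow]
  field_simp

theorem Subgroup.normal_of_card_eq {A : Subgroup G} (hG : Nat.card G = p ^ (n + 1))
    (hA : Nat.card A = p ^ n) : A.Normal := by
  refine normal_of_index_eq_minFac_card ?_
  rw [index_eq_pow hG hA, hG, hp.out.pow_minFac n.succ_ne_zero, pow_one]

/-- Since `A` is normal of index `p`, its relative index in `C` divides `p`, and `x` excludes the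
value `1`. -/
theorem exponent_inf_of_notMem {A : Subgroup G} (hG : Nat.card G = p ^ (n + 1))
    (hA : Nat.card A = p ^ n)
    {C : Subgroup G} {x : G} (hxC : x ∈ C) (hxA : x ∉ A) {c : ℕ}
    (hC : Nat.card ((A ⊓ C : Subgroup G)) = p ^ c) : Nat.card C = p ^ (c + 1) := by
  have hN := normal_of_card_eq hG hA
  have h1 : A.relIndex C ∣ p := by
    have := relIndex_dvd_index_of_normal A C
    rwa [index_eq_pow hG hA, pow_one] at this
  have h2 : A.relIndex C = p := by
    refine ((Nat.dvd_prime hp.out).1 h1).resolve_left fun h => hxA ?_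
    exact relIndex_eq_one.1 h hxC
  have h3 := relIndex_mul_relIndex (⊥ : Subgroup G) (A ⊓ C) C bot_le inf_le_right
  rw [relIndex_bot_left, relIndex_bot_left, inf_relIndex_right, h2, hC, ← pow_succ] at h3
  exact h3.symm

variable [Finite G]

theorem Subgroup.card_lt_of_lt {H K : Subgroup G} (h : H < K) : Nat.card H < Nat.card K := by
  by_contra hc
  exact h.ne (eq_of_le_of_card_ge h.le (not_lt.1 hc))

theorem Subgroup.exponent_lt_of_lt {H K : Subgroup G} {a b : ℕ} (hH : Nat.card H = p ^ a)
    (hK : Nat.card K = p ^ b) (h : H < K) : a < b := by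
  have := card_lt_of_lt h
  rw [hH, hK] at this
  exact (Nat.pow_lt_pow_iff_right hp.out.one_lt).1 this

theorem Subgroup.eq_of_le_of_exponent_le {H K : Subgroup G} {a b : ℕ} (hH : Nat.card H = p ^ a)
    (hK : Nat.card K = p ^ b) (h : H ≤ K) (hab : b ≤ a) : H = K := by
  refine eq_of_le_of_card_ge h ?_
  rw [hH, hK]
  exact Nat.pow_le_pow_right hp.out.pos hab

theorem Subgroup.eq_top_of_lt_of_card {A K : Subgroup G} (hG : Nat.card G = p ^ (n + 1))
    (hA : Nat.card A = p ^ n) (h : A < K) : K = ⊤ := by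
  obtain ⟨k, -, hk⟩ := card_pos_exponent hG K
  have := exponent_lt_of_lt hA hk h
  exact eq_of_le_of_exponent_le hk (by rw [card_top, hG]) le_top this

theorem Subgroup.eq_top_of_notMem {A K : Subgroup G} (hG : Nat.card G = p ^ (n + 1))
    (hA : Nat.card A = p ^ n) (hAK : A ≤ K) {t : G} (ht : t ∉ A) (htK : t ∈ K) : K = ⊤ :=
  eq_top_of_lt_of_card hG hA (lt_of_le_of_ne hAK fun h => ht (h ▸ htK))

theorem Subgroup.card_comap_mk' (N : Subgroup G) [N.Normal] (H : Subgroup (G ⧸ N)) :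
    Nat.card (H.comap (QuotientGroup.mk' N)) = Nat.card H * Nat.card N := by
  have h : (H.comap (QuotientGroup.mk' N)).index = H.index :=
    index_comap_of_surjective _ (QuotientGroup.mk'_surjective _)
  have h1 := (H.comap (QuotientGroup.mk' N)).card_mul_index
  have h2 := H.card_mul_index
  have h3 := card_eq_card_quotient_mul_card_subgroup N
  have h4 : 0 < H.index := Nat.pos_of_ne_zero index_ne_zero_of_finite
  rw [h3, ← h2, h] at h1
  exact Nat.eq_of_mul_eq_mul_right h4 (by rw [h1]; ring)

theorem Subgroup.card_secondCenter :
    Nat.card (secondCenter G) = Nat.card (center (G ⧸ center G)) * Nat.card (center G) :=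
  card_comap_mk' _ _

/-- A finite group whose centre has prime (or trivial) index is abelian. -/
theorem commute_of_card_center {k : ℕ} (hG : Nat.card G = p ^ n)
    (hZ : Nat.card (center G) = p ^ k) (h : n ≤ k + 1) (x y : G) : Commute x y := by
  rcases h.lt_or_eq with h | rfl
  · have : center G = ⊤ := eq_of_le_of_exponent_le hZ (by rw [card_top, hG]) le_top (by omega)
    exact commute_of_mem_center_or (fun x => this ▸ mem_top x) x y
  · have h1 : Nat.card (G ⧸ center G) = p := by
      rw [← index_eq_card, index_eq_pow hG hZ, pow_one]
    have : IsCyclic (G ⧸ center G) := isCyclic_of_prime_card h1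
    exact (MonoidHom.isMulCommutative_of_isCyclic_of_ker_le_center (QuotientGroup.mk' (center G))
      (by rw [QuotientGroup.ker_mk'])).is_comm.comm x y

/-- The centre of `C(x)` contains both `Z(G)` and the noncentral element `x` itself. -/
theorem card_center_centralizer {x : G} (hx : x ∉ center G) (hG : Nat.card G = p ^ n) {k : ℕ}
    (hZ : Nat.card (center G) = p ^ k) :
    ∃ j, k < j ∧ Nat.card (center (centralizer {x})) = p ^ j := by
  set C := centralizer {x}
  have hcard : Nat.card ((center C).map C.subtype) = Nat.card (center C) :=
    card_map_of_injective C.subtype_injective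
  have hlt : center G < (center C).map C.subtype := by
    refine lt_of_le_of_ne (fun z hz => ?_) fun h => hx ?_
    · refine ⟨⟨z, center_le_centralizer _ hz⟩, mem_center_iff.2 fun c => ?_, rfl⟩
      exact Subtype.ext (mem_center_iff.1 hz c)
    · rw [h]
      refine ⟨⟨x, self_mem_centralizer x⟩, mem_center_iff.2 fun c => ?_, rfl⟩
      exact Subtype.ext (mem_centralizer_singleton_iff.1 c.2)
  obtain ⟨j, -, hj⟩ := card_pos_exponent hG ((center C).map C.subtype)
  exact ⟨j, exponent_lt_of_lt hZ hj hlt, hcard ▸ hj⟩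

/-- The centre of `C(x)` has order at least `p ^ (k + 1)`, hence index at most `p` in `C(x)`, which
forces `C(x)` to be abelian. -/
theorem centralizer_commute {x : G} (hx : x ∉ center G) (hG : Nat.card G = p ^ n) {k c : ℕ}
    (hZ : Nat.card (center G) = p ^ k) (hC : Nat.card (centralizer {x}) = p ^ c)
    (hc : c ≤ k + 2) (a b : centralizer {x}) : Commute a b := by
  obtain ⟨j, hj, hj'⟩ := card_center_centralizer hx hG hZ
  exact commute_of_card_center hC hj' (by omega) a b

/-- The order exceeds `p ^ k` because `x` is central in `C(x)`, and a centre of index `1` or `p`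
would make `C(x)` abelian. -/
theorem card_center_centralizer_of_nonabelian {x : G} (hx : x ∉ center G)
    (hG : Nat.card G = p ^ n) {k : ℕ} (hZ : Nat.card (center G) = p ^ k)
    (hC : Nat.card (centralizer {x}) = p ^ (k + 3))
    (h : ¬ ∀ a b : centralizer {x}, Commute a b) :
    Nat.card (center (centralizer {x})) = p ^ (k + 1) := by
  obtain ⟨j, hj, hj'⟩ := card_center_centralizer hx hG hZ
  by_cases hjk : k + 2 ≤ j
  · exact absurd (commute_of_card_center hC hj' (by omega)) h
  · rw [hj', show j = k + 1 by omega]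

theorem exponent_center_add_two_le {k : ℕ} (hG : Nat.card G = p ^ n)
    (hZ : Nat.card (center G) = p ^ k) (h : ¬ ∀ x y : G, Commute x y) : k + 2 ≤ n := by
  by_contra hc
  exact h (commute_of_card_center hG hZ (by omega))

theorem centralizerType_of_commute {x : G} {a b : ℕ} (hG : Nat.card G = p ^ (a + b))
    (hC : Nat.card (centralizer {x}) = p ^ a) (h : ∀ a b : centralizer {x}, Commute a b) :
    CentralizerType x ((p : ℚ)⁻¹ ^ b) fun _ => 1 := by
  have h0 : (p : ℚ) ≠ 0 := Nat.cast_ne_zero.2 hp.out.ne_zero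
  refine ⟨?_, fun m => commDensity_of_comm h m⟩
  rw [hC, hG]
  push_cast
  rw [pow_add, inv_pow]
  field_simp

theorem row2_of_card_center {k : ℕ} (hG : Nat.card G = p ^ (k + 2))
    (hZ : Nat.card (center G) = p ^ k) :
    normA G = rowA2 p ∧ normB G = rowB2 p ∧ ∀ m, commDensity G m = heisDensity p m := by
  have h0 : (p : ℚ) ≠ 0 := Nat.cast_ne_zero.2 hp.out.ne_zero
  refine row2_of_abelian h0 (fun x hx => ?_) (card_cast_eq hG hZ)
  obtain ⟨c, hc, hC⟩ := card_pos_exponent hG (centralizer {x})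
  have h1 := exponent_lt_of_lt hZ hC (center_lt_centralizer hx)
  have h2 := exponent_lt_of_lt hC (by rw [card_top, hG]) (centralizer_ne_top hx).lt_top
  obtain rfl : c = k + 1 := by omega
  simpa using centralizerType_of_commute (b := 1) hG hC
    (centralizer_commute hx hG hZ hC (by omega))

/-- The centre of `C(x)` has index `p ^ 2`, so `row2_of_card_center` applied to the group `C(x)`
gives its densities. -/
theorem centralizerType_of_nonabelian {x : G} (hx : x ∉ center G) {k : ℕ}
    (hG : Nat.card G = p ^ (k + 4)) (hZ : Nat.card (center G) = p ^ k)
    (hC : Nat.card (centralizer {x}) = p ^ (k + 3))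
    (h : ¬ ∀ a b : centralizer {x}, Commute a b) :
    CentralizerType x (p : ℚ)⁻¹ (heisDensity p) := by
  refine ⟨?_, (row2_of_card_center (k := k + 1) hC
    (card_center_centralizer_of_nonabelian hx hG hZ hC h)).2.2⟩
  have h0 := card_ne_zero_rat G
  have := card_cast_eq (b := 1) hG hC
  rw [this, pow_one, mul_div_assoc, div_self h0, mul_one]

/-- If all commutators `⁅g, x⁆` lie in `N`, then the class of `x` has at most `|N|` elements. -/
theorem card_le_card_centralizer_mul {N : Subgroup G} {x : G} (h : ∀ g : G, ⁅g, x⁆ ∈ N) :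
    Nat.card G ≤ Nat.card (centralizer {x}) * Nat.card N := by
  rw [← (centralizer {x}).card_mul_index]
  refine Nat.mul_le_mul_left _ ?_
  rw [index_eq_card]
  -- The map `g ↦ [g, x]` separates the cosets of the centralizer, because `[g, x] = [h, x]` means
  -- that `g` and `h` conjugate `x` to the same element.
  refine Nat.card_le_card_of_injective
    (fun q : G ⧸ centralizer {x} => (⟨⁅q.out, x⁆, h _⟩ : N)) fun a b hab => ?_
  have hab : ⁅a.out, x⁆ = ⁅b.out, x⁆ := congrArg Subtype.val hab
  rw [commutatorElement_def, commutatorElement_def, mul_left_inj] at hab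
  rw [← QuotientGroup.out_eq' a, ← QuotientGroup.out_eq' b, QuotientGroup.eq,
    mem_centralizer_singleton_iff, mul_assoc, inv_mul_eq_iff_eq_mul]
  have := congrArg (· * b.out) hab
  simp only [inv_mul_cancel_right] at this
  rw [← this]
  group

theorem exponent_le_centralizer_add {N : Subgroup G} {x : G} (h : ∀ g : G, ⁅g, x⁆ ∈ N) {c k : ℕ}
    (hG : Nat.card G = p ^ n) (hC : Nat.card (centralizer {x}) = p ^ c)
    (hN : Nat.card N = p ^ k) : n ≤ c + k := by
  have := card_le_card_centralizer_mul h
  rw [hG, hC, hN, ← pow_add] at this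
  exact (Nat.pow_le_pow_iff_right hp.out.one_lt).1 this

/-- Under conjugation by a `p`-group the number of fixed points in `N` is divisible by `p`. It is
positive because `1` is fixed, so all `p` elements are fixed. -/
theorem normal_le_center_of_card_eq_prime (hG : Nat.card G = p ^ n) {N : Subgroup G} [N.Normal]
    (hN : Nat.card N = p) : N ≤ center G := by
  have hP : IsPGroup p (ConjAct G) := IsPGroup.of_card hG
  have h := hP.card_modEq_card_fixedPoints N
  have hone : (1 : N) ∈ MulAction.fixedPoints (ConjAct G) N := fun g => by
    ext
    simp
  have hpos : 0 < Nat.card (MulAction.fixedPoints (ConjAct G) N) :=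
    have : Nonempty (MulAction.fixedPoints (ConjAct G) N) := ⟨⟨1, hone⟩⟩
    Nat.card_pos
  have hdvd : p ∣ Nat.card (MulAction.fixedPoints (ConjAct G) N) := by
    rw [hN] at h
    exact (Nat.modEq_zero_iff_dvd.1 (h.symm.trans (Nat.modEq_zero_iff_dvd.2 dvd_rfl)))
  have hall : MulAction.fixedPoints (ConjAct G) N = Set.univ := by
    refine Set.eq_of_subset_of_ncard_le (Set.subset_univ _) ?_
    rw [Set.ncard_univ, hN]
    exact Nat.le_of_dvd hpos hdvd
  intro x hx
  refine mem_center_iff.2 fun g => ?_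
  have hmem : (⟨x, hx⟩ : N) ∈ MulAction.fixedPoints (ConjAct G) N := hall ▸ Set.mem_univ _
  have := congrArg Subtype.val (hmem (ConjAct.toConjAct g))
  rw [ConjAct.Subgroup.val_conj_smul, ConjAct.toConjAct_smul] at this
  exact mul_inv_eq_iff_eq_mul.1 this

end PGroups

/-! ### Groups with an abelian subgroup of index p -/

section AbelianIndexP

open Subgroup
open scoped commutatorElement

variable {G : Type u} [Group G] [Finite G] {p n : ℕ} [hp : Fact p.Prime] {A : Subgroup G}

/-- A central `z` outside `A` would generate `G` together with the maximal subgroup `A`. Then every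
element of `A` would be central, and so would all of `G`. -/
theorem center_le_of_abelian_index (hG : Nat.card G = p ^ (n + 1)) (hA : Nat.card A = p ^ n)
    (hab : ∀ a ∈ A, ∀ b ∈ A, Commute a b) (h : ¬ ∀ x y : G, Commute x y) : center G ≤ A := by
  intro z hz
  by_contra hzA
  refine h fun x y => ?_
  have h1 : ∀ a ∈ A, a ∈ center G := by
    intro a ha
    have : centralizer {a} = ⊤ := eq_top_of_notMem hG hA
      (fun b hb => mem_centralizer_singleton_iff.2 (hab b hb a ha)) hzA
      (center_le_centralizer _ hz)
    by_contra hc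
    exact centralizer_ne_top hc this
  have h2 : center G = ⊤ := eq_top_of_notMem hG hA h1 hzA hz
  exact commute_of_mem_center_or (fun x => h2 ▸ mem_top x) x y

theorem centralizer_of_mem_abelian_index (hG : Nat.card G = p ^ (n + 1))
    (hA : Nat.card A = p ^ n) (hab : ∀ a ∈ A, ∀ b ∈ A, Commute a b) {x : G} (hxA : x ∈ A)
    (hx : x ∉ center G) : centralizer {x} = A := by
  have hle : A ≤ centralizer {x} := fun b hb => mem_centralizer_singleton_iff.2 (hab b hb x hxA)
  by_contra hne
  exact centralizer_ne_top hx (eq_top_of_lt_of_card hG hA (lt_of_le_of_ne hle (Ne.symm hne)))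

theorem mem_center_of_commute_notMem (hG : Nat.card G = p ^ (n + 1))
    (hA : Nat.card A = p ^ n) (hab : ∀ a ∈ A, ∀ b ∈ A, Commute a b) {a t : G} (ha : a ∈ A)
    (ht : t ∉ A) (hat : Commute t a) : a ∈ center G := by
  by_contra hc
  exact centralizer_ne_top hc (eq_top_of_notMem hG hA
    (fun b hb => mem_centralizer_singleton_iff.2 (hab b hb a ha)) ht
    (mem_centralizer_singleton_iff.2 hat))

/-- An element of `A` commuting with `x` commutes with `A` and `x`, which generate `G`. So `C(x)`
meets `A` exactly in the centre, and this intersection has index `p` in `C(x)`. -/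
theorem card_centralizer_of_notMem (hG : Nat.card G = p ^ (n + 1)) (hA : Nat.card A = p ^ n)
    (hab : ∀ a ∈ A, ∀ b ∈ A, Commute a b) {k : ℕ} (hZ : Nat.card (center G) = p ^ k) {x : G}
    (hx : x ∉ A) (hna : ¬ ∀ x y : G, Commute x y) :
    Nat.card (centralizer {x}) = p ^ (k + 1) := by
  refine exponent_inf_of_notMem hG hA (self_mem_centralizer x) hx ?_
  have : A ⊓ centralizer {x} = center G := by
    refine le_antisymm (fun a ha => ?_) (le_inf (center_le_of_abelian_index hG hA hab hna)
      (center_le_centralizer _))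
    exact mem_center_of_commute_notMem hG hA hab ha.1 hx
      (mem_centralizer_singleton_iff.1 ha.2).symm
  rw [this, hZ]

theorem centralizerTypes_of_abelian_index (hG : Nat.card G = p ^ (n + 1))
    (hA : Nat.card A = p ^ n) (hab : ∀ a ∈ A, ∀ b ∈ A, Commute a b) {k j : ℕ}
    (hZ : Nat.card (center G) = p ^ k) (hna : ¬ ∀ x y : G, Commute x y) (hk : k + j = n) :
    (∀ x ∈ A, x ∉ center G → CentralizerType x (p : ℚ)⁻¹ fun _ => 1) ∧
      ∀ x, x ∉ A → CentralizerType x ((p : ℚ)⁻¹ ^ j) fun _ => 1 := by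
  constructor
  · intro x hxA hx
    have hC := centralizer_of_mem_abelian_index hG hA hab hxA hx
    have := centralizerType_of_commute (x := x) (b := 1) hG (by rw [hC, hA])
      (fun a b => Subtype.ext (hab a (hC ▸ a.2) b (hC ▸ b.2)))
    simpa using this
  · intro x hx
    have hC := card_centralizer_of_notMem hG hA hab hZ hx hna
    have hxZ : x ∉ center G := fun h => hx (center_le_of_abelian_index hG hA hab hna h)
    exact centralizerType_of_commute (by rw [hG]; congr 1; omega) hC
      (centralizer_commute hxZ hG hZ hC (by omega))

/-- In a nonabelian group with an abelian subgroup `A` of index `p` one has `|G'| |Z| ≤ |A|`. -/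
theorem card_commutator_mul_card_center_le (hG : Nat.card G = p ^ (n + 1))
    (hA : Nat.card A = p ^ n) (hab : ∀ a ∈ A, ∀ b ∈ A, Commute a b)
    (hna : ¬ ∀ x y : G, Commute x y) :
    Nat.card (commutator G) * Nat.card (center G) ≤ Nat.card A := by
  have hN := normal_of_card_eq hG hA
  have hne : A ≠ ⊤ := fun h => by
    have := hA
    rw [h, card_top, hG] at this
    exact absurd (Nat.pow_right_injective hp.out.two_le this) (by omega)
  obtain ⟨t, ht⟩ : ∃ t, t ∉ A := by
    by_contra hc
    push Not at hc
    exact hne (eq_top_iff.2 fun x _ => hc x)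
  have hconj : ∀ a ∈ A, t * a * t⁻¹ ∈ A := fun a ha => hN.conj_mem a ha t
  -- Multiplicative because `A` is abelian and normal. Its kernel contains the centre, and its range
  -- will be shown to contain the derived subgroup, so the bound is the order formula for `f`.
  let f : A →* G :=
    { toFun := fun a => ⁅t, (a : G)⁆
      map_one' := by simp
      map_mul' := fun a b => by
        have h := hab _ (hconj b b.2) _ (inv_mem a.2)
        simp only [commutatorElement_def, coe_mul, mul_inv_rev]
        calc t * (a * b) * t⁻¹ * ((b : G)⁻¹ * (a : G)⁻¹)
            = t * a * t⁻¹ * ((t * b * t⁻¹) * (b : G)⁻¹ * (a : G)⁻¹) := by group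
          _ = t * a * t⁻¹ * ((a : G)⁻¹ * ((t * b * t⁻¹) * (b : G)⁻¹)) := by
            rw [(Commute.mul_left h (hab _ (inv_mem b.2) _ (inv_mem a.2))).eq]
          _ = _ := by group }
  have hker : Nat.card (center G) ≤ Nat.card f.ker := by
    have hle : center G ≤ f.ker.map A.subtype := fun z hz =>
      ⟨⟨z, center_le_of_abelian_index hG hA hab hna hz⟩,
        commutatorElement_eq_one_iff_mul_comm.2 (mem_center_iff.1 hz t), rfl⟩
    have := card_le_of_le hle
    rwa [card_map_of_injective A.subtype_injective] at this
  have hcard : Nat.card f.range * Nat.card f.ker = Nat.card A := by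
    rw [← index_ker, mul_comm, card_mul_index]
  have hfA : ∀ a : A, f a ∈ A := fun a => mul_mem (hconj a a.2) (inv_mem a.2)
  -- The range lies in `A`, hence is centralized by `A`; it is also normalized by `t`, and `A` and
  -- `t` generate `G`.
  have hnormal : f.range.Normal := by
    rw [← normalizer_eq_top_iff]
    have hle : A ≤ normalizer (f.range : Set G) := by
      intro a ha
      have key : ∀ y ∈ f.range, a * y * a⁻¹ = y := by
        rintro _ ⟨b, rfl⟩
        rw [(hab a ha _ (hfA b)).eq, mul_inv_cancel_right]
      rw [mem_normalizer_iff]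
      intro y
      constructor
      · intro hy
        have hy : y ∈ f.range := hy
        change a * y * a⁻¹ ∈ f.range
        rwa [key y hy]
      · intro hy
        have hy : a * y * a⁻¹ ∈ f.range := hy
        have hyA : a * y * a⁻¹ ∈ A := by
          obtain ⟨b, hb⟩ := hy
          exact hb ▸ hfA b
        have h1 : y ∈ A := by
          have := hN.conj_mem _ hyA a⁻¹
          simpa [mul_assoc] using this
        rwa [(hab a ha y h1).eq, mul_inv_cancel_right] at hy
    refine eq_top_of_notMem hG hA hle ht ?_
    have hmap : ∀ y ∈ f.range, t * y * t⁻¹ ∈ f.range := by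
      rintro _ ⟨b, rfl⟩
      refine ⟨⟨t * b * t⁻¹, hconj b b.2⟩, ?_⟩
      change ⁅t, t * (b : G) * t⁻¹⁆ = t * ⁅t, (b : G)⁆ * t⁻¹
      simp only [commutatorElement_def]
      group
    -- Membership in the normalizer is an equivalence; finiteness upgrades the inclusion to the
    -- equality needed for its converse half.
    have hfin : (f.range.map (MulAut.conj t).toMonoidHom) = f.range := by
      refine eq_of_le_of_card_ge ?_ ?_
      · rintro _ ⟨y, hy, rfl⟩
        exact hmap y hy
      · exact (card_map_of_injective (MulAut.conj t).injective).ge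
    rw [mem_normalizer_iff]
    intro y
    refine ⟨hmap y, fun hy => ?_⟩
    rw [← hfin] at hy
    obtain ⟨w, hw, hwy⟩ := hy
    have : w = y := (MulAut.conj t).injective hwy
    exact this ▸ hw
  -- Modulo the range of `f` the image of `t` commutes with the abelian image of `A`. These generate
  -- the quotient, which is therefore abelian.
  have hcomm : commutator G ≤ f.range := by
    rw [← Normal.quotient_commutative_iff_commutator_le]
    set π := QuotientGroup.mk' f.range
    have h1 : ∀ a ∈ A, Commute (π t) (π a) := by
      intro a ha
      rw [← commutatorElement_eq_one_iff_commute, ← map_commutatorElement]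
      exact (QuotientGroup.eq_one_iff _).2 ⟨⟨a, ha⟩, rfl⟩
    have h2 : ∀ a ∈ A, ∀ g, Commute (π g) (π a) := by
      intro a ha g
      have : (centralizer {π a}).comap π = ⊤ := eq_top_of_notMem hG hA
        (fun b hb => mem_centralizer_singleton_iff.2 ((hab b hb a ha).map π)) ht
        (mem_centralizer_singleton_iff.2 (h1 a ha))
      exact mem_centralizer_singleton_iff.1 (mem_comap.1 (this ▸ mem_top g))
    have h3 : ∀ g, Commute (π t) (π g) := by
      intro g
      have : (centralizer {π t}).comap π = ⊤ := eq_top_of_notMem hG hA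
        (fun b hb => mem_centralizer_singleton_iff.2 (h1 b hb).symm) ht
        (mem_centralizer_singleton_iff.2 rfl)
      exact (mem_centralizer_singleton_iff.1 (mem_comap.1 (this ▸ mem_top g)) : _ = _).symm
    have h4 : ∀ g h, Commute (π g) (π h) := by
      intro g h
      have : (centralizer {π h}).comap π = ⊤ := eq_top_of_notMem hG hA
        (fun b hb => mem_centralizer_singleton_iff.2 (h2 b hb h).symm) ht
        (mem_centralizer_singleton_iff.2 (h3 h))
      exact mem_centralizer_singleton_iff.1 (mem_comap.1 (this ▸ mem_top g))
    refine ⟨⟨fun a b => ?_⟩⟩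
    obtain ⟨a, rfl⟩ := QuotientGroup.mk'_surjective _ a
    obtain ⟨b, rfl⟩ := QuotientGroup.mk'_surjective _ b
    exact h4 a b
  calc Nat.card (commutator G) * Nat.card (center G)
      ≤ Nat.card f.range * Nat.card f.ker := Nat.mul_le_mul (card_le_of_le hcomm) hker
    _ = Nat.card A := hcard

end AbelianIndexP

/-! ### Identifying the row from the centre, second centre and derived subgroup -/

section Classification

open Subgroup
open scoped commutatorElement

variable {G : Type u} [Group G] {p : ℕ} [hp : Fact p.Prime]

theorem not_commute_of_card_center {n k : ℕ} (hG : Nat.card G = p ^ n)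
    (hZ : Nat.card (center G) = p ^ k) (h : k < n) : ¬ ∀ x y : G, Commute x y := by
  intro hc
  have hG' : Nat.card (⊤ : Subgroup G) = p ^ n := by rw [card_top, hG]
  have : center G = ⊤ := eq_top_iff.2 fun x _ => mem_center_iff.2 fun y => hc y x
  rw [this, hG'] at hZ
  exact h.ne' (Nat.pow_right_injective hp.out.two_le hZ)

theorem card_quotient_center {k j : ℕ} (hG : Nat.card G = p ^ (k + j))
    (hZ : Nat.card (center G) = p ^ k) : Nat.card (G ⧸ center G) = p ^ j := by
  rw [← index_eq_card, index_eq_pow hG hZ]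

theorem commutator_quotient_notMem {a b c : G} (h : ⁅⁅a, b⁆, c⁆ ∉ center G) :
    ⁅(a : G ⧸ center G), (b : G ⧸ center G)⁆ ∉ center (G ⧸ center G) := by
  intro hm
  refine h ((QuotientGroup.eq_one_iff _).1 ?_)
  rw [← QuotientGroup.mk'_apply, map_commutatorElement, map_commutatorElement,
    commutatorElement_eq_one_iff_commute]
  exact (mem_center_iff.1 hm _ : _ * _ = _ * _).symm

theorem IsStemGroup.not_commute (hs : IsStemGroup G) (h1 : Nontrivial G) :
    ¬ ∀ x y : G, Commute x y := by
  intro h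
  have h2 : commutator G = ⊥ := by
    rw [commutator_def, eq_bot_iff, commutator_le]
    exact fun a _ b _ => commutatorElement_eq_one_iff_commute.2 (h a b)
  obtain ⟨x, hx⟩ := exists_ne (1 : G)
  have : x ∈ commutator G := hs (mem_center_iff.2 fun y => h y x)
  rw [h2] at this
  exact hx this

theorem exists_notMem_center {n k : ℕ} (hG : Nat.card G = p ^ n)
    (hZ : Nat.card (center G) = p ^ k) (h : k < n) : ∃ x, x ∉ center G := by
  by_contra hc
  push Not at hc
  exact not_commute_of_card_center hG hZ h (commute_of_mem_center_or hc)

variable [Finite G]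

theorem exists_exponent_centralizer {n k : ℕ} (hG : Nat.card G = p ^ n)
    (hZ : Nat.card (center G) = p ^ k) {x : G} (hx : x ∉ center G) :
    ∃ c, k < c ∧ c < n ∧ Nat.card (centralizer {x}) = p ^ c := by
  obtain ⟨c, -, hC⟩ := card_pos_exponent hG (centralizer {x})
  exact ⟨c, exponent_lt_of_lt hZ hC (center_lt_centralizer hx),
    exponent_lt_of_lt hC (by rw [card_top, hG]) (centralizer_ne_top hx).lt_top, hC⟩

theorem row3_of_abelian_subgroup {k : ℕ} (hG : Nat.card G = p ^ (k + 3))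
    (hZ : Nat.card (center G) = p ^ k) {A : Subgroup G} (hA : Nat.card A = p ^ (k + 2))
    (hab : ∀ a ∈ A, ∀ b ∈ A, Commute a b) : normA G = rowA3 p ∧ normB G = rowB3 p := by
  have hna := not_commute_of_card_center hG hZ (by omega)
  obtain ⟨h₁, h₂⟩ := centralizerTypes_of_abelian_index hG hA hab hZ hna rfl
  exact row3_of_abelian_index (center_le_of_abelian_index hG hA hab hna)
    (Nat.cast_ne_zero.2 hp.out.ne_zero) h₁ h₂ (card_cast_eq hG hZ)
    (by rw [card_cast_eq (b := 1) hG hA, pow_one])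

theorem row9_of_abelian_subgroup {k : ℕ} (hG : Nat.card G = p ^ (k + 4))
    (hZ : Nat.card (center G) = p ^ k) {A : Subgroup G} (hA : Nat.card A = p ^ (k + 3))
    (hab : ∀ a ∈ A, ∀ b ∈ A, Commute a b) : normA G = rowA9 p ∧ normB G = rowB9 p := by
  have hna := not_commute_of_card_center hG hZ (by omega)
  obtain ⟨h₁, h₂⟩ := centralizerTypes_of_abelian_index hG hA hab hZ hna rfl
  exact row9_of_abelian_index (center_le_of_abelian_index hG hA hab hna)
    (Nat.cast_ne_zero.2 hp.out.ne_zero) h₁ h₂ (card_cast_eq hG hZ)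
    (by rw [card_cast_eq (b := 1) hG hA, pow_one])

/-- The centralizer of a noncentral element is an abelian subgroup of index `p`, so `|G'| |Z| ≤ p
|Z|`. -/
theorem card_commutator_le_of_card_center {k : ℕ} (hG : Nat.card G = p ^ (k + 2))
    (hZ : Nat.card (center G) = p ^ k) : Nat.card (commutator G) ≤ p := by
  obtain ⟨x, hx⟩ := exists_notMem_center hG hZ (by omega)
  obtain ⟨c, hc, hc', hC⟩ := exists_exponent_centralizer hG hZ hx
  obtain rfl : c = k + 1 := by omega
  have hcomm := centralizer_commute hx hG hZ hC (by omega)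
  have h := card_commutator_mul_card_center_le hG hC
    (fun a ha b hb => congrArg Subtype.val (hcomm ⟨a, ha⟩ ⟨b, hb⟩).eq)
    (not_commute_of_card_center hG hZ (by omega))
  rw [hZ, hC, pow_succ, mul_comm] at h
  exact Nat.le_of_mul_le_mul_left h (pow_pos hp.out.pos k)

/-- If the centre had index at most `p ^ 2`, then `G / Z` would be abelian and every commutator
central. -/
theorem exponent_center_add_three_le {n k : ℕ} (hG : Nat.card G = p ^ n)
    (hZ : Nat.card (center G) = p ^ k) {a b : G} (h : ⁅a, b⁆ ∉ center G) : k + 3 ≤ n := by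
  by_contra hc
  have hkn : k ≤ n := (Nat.pow_le_pow_iff_right hp.out.one_lt).1 (by
    rw [← hZ, ← hG]; exact card_le_card_group _)
  obtain ⟨j, rfl⟩ := Nat.exists_eq_add_of_le hkn
  have hQ : Nat.card (G ⧸ center G) = p ^ j := by rw [← index_eq_card, index_eq_pow hG hZ]
  obtain ⟨i, -, hi⟩ := card_pos_exponent hQ (center (G ⧸ center G))
  have hcomm : ∀ x y : G ⧸ center G, Commute x y := by
    rcases Nat.eq_zero_or_pos j with rfl | hj
    · exact commute_of_card_center hQ hi (by omega)
    · have : Nontrivial (G ⧸ center G) := by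
        rw [← Finite.one_lt_card_iff_nontrivial, hQ]
        exact Nat.one_lt_pow hj.ne' hp.out.one_lt
      have hlt : ⊥ < center (G ⧸ center G) := (IsPGroup.of_card hQ).bot_lt_center
      have := exponent_lt_of_lt (a := 0) (by simp) hi hlt
      exact commute_of_card_center hQ hi (by omega)
  refine h ((QuotientGroup.eq_one_iff _).1 ?_)
  rw [← QuotientGroup.mk'_apply, map_commutatorElement]
  exact commutatorElement_eq_one_iff_commute.2 (hcomm _ _)

/-- A group of order `p ^ 5` and class `4` has centre of order `p`, second centre of order
`p ^ 2`. -/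
theorem exponent_center_add_four_le {n k : ℕ} (hG : Nat.card G = p ^ n)
    (hZ : Nat.card (center G) = p ^ k) {a b c : G} (h : ⁅⁅a, b⁆, c⁆ ∉ center G) : k + 4 ≤ n := by
  have hkn : k ≤ n := (Nat.pow_le_pow_iff_right hp.out.one_lt).1 (by
    rw [← hZ, ← hG]; exact card_le_card_group _)
  obtain ⟨j, rfl⟩ := Nat.exists_eq_add_of_le hkn
  have hQ := card_quotient_center hG hZ
  obtain ⟨i, -, hi⟩ := card_pos_exponent hQ (center (G ⧸ center G))
  -- The previous bound is applied to `G / Z`, where `[a, b]` is still noncentral. The centre of `G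
  -- / Z` is nontrivial, which supplies the extra unit.
  have h3 := exponent_center_add_three_le hQ hi (commutator_quotient_notMem h)
  have : Nontrivial (G ⧸ center G) := by
    rw [← Finite.one_lt_card_iff_nontrivial, hQ]
    exact Nat.one_lt_pow (by omega) hp.out.one_lt
  have := exponent_lt_of_lt (a := 0) (by simp) hi (IsPGroup.of_card hQ).bot_lt_center
  omega

/-- The quotient `G / Z` has order `p ^ 4` and a noncentral commutator, so its nontrivial centre can
only have order `p`. -/
theorem card_secondCenter_of_class_four (hG : Nat.card G = p ^ 5)
    (hZ : Nat.card (center G) = p) {a b c : G} (h : ⁅⁅a, b⁆, c⁆ ∉ center G) :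
    Nat.card (secondCenter G) = p ^ 2 := by
  have hQ : Nat.card (G ⧸ center G) = p ^ 4 := card_quotient_center (k := 1) hG (by simpa using hZ)
  obtain ⟨i, -, hi⟩ := card_pos_exponent hQ (center (G ⧸ center G))
  have h3 := exponent_center_add_three_le hQ hi (commutator_quotient_notMem h)
  have : Nontrivial (G ⧸ center G) := by
    rw [← Finite.one_lt_card_iff_nontrivial, hQ]
    exact Nat.one_lt_pow (by omega) hp.out.one_lt
  have := exponent_lt_of_lt (a := 0) (by simp) hi (IsPGroup.of_card hQ).bot_lt_center
  obtain rfl : i = 1 := by omega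
  rw [card_secondCenter, hi, hZ, pow_one, sq]

theorem center_exponent_pos {n k : ℕ} (hn : n ≠ 0) (hG : Nat.card G = p ^ n)
    (hZ : Nat.card (center G) = p ^ k) : 0 < k := by
  have : Nontrivial G := by
    rw [← Finite.one_lt_card_iff_nontrivial, hG]
    exact Nat.one_lt_pow hn hp.out.one_lt
  exact exponent_lt_of_lt (a := 0) (by simp) hZ (IsPGroup.of_card hG).bot_lt_center

/-- A nonabelian `p`-group with centre of order `p` is a stem group. -/
theorem isStemGroup_of_card_center {n : ℕ} (hG : Nat.card G = p ^ n)
    (hZ : Nat.card (center G) = p) {z : G} (hz : z ∈ center G) (hz' : z ∈ commutator G)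
    (hz1 : z ≠ 1) : IsStemGroup G := by
  have hlt : ⊥ < center G ⊓ commutator G := by
    rw [bot_lt_iff_ne_bot, Ne, eq_bot_iff]
    exact fun h => hz1 (h ⟨hz, hz'⟩)
  obtain ⟨k, -, hk⟩ := card_pos_exponent hG (center G ⊓ commutator G)
  have h0 := exponent_lt_of_lt (a := 0) (by simp) hk hlt
  have : center G ⊓ commutator G = center G :=
    eq_of_le_of_exponent_le hk (hZ.trans (pow_one p).symm) inf_le_left h0
  exact inf_eq_left.1 this

theorem row2_of_isStemGroup (hs : IsStemGroup G) (hG : Nat.card G = p ^ 3) :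
    normA G = rowA2 p ∧ normB G = rowB2 p := by
  have h1 : Nontrivial G := by
    rw [← Finite.one_lt_card_iff_nontrivial, hG]
    exact Nat.one_lt_pow (by omega) hp.out.one_lt
  obtain ⟨k, -, hk⟩ := card_pos_exponent hG (center G)
  have := center_exponent_pos (by omega) hG hk
  have := exponent_center_add_two_le hG hk (hs.not_commute h1)
  obtain rfl : k = 1 := by omega
  have := row2_of_card_center hG hk
  exact ⟨this.1, this.2.1⟩

/-- A centre of order `p ^ 2` would force `|G'| ≤ p`, although `G'` contains the centre; so `|Z| =
p`. An element of the second centre outside `Z` has all its commutators in `Z`, so its centralizer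
has index `p` and is abelian. -/
theorem row3_of_isStemGroup (hs : IsStemGroup G) (hG : Nat.card G = p ^ 4) :
    normA G = rowA3 p ∧ normB G = rowB3 p := by
  have h1 : Nontrivial G := by
    rw [← Finite.one_lt_card_iff_nontrivial, hG]
    exact Nat.one_lt_pow (by omega) hp.out.one_lt
  obtain ⟨k, -, hk⟩ := card_pos_exponent hG (center G)
  have := center_exponent_pos (by omega) hG hk
  have := exponent_center_add_two_le hG hk (hs.not_commute h1)
  have hk2 : k ≠ 2 := by
    rintro rfl
    have h2 := card_commutator_le_of_card_center hG hk
    have h3 := card_le_of_le hs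
    rw [hk] at h3
    have := hp.out.one_lt
    nlinarith
  obtain rfl : k = 1 := by omega
  have hQ := card_quotient_center (j := 3) hG hk
  have : Nontrivial (G ⧸ center G) := by
    rw [← Finite.one_lt_card_iff_nontrivial, hQ]
    exact Nat.one_lt_pow (by omega) hp.out.one_lt
  have hlt : center G < secondCenter G := by
    obtain ⟨i, -, hi⟩ := card_pos_exponent hQ (center (G ⧸ center G))
    have h2 := center_exponent_pos (by omega) hQ hi
    refine lt_of_le_of_ne center_le_secondCenter fun h => ?_
    have h3 := card_secondCenter (G := G)
    rw [← h, hi, hk, ← pow_add] at h3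
    have h4 : 1 = i + 1 := Nat.pow_right_injective hp.out.two_le h3
    omega
  obtain ⟨x, hx, hxZ⟩ := SetLike.exists_of_lt hlt
  obtain ⟨c, hc, hc', hC⟩ := exists_exponent_centralizer hG hk hxZ
  have := exponent_le_centralizer_add (mem_secondCenter_iff.1 hx) hG hC hk
  obtain rfl : c = 3 := by omega
  have hcomm := centralizer_commute hxZ hG hk hC (by omega)
  exact row3_of_abelian_subgroup hG hk hC
    (fun a ha b hb => congrArg Subtype.val (hcomm ⟨a, ha⟩ ⟨b, hb⟩).eq)

/-- A centralizer of order `p ^ 4` would be abelian and give `|G'| |Z| ≤ p ^ 4`, which the size of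
`G'` excludes. So all noncentral centralizers have order `p ^ 3`. -/
theorem row6_of_card_commutator (hG : Nat.card G = p ^ 5) (hZ : Nat.card (center G) = p ^ 2)
    (hK : p ^ 2 < Nat.card (commutator G)) : normA G = rowA6 p ∧ normB G = rowB6 p := by
  refine row6_of_centralizers (Nat.cast_ne_zero.2 hp.out.ne_zero) (fun x hx => ?_)
    (card_cast_eq (b := 3) hG hZ)
  obtain ⟨c, hc, hc', hC⟩ := exists_exponent_centralizer hG hZ hx
  have hcomm := centralizer_commute hx hG hZ hC (by omega)
  have hc4 : c ≠ 4 := by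
    rintro rfl
    have h := card_commutator_mul_card_center_le hG hC
      (fun a ha b hb => congrArg Subtype.val (hcomm ⟨a, ha⟩ ⟨b, hb⟩).eq)
      (not_commute_of_card_center hG hZ (by omega))
    rw [hZ, hC] at h
    have := Nat.mul_lt_mul_of_pos_right hK (pow_pos hp.out.pos 2)
    rw [← pow_add] at this
    exact absurd h (not_le.2 this)
  obtain rfl : c = 3 := by omega
  exact centralizerType_of_commute hG hC hcomm

/-- If all centralizers have order at least `p ^ 3` and the centre has order `p`, then no
centralizer of index `p` in a group of order `p ^ 5` is abelian. -/
theorem not_commute_centralizer (hG : Nat.card G = p ^ 5) (hZ : Nat.card (center G) = p)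
    (h : ∀ x : G, p ^ 2 < Nat.card (centralizer {x})) {x : G}
    (hC : Nat.card (centralizer {x}) = p ^ 4) : ¬ ∀ a b : centralizer {x}, Commute a b := by
  intro hcomm
  have hZ' : Nat.card (center G) = p ^ 1 := by rw [hZ, pow_one]
  have hlt : centralizer {x} < ⊤ := lt_top_iff_ne_top.2 fun ht => by
    rw [ht, card_top, hG] at hC
    exact absurd (Nat.pow_right_injective hp.out.two_le hC) (by omega)
  obtain ⟨y, -, hy⟩ := SetLike.exists_of_lt hlt
  have := card_centralizer_of_notMem hG hC
    (fun a ha b hb => congrArg Subtype.val (hcomm ⟨a, ha⟩ ⟨b, hb⟩).eq) hZ' hy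
    (not_commute_of_card_center hG hZ' (by omega))
  exact (h y).ne' this

/-- Every conjugacy class lies in a coset of the centre, so all noncentral centralizers have index
`p`. None is abelian, as otherwise elements outside it would have centralizers of order `p ^ 2`. -/
theorem row5_of_commutator_le (hG : Nat.card G = p ^ 5) (hZ : Nat.card (center G) = p)
    (hK : commutator G ≤ center G) : normA G = rowA5 p ∧ normB G = rowB5 p := by
  have hZ' : Nat.card (center G) = p ^ 1 := by rw [hZ, pow_one]
  have hcard : ∀ x : G, x ∉ center G → Nat.card (centralizer {x}) = p ^ 4 := by
    intro x hx
    obtain ⟨c, hc, hc', hC⟩ := exists_exponent_centralizer hG hZ' hx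
    have := exponent_le_centralizer_add (N := center G)
      (fun g => hK (commutator_mem_commutator (mem_top g) (mem_top x))) hG hC hZ'
    rw [hC, show c = 4 by omega]
  have hall : ∀ x : G, p ^ 2 < Nat.card (centralizer {x}) := by
    intro x
    by_cases hx : x ∈ center G
    · have : centralizer {x} = ⊤ := by
        rwa [centralizer_eq_top_iff_subset, Set.singleton_subset_iff]
      rw [this, card_top, hG]
      exact Nat.pow_lt_pow_right hp.out.one_lt (by omega)
    · rw [hcard x hx]
      exact Nat.pow_lt_pow_right hp.out.one_lt (by omega)
  exact row5_of_centralizers (Nat.cast_ne_zero.2 hp.out.ne_zero) (fun x hx =>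
    centralizerType_of_nonabelian hx hG hZ' (hcard x hx)
      (not_commute_centralizer hG hZ hall (hcard x hx))) (card_cast_eq (b := 4) hG hZ')

/-- The centre `K` of `C(x)` has order `p ^ 2` and is normal in `G`. Its image in `G / Z` is normal
of order `p`, hence central, and `x` lies in `K`. -/
theorem mem_secondCenter_of_card_centralizer (hG : Nat.card G = p ^ 5)
    (hZ : Nat.card (center G) = p) {x : G} (hx : x ∉ center G)
    (hC : Nat.card (centralizer {x}) = p ^ 4)
    (hna : ¬ ∀ a b : centralizer {x}, Commute a b) : x ∈ secondCenter G := by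
  have hZ' : Nat.card (center G) = p ^ 1 := by rw [hZ, pow_one]
  have hN : (centralizer {x}).Normal := normal_of_card_eq hG hC
  set C := centralizer {x}
  set K := (center C).map C.subtype
  have hK : Nat.card K = p ^ 2 := by
    rw [card_map_of_injective C.subtype_injective]
    exact card_center_centralizer_of_nonabelian hx hG hZ' hC hna
  -- The centre of `C` is characteristic in `C`, and `C` is normal in `G`.
  have hKN : K.Normal := inferInstance
  have hZK : center G ≤ K := fun z hz =>
    ⟨⟨z, center_le_centralizer _ hz⟩,
      mem_center_iff.2 fun c => Subtype.ext (mem_center_iff.1 hz c), rfl⟩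
  set π := QuotientGroup.mk' (center G)
  have hmap : Nat.card (K.map π) = p := by
    have h1 : Nat.card (K.map π) * Nat.card (center G) = Nat.card K := by
      rw [← relIndex_ker, QuotientGroup.ker_mk', mul_comm, ← relIndex_bot_left (center G),
        relIndex_mul_relIndex _ _ _ bot_le hZK, relIndex_bot_left]
    rw [hZ, hK, sq] at h1
    exact Nat.eq_of_mul_eq_mul_right hp.out.pos h1
  have hle : K.map π ≤ center (G ⧸ center G) :=
    have : (K.map π).Normal := hKN.map π (QuotientGroup.mk'_surjective _)
    normal_le_center_of_card_eq_prime (card_quotient_center (j := 4) hG hZ') hmap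
  refine hle ⟨x, ⟨⟨x, self_mem_centralizer x⟩, mem_center_iff.2 fun c => ?_, rfl⟩, rfl⟩
  exact Subtype.ext (mem_centralizer_singleton_iff.1 c.2)

/-- The quotient `G / Z` of order `p ^ 4` has centre of order `p ^ 2`, so its derived subgroup has
order at most `p`; `G'` lies in the preimage. -/
theorem card_commutator_le_of_card_secondCenter (hG : Nat.card G = p ^ 5)
    (hZ : Nat.card (center G) = p) (hZ2 : Nat.card (secondCenter G) = p ^ 3) :
    Nat.card (commutator G) ≤ p ^ 2 := by
  have hZ' : Nat.card (center G) = p ^ 1 := by rw [hZ, pow_one]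
  have hQ := card_quotient_center (j := 4) hG hZ'
  have hQZ : Nat.card (center (G ⧸ center G)) = p ^ 2 := by
    have := card_secondCenter (G := G)
    rw [hZ2, hZ, pow_succ] at this
    exact (Nat.eq_of_mul_eq_mul_right hp.out.pos this).symm
  have h1 := card_commutator_le_of_card_center hQ hQZ
  have h2 : commutator G ≤ (commutator (G ⧸ center G)).comap (QuotientGroup.mk' (center G)) := by
    rw [commutator_def, commutator_le]
    intro a _ b _
    rw [mem_comap, map_commutatorElement]
    exact commutator_mem_commutator (mem_top _) (mem_top _)
  refine (card_le_of_le h2).trans ?_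
  rw [card_comap_mk', hZ, sq]
  exact Nat.mul_le_mul_right p h1

/-- Classes have at most `|G'| ≤ p ^ 2` elements, so centralizers have order at least `p ^ 3`. Among
noncentral elements, those with centralizer of order `p ^ 4` are exactly the ones in the second
centre. -/
theorem row7_of_card_secondCenter (hG : Nat.card G = p ^ 5) (hZ : Nat.card (center G) = p)
    (hZ2 : Nat.card (secondCenter G) = p ^ 3) : normA G = rowA7 p ∧ normB G = rowB7 p := by
  have hZ' : Nat.card (center G) = p ^ 1 := by rw [hZ, pow_one]
  have hK := card_commutator_le_of_card_secondCenter hG hZ hZ2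
  have hlow : ∀ {x : G} {c : ℕ}, Nat.card (centralizer {x}) = p ^ c → 3 ≤ c := by
    intro x c hc
    have h1 := card_le_card_centralizer_mul (N := commutator G) (x := x)
      fun g => commutator_mem_commutator (mem_top g) (mem_top x)
    have h2 := h1.trans (Nat.mul_le_mul_left _ hK)
    rw [hG, hc, ← pow_add, Nat.pow_le_pow_iff_right hp.out.one_lt] at h2
    omega
  have hall : ∀ x : G, p ^ 2 < Nat.card (centralizer {x}) := by
    intro x
    obtain ⟨c, -, hC⟩ := card_pos_exponent hG (centralizer {x})
    rw [hC]
    exact Nat.pow_lt_pow_right hp.out.one_lt (hlow hC)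
  refine row7_of_centralizers center_le_secondCenter (Nat.cast_ne_zero.2 hp.out.ne_zero)
    (fun x hx hxZ => ?_) (fun x hx => ?_) (card_cast_eq (b := 4) hG hZ')
    (card_cast_eq (b := 2) hG hZ2)
  · obtain ⟨c, hc, hc', hC⟩ := exists_exponent_centralizer hG hZ' hxZ
    have := exponent_le_centralizer_add (mem_secondCenter_iff.1 hx) hG hC hZ'
    obtain rfl : c = 4 := by omega
    exact centralizerType_of_nonabelian hxZ hG hZ' hC (not_commute_centralizer hG hZ hall hC)
  · have hxZ : x ∉ center G := fun h => hx (center_le_secondCenter h)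
    obtain ⟨c, hc, hc', hC⟩ := exists_exponent_centralizer hG hZ' hxZ
    have h3 := hlow hC
    have h4 : c ≠ 4 := by
      rintro rfl
      exact hx (mem_secondCenter_of_card_centralizer hG hZ hxZ hC
        (not_commute_centralizer hG hZ hall hC))
    obtain rfl : c = 3 := by omega
    exact centralizerType_of_commute hG hC (centralizer_commute hxZ hG hZ' hC (by omega))

/-- The layers are cut out by the centre, the second centre and `M = C(y)` for a noncentral `y` in
the second centre. The centralizer orders on the noncentral layers are `p ^ 4`, `p ^ 3` and `p ^ 2`.
-/
theorem row10_of_card_secondCenter (hG : Nat.card G = p ^ 5) (hZ : Nat.card (center G) = p)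
    (hZ2 : Nat.card (secondCenter G) = p ^ 2)
    (hna : ∀ A : Subgroup G, Nat.card A = p ^ 4 → ¬ ∀ a ∈ A, ∀ b ∈ A, Commute a b) :
    normA G = rowA10 p ∧ normB G = rowB10 p := by
  have hZ' : Nat.card (center G) = p ^ 1 := by rw [hZ, pow_one]
  have hna' : ∀ {x : G}, Nat.card (centralizer {x}) = p ^ 4 →
      ¬ ∀ a b : centralizer {x}, Commute a b := fun {x} hC hcomm => hna _ hC
    fun a ha b hb => congrArg Subtype.val (hcomm ⟨a, ha⟩ ⟨b, hb⟩).eq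
  have hlt : center G < secondCenter G := lt_of_le_of_ne center_le_secondCenter fun h => by
    rw [← h, hZ'] at hZ2
    exact absurd (Nat.pow_right_injective hp.out.two_le hZ2) (by omega)
  have hY : ∀ {x : G}, x ∈ secondCenter G → x ∉ center G →
      Nat.card (centralizer {x}) = p ^ 4 := by
    intro x hx hxZ
    obtain ⟨c, hc, hc', hC⟩ := exists_exponent_centralizer hG hZ' hxZ
    have := exponent_le_centralizer_add (mem_secondCenter_iff.1 hx) hG hC hZ'
    rw [hC, show c = 4 by omega]
  -- The centre has index `p` in the second centre, so one noncentral element of the latter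
  -- generates it over the centre.
  have hcov : ∀ {H : Subgroup G} {y : G}, center G ≤ H → y ∈ H → y ∈ secondCenter G →
      y ∉ center G → secondCenter G ≤ H := by
    intro H y hH hyH hy hyZ
    obtain ⟨c, -, hC⟩ := card_pos_exponent hG (secondCenter G ⊓ H)
    have := exponent_lt_of_lt hZ' hC (lt_of_le_of_ne (le_inf center_le_secondCenter hH)
      fun h => hyZ (h ▸ ⟨hy, hyH⟩))
    exact inf_eq_left.1 (eq_of_le_of_exponent_le hC hZ2 inf_le_left this)
  obtain ⟨y, hy, hyZ⟩ := SetLike.exists_of_lt hlt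
  have hYM : secondCenter G ≤ centralizer {y} :=
    hcov (center_le_centralizer _) (self_mem_centralizer y) hy hyZ
  refine row10_of_centralizers center_le_secondCenter hYM (Nat.cast_ne_zero.2 hp.out.ne_zero)
    (fun x hx hxZ => centralizerType_of_nonabelian hxZ hG hZ' (hY hx hxZ) (hna' (hY hx hxZ)))
    (fun x hxM hx => ?_) (fun x hxM => ?_) (card_cast_eq (b := 4) hG hZ')
    (card_cast_eq (b := 3) hG hZ2) (by rw [card_cast_eq (b := 1) hG (hY hy hyZ), pow_one])
  · have hxZ : x ∉ center G := fun h => hx (center_le_secondCenter h)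
    obtain ⟨c, hc, hc', hC⟩ := exists_exponent_centralizer hG hZ' hxZ
    have hyx : y ∈ centralizer {x} :=
      mem_centralizer_singleton_iff.2 (mem_centralizer_singleton_iff.1 hxM).symm
    have h2 := exponent_lt_of_lt hZ2 hC (lt_of_le_of_ne
      (hcov (center_le_centralizer _) hyx hy hyZ) fun h => hx (h ▸ self_mem_centralizer x))
    have h4 : c ≠ 4 := by
      rintro rfl
      exact hx (mem_secondCenter_of_card_centralizer hG hZ hxZ hC (hna' hC))
    obtain rfl : c = 3 := by omega
    exact centralizerType_of_commute hG hC (centralizer_commute hxZ hG hZ' hC (by omega))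
  · have hxZ : x ∉ center G := fun h => hxM (hYM (center_le_secondCenter h))
    obtain ⟨c, hc, hc', hC⟩ := exists_exponent_centralizer hG hZ' hxZ
    have h4 : c ≠ 4 := by
      rintro rfl
      exact hxM (hYM (mem_secondCenter_of_card_centralizer hG hZ hxZ hC (hna' hC)))
    have hcomm := centralizer_commute hxZ hG hZ' hC (by omega)
    have hyx : y ∉ centralizer {x} := fun h =>
      hxM (mem_centralizer_singleton_iff.2 (mem_centralizer_singleton_iff.1 h).symm)
    -- If `|C(x)| = p ^ 3`, then `C(x)` is abelian and meets `C(y)` in order `p ^ 2`, hence in a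
    -- noncentral `s`. Now `C(s)` contains `C(x)` and also `y`, so it has order `p ^ 4` and `s` lies
    -- in the second centre. Then `C(x)` contains the whole second centre, including `y`, a
    -- contradiction.
    have h3 : c ≠ 3 := by
      rintro rfl
      obtain ⟨d, -, hD⟩ := card_pos_exponent hG (centralizer {y} ⊓ centralizer {x})
      have h5 := exponent_inf_of_notMem hG (hY hy hyZ) (self_mem_centralizer x) hxM hD
      rw [hC] at h5
      have h6 := Nat.pow_right_injective hp.out.two_le h5
      have hlt2 : center G < centralizer {y} ⊓ centralizer {x} := by
        refine lt_of_le_of_ne (le_inf (center_le_centralizer _) (center_le_centralizer _))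
          fun h => ?_
        rw [← h, hZ'] at hD
        have h7 : 1 = d := Nat.pow_right_injective hp.out.two_le hD
        have h6 : 3 = d + 1 := h6
        omega
      obtain ⟨s, ⟨hsy, hsx⟩, hsZ⟩ := SetLike.exists_of_lt hlt2
      have hle : centralizer {x} ≤ centralizer {s} := fun w hw =>
        mem_centralizer_singleton_iff.2 (congrArg Subtype.val (hcomm ⟨w, hw⟩ ⟨s, hsx⟩).eq)
      have hys : y ∈ centralizer {s} :=
        mem_centralizer_singleton_iff.2 (mem_centralizer_singleton_iff.1 hsy).symm
      obtain ⟨e, he, he', hE⟩ := exists_exponent_centralizer hG hZ' hsZ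
      have := exponent_lt_of_lt hC hE (lt_of_le_of_ne hle fun h => hyx (h ▸ hys))
      obtain rfl : e = 4 := by omega
      have hs2 := mem_secondCenter_of_card_centralizer hG hZ hsZ hE (hna' hE)
      exact hyx (hcov (center_le_centralizer _) hsx hs2 hsZ hy)
    obtain rfl : c = 2 := by omega
    exact centralizerType_of_commute hG hC hcomm

end Classification

/-! ### Commutator calculus on generators and upper bounds for orders -/

section Generation

open Subgroup
open scoped commutatorElement

variable {G : Type u} [Group G]

theorem pcComm_eq_commutatorElement (x y : G) : pcComm x y = ⁅x⁻¹, y⁻¹⁆ := by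
  rw [pcComm, commutatorElement_def, inv_inv, inv_inv]

/-- The collection form of a commutator relation: moving `x` past `y` leaves `z` on the right. -/
theorem pcComm_eq_iff {x y z : G} : pcComm x y = z ↔ x * y = y * x * z := by
  rw [pcComm, mul_assoc, mul_assoc, inv_mul_eq_iff_eq_mul, inv_mul_eq_iff_eq_mul, mul_assoc]

theorem pcComm_eq_one_iff {x y : G} : pcComm x y = 1 ↔ Commute x y := by
  rw [pcComm_eq_iff, mul_one]; rfl

theorem map_pcComm {H : Type v} [Group H] (f : G →* H) (x y : G) :
    f (pcComm x y) = pcComm (f x) (f y) := by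
  simp only [pcComm, map_mul, map_inv]

theorem conj_eq_mul_pcComm (x y : G) : y⁻¹ * x * y = x * pcComm x y := by
  rw [pcComm]; group

theorem pcComm_mem_commutator (x y : G) : pcComm x y ∈ commutator G := by
  rw [pcComm_eq_commutatorElement]
  exact commutator_mem_commutator (mem_top _) (mem_top _)

theorem commute_of_mem_closure {S : Set G} (h : ∀ x ∈ S, ∀ y ∈ S, Commute x y) :
    ∀ a ∈ closure S, ∀ b ∈ closure S, Commute a b := by
  have h1 : ∀ x ∈ S, ∀ b ∈ closure S, Commute b x := fun x hx b hb =>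
    mem_centralizer_singleton_iff.1 ((closure_le (centralizer {x})).2
      (fun y hy => mem_centralizer_singleton_iff.2 (h y hy x hx)) hb)
  intro a ha b hb
  exact mem_centralizer_singleton_iff.1 ((closure_le (centralizer {b})).2
    (fun y hy => mem_centralizer_singleton_iff.2 (h1 y hy b hb).symm) ha)

theorem mem_center_of_closure {S : Set G} (hS : closure S = ⊤) {x : G}
    (h : ∀ s ∈ S, Commute x s) : x ∈ center G := by
  refine mem_center_iff.2 fun g => ?_
  have : g ∈ closure S := hS ▸ mem_top g
  exact mem_centralizer_singleton_iff.1 ((closure_le (centralizer {x})).2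
    (fun y hy => mem_centralizer_singleton_iff.2 (h y hy).symm) this)

theorem commute_mk_of_pcComm_mem {N : Subgroup G} [N.Normal] {x y : G} (h : pcComm x y ∈ N) :
    Commute (x : G ⧸ N) (y : G ⧸ N) := by
  rw [← pcComm_eq_one_iff]
  exact (map_pcComm (QuotientGroup.mk' N) x y).symm.trans ((QuotientGroup.eq_one_iff _).2 h)

theorem mem_secondCenter_of_closure {S : Set G} (hS : closure S = ⊤) {x : G}
    (h : ∀ s ∈ S, pcComm x s ∈ center G) : x ∈ secondCenter G := by
  have hS' : closure ((QuotientGroup.mk' (center G)) '' S) = ⊤ := by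
    rw [← MonoidHom.map_closure, hS, ← MonoidHom.range_eq_map, MonoidHom.range_eq_top]
    exact QuotientGroup.mk'_surjective _
  refine mem_comap.2 (mem_center_of_closure hS' ?_)
  rintro _ ⟨s, hs, rfl⟩
  exact commute_mk_of_pcComm_mem (h s hs)

theorem commutator_le_of_closure {S : Set G} (hS : closure S = ⊤) {N : Subgroup G} [N.Normal]
    (h : ∀ x ∈ S, ∀ y ∈ S, pcComm x y ∈ N) : commutator G ≤ N := by
  rw [← Normal.quotient_commutative_iff_commutator_le]
  have hS' : closure ((QuotientGroup.mk' N) '' S) = ⊤ := by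
    rw [← MonoidHom.map_closure, hS, ← MonoidHom.range_eq_map, MonoidHom.range_eq_top]
    exact QuotientGroup.mk'_surjective _
  have := commute_of_mem_closure (S := (QuotientGroup.mk' N) '' S) (by
    rintro _ ⟨x, hx, rfl⟩ _ ⟨y, hy, rfl⟩
    exact commute_mk_of_pcComm_mem (h x hx y hy))
  exact ⟨⟨fun a b => this a (hS' ▸ mem_top a) b (hS' ▸ mem_top b)⟩⟩

theorem commutator_le_of_index_prime {p : ℕ} [Fact p.Prime] {A : Subgroup G} [A.Normal]
    (hA : A.index = p) : commutator G ≤ A := by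
  rw [← Normal.quotient_commutative_iff_commutator_le]
  have : IsCyclic (G ⧸ A) := isCyclic_of_prime_card hA
  let _ : CommGroup (G ⧸ A) := IsCyclic.commGroup
  exact ⟨⟨fun a b => mul_comm a b⟩⟩

/-- Adjoining an element `g` that normalizes `⟨S⟩` and satisfies `g ^ m ∈ ⟨S⟩` multiplies the
order by a divisor of `m`. -/
theorem card_closure_insert_dvd {S : Set G} {g : G} {m : ℕ} (hS : Nat.card (closure S) ≠ 0)
    (hm : g ^ m ∈ closure S) (hg : ∀ s ∈ S, g⁻¹ * s * g ∈ closure S) :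
    Nat.card (closure (insert g S)) ∣ m * Nat.card (closure S) := by
  set H := closure S
  set K := closure (insert g S)
  have hfin : Finite H := Nat.finite_of_card_ne_zero hS
  have hHK : H ≤ K := closure_mono (Set.subset_insert _ _)
  have hgK : g ∈ K := subset_closure (Set.mem_insert _ _)
  have hgN : g⁻¹ ∈ normalizer (H : Set G) := by
    have hle : H.map (MulAut.conj g⁻¹).toMonoidHom ≤ H := by
      rw [MonoidHom.map_closure, closure_le]
      rintro _ ⟨s, hs, rfl⟩
      simpa using hg s hs
    -- Only the inclusion is assumed, on generators; equality follows because `H` is finite.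
    have heq : H.map (MulAut.conj g⁻¹).toMonoidHom = H :=
      eq_of_le_of_card_ge hle (card_map_of_injective (MulAut.conj g⁻¹).injective).ge
    rw [mem_normalizer_iff]
    intro h
    constructor
    · intro hh
      exact hle ⟨h, hh, rfl⟩
    · intro hh
      have hh : g⁻¹ * h * g⁻¹⁻¹ ∈ H := hh
      rw [← heq] at hh
      obtain ⟨w, hw, hwh⟩ := hh
      have : w = h := (MulAut.conj g⁻¹).injective hwh
      exact this ▸ hw
  have hKN : K ≤ normalizer (H : Set G) := by
    refine (closure_le _).2 (Set.insert_subset ((inv_mem_iff).1 hgN) ?_)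
    exact fun s hs => le_normalizer (subset_closure hs)
  have hnormal : (H.subgroupOf K).Normal := normal_subgroupOf_iff_le_normalizer hHK |>.2 hKN
  set gK : K := ⟨g, hgK⟩
  set π := QuotientGroup.mk' (H.subgroupOf K)
  -- All generators other than `g` die in `K / H`, so this quotient is cyclic on the image of `g`,
  -- whose order divides `m`.
  have hall : ∀ x : K, π x ∈ zpowers (π gK) := by
    have h1 : K ≤ ((zpowers (π gK)).comap π).map K.subtype := by
      refine (closure_le _).2 (Set.insert_subset ⟨gK, mem_zpowers _, rfl⟩ fun s hs => ?_)
      refine ⟨⟨s, hHK (subset_closure hs)⟩, ?_, rfl⟩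
      have : π ⟨s, hHK (subset_closure hs)⟩ = 1 :=
        (QuotientGroup.eq_one_iff _).2 (mem_subgroupOf.2 (subset_closure hs))
      exact mem_comap.2 (this ▸ one_mem _)
    intro x
    obtain ⟨y, hy, hyx⟩ := h1 x.2
    have : y = x := Subtype.ext hyx
    exact this ▸ hy
  have hcard : Nat.card (K ⧸ H.subgroupOf K) = orderOf (π gK) := by
    rw [← Nat.card_zpowers]
    refine (Nat.card_congr (Equiv.subtypeUnivEquiv fun q => ?_)).symm
    obtain ⟨x, rfl⟩ := QuotientGroup.mk'_surjective _ q
    exact hall x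
  have hdvd : Nat.card (K ⧸ H.subgroupOf K) ∣ m := by
    rw [hcard, orderOf_dvd_iff_pow_eq_one, ← map_pow]
    exact (QuotientGroup.eq_one_iff _).2 (mem_subgroupOf.2 hm)
  rw [card_eq_card_quotient_mul_card_subgroup (H.subgroupOf K),
    Nat.card_congr (subgroupOfEquivOfLe hHK).toEquiv]
  exact Nat.mul_dvd_mul_right hdvd _

theorem card_closure_insert_dvd_pow {S : Set G} {g : G} {p k m j : ℕ} (hp : p ≠ 0)
    (hS : Nat.card (closure S) ∣ p ^ k) (hm : g ^ m ∈ closure S)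
    (hg : ∀ s ∈ S, g⁻¹ * s * g ∈ closure S) (hmj : m * p ^ k = p ^ j) :
    Nat.card (closure (insert g S)) ∣ p ^ j := by
  have h0 : Nat.card (closure S) ≠ 0 := fun h => pow_ne_zero k hp (by
    rw [h, zero_dvd_iff] at hS; exact hS)
  exact hmj ▸ (card_closure_insert_dvd h0 hm hg).trans (Nat.mul_dvd_mul_left m hS)

theorem conj_mem_of_pcComm_mem {H : Subgroup G} {s g : G} (hs : s ∈ H) (h : pcComm s g ∈ H) :
    g⁻¹ * s * g ∈ H := by
  rw [conj_eq_mul_pcComm]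
  exact mul_mem hs h

theorem conj_mem_of_commute {H : Subgroup G} {s g : G} (hs : s ∈ H) (h : Commute s g) :
    g⁻¹ * s * g ∈ H :=
  conj_mem_of_pcComm_mem hs (pcComm_eq_one_iff.2 h ▸ one_mem H)

end Generation

/-! ### Recognizing the families from an upper bound and nontrivial words -/

section Criteria

open Subgroup
open scoped commutatorElement

theorem Isoclinic.refl (G : Type u) [Group G] : Isoclinic G G :=
  ⟨⟨MulEquiv.refl _, MulEquiv.refl _, fun _ _ _ _ e₁ e₂ => commutatorElement_eq_of_mk_eq e₁ e₂⟩⟩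

theorem familyHasInvariants_of_finite {K : Type} [Group K] [Finite K] {a b : PowerSeries ℚ}
    (h : normA K = a ∧ normB K = b) : FamilyHasInvariants.{u} K a b := by
  intro G _ _ hG
  have := hG.norm_eq
  exact ⟨this.1.trans h.1, this.2.trans h.2⟩

theorem family_of_isStemGroup {K : Type} [Group K] [Finite K] {p r : ℕ} (hs : IsStemGroup K)
    (hK : Nat.card K = p ^ r) {a b : PowerSeries ℚ} (h : normA K = a ∧ normB K = b) :
    HasFamilyRank p K r ∧ FamilyHasInvariants.{u} K a b :=
  ⟨⟨K, inferInstance, Isoclinic.refl K, hs, hK⟩, familyHasInvariants_of_finite h⟩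

/-- An infinite type has `Nat.card` equal to `0`, which does not divide `p ^ r`. For this reason the
upper bounds are stated as divisibilities and not as inequalities. -/
theorem finite_of_card_dvd {K : Type} {p : ℕ} [hp : Fact p.Prime] {r : ℕ}
    (hK : Nat.card K ∣ p ^ r) : Finite K :=
  Nat.finite_of_card_ne_zero fun h => pow_ne_zero r hp.out.ne_zero (by
    rw [h, zero_dvd_iff] at hK; exact hK)

theorem exponent_ne_zero_of_ne_one {K : Type} [Group K] {p n : ℕ}
    (hK : Nat.card K = p ^ n) {z : K} (hz : z ≠ 1) :
    n ≠ 0 := by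
  rintro rfl
  rw [pow_zero] at hK
  have := (Nat.card_eq_one_iff_unique.1 hK).1
  exact hz (Subsingleton.elim _ _)

variable {K : Type} [Group K] {p : ℕ} [hp : Fact p.Prime]

theorem exists_exponents {r : ℕ} (hK : Nat.card K ∣ p ^ r) :
    ∃ n k, n ≤ r ∧ Nat.card K = p ^ n ∧ Nat.card (center K) = p ^ k ∧ (n ≠ 0 → 0 < k) := by
  have := finite_of_card_dvd hK
  obtain ⟨n, hn, hK⟩ := (Nat.dvd_prime_pow hp.out).1 hK
  obtain ⟨k, -, hk⟩ := card_pos_exponent hK (center K)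
  exact ⟨n, k, hn, hK, hk, fun h => center_exponent_pos h hK hk⟩

theorem notMem_center_of_pcComm_ne_one {x y : K} (h : pcComm x y ≠ 1) : x ∉ center K := fun hx =>
  h (pcComm_eq_one_iff.2 (mem_center_iff.1 hx y).symm)

/-- A nontrivial commutator gives `n ≥ k + 2` with `k ≥ 1`, so the upper bound `n ≤ 3` is attained
and the centre has order `p`. The later criteria follow the same pattern with longer commutators. -/
theorem family2_of_card_dvd (hK : Nat.card K ∣ p ^ 3) {x y : K} (hz : pcComm x y ∈ center K)
    (hxy : pcComm x y ≠ 1) :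
    HasFamilyRank p K 3 ∧ FamilyHasInvariants.{u} K (rowA2 p) (rowB2 p) := by
  have := finite_of_card_dvd hK
  obtain ⟨n, k, hn, hK, hk, hpos⟩ := exists_exponents hK
  have h0 := hpos (exponent_ne_zero_of_ne_one hK hxy)
  have h1 := exponent_center_add_two_le hK hk fun h => hxy (pcComm_eq_one_iff.2 (h x y))
  obtain rfl : n = 3 := by omega
  obtain rfl : k = 1 := by omega
  have hs := isStemGroup_of_card_center hK (by simpa using hk) hz (pcComm_mem_commutator x y) hxy
  exact family_of_isStemGroup hs hK (row2_of_isStemGroup hs hK)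

theorem family3_of_card_dvd (hK : Nat.card K ∣ p ^ 4) {x y z : K}
    (hz : pcComm (pcComm x y) z ∈ center K) (h1 : pcComm (pcComm x y) z ≠ 1) :
    HasFamilyRank p K 4 ∧ FamilyHasInvariants.{u} K (rowA3 p) (rowB3 p) := by
  have := finite_of_card_dvd hK
  obtain ⟨n, k, hn, hK, hk, hpos⟩ := exists_exponents hK
  have h0 := hpos (exponent_ne_zero_of_ne_one hK h1)
  have h2 := notMem_center_of_pcComm_ne_one h1
  rw [pcComm_eq_commutatorElement] at h2
  have h3 := exponent_center_add_three_le hK hk h2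
  obtain rfl : n = 4 := by omega
  obtain rfl : k = 1 := by omega
  have hs := isStemGroup_of_card_center hK (by simpa using hk) hz (pcComm_mem_commutator _ _) h1
  exact family_of_isStemGroup hs hK (row3_of_isStemGroup hs hK)

theorem card_of_class_four (hK : Nat.card K ∣ p ^ 5) {x y z w : K}
    (hc : pcComm (pcComm (pcComm x y) z) w ∈ center K)
    (h1 : pcComm (pcComm (pcComm x y) z) w ≠ 1) :
    Nat.card K = p ^ 5 ∧ Nat.card (center K) = p ∧ Nat.card (secondCenter K) = p ^ 2 ∧
      IsStemGroup K := by
  have := finite_of_card_dvd hK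
  obtain ⟨n, k, hn, hK, hk, hpos⟩ := exists_exponents hK
  have h0 := hpos (exponent_ne_zero_of_ne_one hK h1)
  have h2 := notMem_center_of_pcComm_ne_one h1
  rw [pcComm_eq_commutatorElement (pcComm x y), pcComm_eq_commutatorElement x,
    commutatorElement_inv] at h2
  have h3 := exponent_center_add_four_le hK hk h2
  obtain rfl : n = 5 := by omega
  obtain rfl : k = 1 := by omega
  have hk' : Nat.card (center K) = p := by simpa using hk
  exact ⟨hK, hk', card_secondCenter_of_class_four hK hk' h2,
    isStemGroup_of_card_center hK hk' hc (pcComm_mem_commutator _ _) h1⟩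

theorem family9_of_card_dvd (hK : Nat.card K ∣ p ^ 5) {x y z w : K}
    (hc : pcComm (pcComm (pcComm x y) z) w ∈ center K)
    (h1 : pcComm (pcComm (pcComm x y) z) w ≠ 1) {A : Subgroup K} (hA : Nat.card A ∣ p ^ 4)
    (hKA : Nat.card K ∣ p * Nat.card A) (hab : ∀ a ∈ A, ∀ b ∈ A, Commute a b) :
    HasFamilyRank p K 5 ∧ FamilyHasInvariants.{u} K (rowA9 p) (rowB9 p) := by
  have := finite_of_card_dvd hK
  obtain ⟨hK, hk, -, hs⟩ := card_of_class_four hK hc h1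
  have hA' : Nat.card A = p ^ 4 := by
    refine Nat.dvd_antisymm hA ?_
    rw [hK, pow_succ'] at hKA
    exact Nat.dvd_of_mul_dvd_mul_left hp.out.pos hKA
  exact family_of_isStemGroup hs hK
    (row9_of_abelian_subgroup (k := 1) hK (by simpa using hk) hA' hab)

/-- An abelian subgroup `A` of order `p ^ 4` would contain the commutators `a₂` and `a₃`, and it
would be the full centralizer of the noncentral `a₃`. It would then contain `a₁` too, contradicting
`[a₁, a₂] = a₄ ≠ 1`. -/
theorem family10_of_card_dvd (hK : Nat.card K ∣ p ^ 5) {a a₁ a₂ a₃ a₄ : K}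
    (h2 : pcComm a₁ a = a₂) (h3 : pcComm a₂ a = a₃) (h4 : pcComm a₃ a = a₄)
    (h12 : pcComm a₁ a₂ = a₄) (h13 : Commute a₁ a₃) (hc : a₄ ∈ center K) (hne : a₄ ≠ 1) :
    HasFamilyRank p K 5 ∧ FamilyHasInvariants.{u} K (rowA10 p) (rowB10 p) := by
  have := finite_of_card_dvd hK
  obtain ⟨hK, hk, hk2, hs⟩ := card_of_class_four (x := a₁) (y := a) (z := a) (w := a) hK
    (by rwa [h2, h3, h4]) (by rwa [h2, h3, h4])
  refine family_of_isStemGroup hs hK (row10_of_card_secondCenter hK hk hk2 fun A hA hab => ?_)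
  have hN := normal_of_card_eq hK hA
  have hle := commutator_le_of_index_prime (p := p) (A := A)
    (by rw [index_eq_pow (b := 1) hK hA, pow_one])
  have m2 : a₂ ∈ A := hle (h2 ▸ pcComm_mem_commutator a₁ a)
  have m3 : a₃ ∈ A := hle (h3 ▸ pcComm_mem_commutator a₂ a)
  have hA3 := centralizer_of_mem_abelian_index hK hA hab m3
    (notMem_center_of_pcComm_ne_one (y := a) (by rwa [h4]))
  have m1 : a₁ ∈ A := hA3 ▸ mem_centralizer_singleton_iff.2 h13
  exact hne (h12 ▸ pcComm_eq_one_iff.2 (hab a₁ m1 a₂ m2))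

/-- The two elements force `Z ∩ K'` to have order at least `p ^ 2`. Centre index `p ^ 2` would give
`|K'| ≤ p`, so the centre has index at least `p ^ 3`, and the upper bound makes everything an
equality. -/
theorem card_of_rank_two_center (hK : Nat.card K ∣ p ^ 5) {b₁ b₂ : K}
    (h1 : b₁ ∈ center K) (h2 : b₂ ∈ center K) (h1' : b₁ ∈ commutator K)
    (h2' : b₂ ∈ commutator K) (hb1 : b₁ ≠ 1) (hb2 : b₂ ∉ zpowers b₁) :
    Nat.card K = p ^ 5 ∧ Nat.card (center K) = p ^ 2 ∧ IsStemGroup K := by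
  have := finite_of_card_dvd hK
  obtain ⟨n, k, hn, hK, hk, hpos⟩ := exists_exponents hK
  obtain ⟨i, -, hi⟩ := card_pos_exponent hK (zpowers b₁)
  obtain ⟨j, -, hj⟩ := card_pos_exponent hK (center K ⊓ commutator K)
  obtain ⟨m, -, hm⟩ := card_pos_exponent hK (commutator K)
  have hi0 := exponent_lt_of_lt (a := 0) (by simp) hi
    (bot_lt_iff_ne_bot.2 fun h => hb1 (zpowers_eq_bot.1 h))
  have hij := exponent_lt_of_lt hi hj (lt_of_le_of_ne (zpowers_le.2 ⟨h1, h1'⟩)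
    fun h => hb2 (h ▸ ⟨h2, h2'⟩))
  have hjk : j ≤ k := (Nat.pow_le_pow_iff_right hp.out.one_lt).1 (by
    rw [← hj, ← hk]; exact card_le_of_le inf_le_left)
  have hjm : j ≤ m := (Nat.pow_le_pow_iff_right hp.out.one_lt).1 (by
    rw [← hj, ← hm]; exact card_le_of_le inf_le_right)
  have hna : ¬ ∀ x y : K, Commute x y := by
    intro h
    have : commutator K = ⊥ := by
      rw [commutator_def, eq_bot_iff, commutator_le]
      exact fun a _ b _ => commutatorElement_eq_one_iff_commute.2 (h a b)
    rw [this] at h1'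
    exact hb1 h1'
  have h3 := exponent_center_add_two_le hK hk hna
  have h4 : n ≠ k + 2 := by
    rintro rfl
    have := card_commutator_le_of_card_center hK hk
    rw [hm] at this
    have := (Nat.pow_le_pow_iff_right (n := m) (m := 1) hp.out.one_lt).1 (by simpa using this)
    omega
  obtain rfl : n = 5 := by omega
  obtain rfl : k = 2 := by omega
  exact ⟨hK, hk, inf_eq_left.1 (eq_of_le_of_exponent_le hj hk inf_le_left (by omega))⟩

theorem family4_of_card_dvd (hK : Nat.card K ∣ p ^ 5) {b₁ b₂ : K}
    (h1 : b₁ ∈ center K) (h2 : b₂ ∈ center K) (h1' : b₁ ∈ commutator K)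
    (h2' : b₂ ∈ commutator K) (hb1 : b₁ ≠ 1) (hb2 : b₂ ∉ zpowers b₁) {A : Subgroup K}
    (hA : Nat.card A ∣ p ^ 4) (hKA : Nat.card K ∣ p * Nat.card A)
    (hab : ∀ a ∈ A, ∀ b ∈ A, Commute a b) :
    HasFamilyRank p K 5 ∧ FamilyHasInvariants.{u} K (rowA3 p) (rowB3 p) := by
  have := finite_of_card_dvd hK
  obtain ⟨hK, hk, hs⟩ := card_of_rank_two_center hK h1 h2 h1' h2' hb1 hb2
  have hA' : Nat.card A = p ^ 4 := by
    refine Nat.dvd_antisymm hA ?_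
    rw [hK, pow_succ'] at hKA
    exact Nat.dvd_of_mul_dvd_mul_left hp.out.pos hKA
  exact family_of_isStemGroup hs hK (row3_of_abelian_subgroup hK hk hA' hab)

/-- The noncentral commutator `c` makes `K'` strictly larger than the centre, which is what
`row6_of_card_commutator` needs. -/
theorem family6_of_card_dvd (hK : Nat.card K ∣ p ^ 5) {b₁ b₂ c : K}
    (h1 : b₁ ∈ center K) (h2 : b₂ ∈ center K) (h1' : b₁ ∈ commutator K)
    (h2' : b₂ ∈ commutator K) (hb1 : b₁ ≠ 1) (hb2 : b₂ ∉ zpowers b₁)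
    (hc : c ∈ commutator K) (hcZ : c ∉ center K) :
    HasFamilyRank p K 5 ∧ FamilyHasInvariants.{u} K (rowA6 p) (rowB6 p) := by
  have := finite_of_card_dvd hK
  obtain ⟨hK, hk, hs⟩ := card_of_rank_two_center hK h1 h2 h1' h2' hb1 hb2
  refine family_of_isStemGroup hs hK (row6_of_card_commutator hK hk ?_)
  rw [← hk]
  exact card_lt_of_lt (lt_of_le_of_ne hs fun h => hcZ (h ▸ hc))

/-- Each `wᵢ` centralizes the earlier `uⱼ` but not `uᵢ`, so centralizing `u₁`, `u₂`, `u₃` in turn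
gives strict inclusions from `K` down to a subgroup still larger than the centre. Four strict steps
give centre index at least `p ^ 4`. -/
theorem card_of_centralizer_chain (hK : Nat.card K ∣ p ^ 5) {u₁ u₂ u₃ u₄ w₁ w₂ w₃ w₄ : K}
    (h1 : ¬ Commute w₁ u₁) (h2 : Commute w₂ u₁) (h2' : ¬ Commute w₂ u₂)
    (h3 : Commute w₃ u₁ ∧ Commute w₃ u₂) (h3' : ¬ Commute w₃ u₃)
    (h4 : Commute w₄ u₁ ∧ Commute w₄ u₂ ∧ Commute w₄ u₃) (h4' : ¬ Commute w₄ u₄) :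
    Nat.card K = p ^ 5 ∧ Nat.card (center K) = p := by
  have := finite_of_card_dvd hK
  obtain ⟨n, k, hn, hK, hk, hpos⟩ := exists_exponents hK
  have hw1 : w₁ ≠ 1 := fun h => h1 (h ▸ Commute.one_left _)
  have h0 := hpos (exponent_ne_zero_of_ne_one hK hw1)
  have hmem : ∀ {x y : K}, y ∈ centralizer {x} ↔ Commute y x := mem_centralizer_singleton_iff
  set C₁ := centralizer {u₁}
  set C₂ := C₁ ⊓ centralizer {u₂}
  set C₃ := C₂ ⊓ centralizer {u₃}
  have l1 : C₁ < ⊤ := lt_top_iff_ne_top.2 fun h => h1 (hmem.1 (by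
    change w₁ ∈ C₁
    rw [h]
    exact mem_top w₁))
  have l2 : C₂ < C₁ := lt_of_le_of_ne inf_le_left fun h => h2' (by
    have : w₂ ∈ C₁ := hmem.2 h2
    rw [← h] at this
    exact hmem.1 this.2)
  have l3 : C₃ < C₂ := lt_of_le_of_ne inf_le_left fun h => h3' (by
    have : w₃ ∈ C₂ := ⟨hmem.2 h3.1, hmem.2 h3.2⟩
    rw [← h] at this
    exact hmem.1 this.2)
  have l4 : center K < C₃ := lt_of_le_of_ne (le_inf (le_inf (center_le_centralizer _)
    (center_le_centralizer _)) (center_le_centralizer _)) fun h => h4' (by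
    have : w₄ ∈ C₃ := ⟨⟨hmem.2 h4.1, hmem.2 h4.2.1⟩, hmem.2 h4.2.2⟩
    rw [← h] at this
    exact (mem_center_iff.1 this u₄).symm)
  obtain ⟨c₁, -, e1⟩ := card_pos_exponent hK C₁
  obtain ⟨c₂, -, e2⟩ := card_pos_exponent hK C₂
  obtain ⟨c₃, -, e3⟩ := card_pos_exponent hK C₃
  have := exponent_lt_of_lt e1 (by rw [card_top, hK]) l1
  have := exponent_lt_of_lt e2 e1 l2
  have := exponent_lt_of_lt e3 e2 l3
  have := exponent_lt_of_lt hk e3 l4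
  obtain rfl : n = 5 := by omega
  obtain rfl : k = 1 := by omega
  exact ⟨hK, by simpa using hk⟩

theorem family5_of_card (hK : Nat.card K = p ^ 5 ∧ Nat.card (center K) = p)
    (hle : commutator K ≤ center K) {x y : K} (hxy : pcComm x y ≠ 1) :
    HasFamilyRank p K 5 ∧ FamilyHasInvariants.{u} K (rowA5 p) (rowB5 p) := by
  have := finite_of_card_dvd (p := p) hK.1.dvd
  have hs := isStemGroup_of_card_center hK.1 hK.2 (hle (pcComm_mem_commutator x y))
    (pcComm_mem_commutator x y) hxy
  exact family_of_isStemGroup hs hK.1 (row5_of_commutator_le hK.1 hK.2 hle)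

/-- The second centre has order exactly `p ^ 3`. At least, since its intersection with `C(w)` lies
strictly between the centre and it, witnessed by `s` and `t`; at most, since `K / Z` is not abelian.
-/
theorem family7_of_card (hK : Nat.card K = p ^ 5 ∧ Nat.card (center K) = p)
    {z s t w x y : K} (hz : z ∈ center K) (hz' : z ∈ commutator K) (hz1 : z ≠ 1)
    (hs2 : s ∈ secondCenter K) (hsZ : s ∉ center K) (hsw : Commute s w)
    (ht2 : t ∈ secondCenter K) (htw : ¬ Commute t w) (hxy : pcComm x y ∉ center K) :
    HasFamilyRank p K 5 ∧ FamilyHasInvariants.{u} K (rowA7 p) (rowB7 p) := by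
  have := finite_of_card_dvd (p := p) hK.1.dvd
  obtain ⟨hK, hk⟩ := hK
  have hs := isStemGroup_of_card_center hK hk hz hz' hz1
  have hk' : Nat.card (center K) = p ^ 1 := by rw [hk, pow_one]
  have hmem : ∀ {x y : K}, y ∈ centralizer {x} ↔ Commute y x := mem_centralizer_singleton_iff
  obtain ⟨i, -, hi⟩ := card_pos_exponent hK (secondCenter K ⊓ centralizer {w})
  have l1 := exponent_lt_of_lt hk' hi (lt_of_le_of_ne
    (le_inf center_le_secondCenter (center_le_centralizer _)) fun h => hsZ (by
      rw [h]; exact ⟨hs2, hmem.2 hsw⟩))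
  obtain ⟨j, -, hj⟩ := card_pos_exponent hK (secondCenter K)
  have l2 := exponent_lt_of_lt hi hj (lt_of_le_of_ne inf_le_left fun h => htw (by
    rw [← h] at ht2; exact hmem.1 ht2.2))
  have hQ := card_quotient_center (j := 4) hK hk'
  obtain ⟨m, -, hm⟩ := card_pos_exponent hQ (center (K ⧸ center K))
  have l3 := exponent_center_add_two_le hQ hm fun h => hxy (by
    rw [← QuotientGroup.eq_one_iff]
    exact (map_pcComm (QuotientGroup.mk' (center K)) x y).trans (pcComm_eq_one_iff.2 (h _ _)))
  have h5 := card_secondCenter (G := K)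
  rw [hj, hm, hk, ← pow_succ] at h5
  have h6 : j = m + 1 := Nat.pow_right_injective hp.out.two_le h5
  obtain rfl : j = 3 := by omega
  exact family_of_isStemGroup hs hK (row7_of_card_secondCenter hK hk hj)

end Criteria

/-! ### Reading off the defining relations -/

section Presentations

open Subgroup

variable {G : Type u} [Group G]

theorem PresentedGroup.lift_of_eq_one {α : Type*} (rels : Set (FreeGroup α)) :
    ∀ r ∈ rels, FreeGroup.lift (PresentedGroup.of (rels := rels)) r = 1 := by
  intro r hr
  have h : FreeGroup.lift (PresentedGroup.of (rels := rels)) = PresentedGroup.mk rels := by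
    ext x
    exact FreeGroup.lift_apply_of
  rw [h]
  exact PresentedGroup.one_of_mem hr

/-- A generator is nontrivial as soon as some group satisfying the relations has a nontrivial
element in its place. -/
theorem PresentedGroup.of_ne_one {α : Type*} {rels : Set (FreeGroup α)} {g : α → G}
    (h : ∀ r ∈ rels, FreeGroup.lift g r = 1) {i : α} (hi : g i ≠ 1) :
    (PresentedGroup.of i : PresentedGroup rels) ≠ 1 := by
  intro h1
  apply hi
  rw [← PresentedGroup.toGroup.of h, h1, map_one]

theorem closure_fin_three {g : Fin 3 → G} (h : closure (Set.range g) = ⊤) :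
    closure {g 0, g 1, g 2} = ⊤ := by
  rw [← h]
  congr 1
  ext x
  simp [Fin.exists_fin_succ, eq_comm]

theorem closure_fin_four {g : Fin 4 → G} (h : closure (Set.range g) = ⊤) :
    closure {g 0, g 1, g 2, g 3} = ⊤ := by
  rw [← h]
  congr 1
  ext x
  simp [Fin.exists_fin_succ, eq_comm]

theorem closure_fin_five {g : Fin 5 → G} (h : closure (Set.range g) = ⊤) :
    closure {g 0, g 1, g 2, g 3, g 4} = ⊤ := by
  rw [← h]
  congr 1
  ext x
  simp [Fin.exists_fin_succ, eq_comm]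

/-- This equivalence and its analogues are used in both directions: to extract relations in the
presented group and to verify them in a model. -/
theorem phi2_iff (p : ℕ) (g : Fin 3 → G) : (∀ r ∈ Phi2Rels p, FreeGroup.lift g r = 1) ↔
    pcComm (g 1) (g 0) = g 2 ∧ g 0 ^ p = 1 ∧ g 1 ^ p = 1 ∧ g 2 ^ p = 1 ∧
      Commute (g 2) (g 0) ∧ Commute (g 1) (g 2) := by
  simp only [Phi2Rels, Set.mem_insert_iff, Set.mem_singleton_iff, forall_eq_or_imp, forall_eq,
    map_mul, map_inv, map_pow, map_pcComm, FreeGroup.lift_apply_of, mul_inv_eq_one,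
    pcComm_eq_one_iff]

theorem phi3_iff (p : ℕ) (g : Fin 4 → G) : (∀ r ∈ Phi3Rels p, FreeGroup.lift g r = 1) ↔
    pcComm (g 1) (g 0) = g 2 ∧ pcComm (g 2) (g 0) = g 3 ∧ g 0 ^ p = 1 ∧
      g 1 ^ p * g 2 ^ p.choose 2 * g 3 ^ p.choose 3 = 1 ∧ g 2 ^ p * g 3 ^ p.choose 2 = 1 ∧
      g 3 ^ p = 1 ∧ Commute (g 3) (g 0) ∧ Commute (g 1) (g 2) ∧ Commute (g 1) (g 3) ∧
      Commute (g 2) (g 3) := by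
  simp only [Phi3Rels, Set.mem_insert_iff, Set.mem_singleton_iff, forall_eq_or_imp, forall_eq,
    map_mul, map_inv, map_pow, map_pcComm, FreeGroup.lift_apply_of, mul_inv_eq_one,
    pcComm_eq_one_iff]

theorem phi4_iff (p : ℕ) (g : Fin 5 → G) : (∀ r ∈ Phi4Rels p, FreeGroup.lift g r = 1) ↔
    pcComm (g 1) (g 0) = g 3 ∧ pcComm (g 2) (g 0) = g 4 ∧ g 0 ^ p = 1 ∧ g 1 ^ p = 1 ∧
      g 2 ^ p = 1 ∧ g 3 ^ p = 1 ∧ g 4 ^ p = 1 ∧ Commute (g 0) (g 3) ∧ Commute (g 0) (g 4) ∧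
      Commute (g 1) (g 2) ∧ Commute (g 1) (g 3) ∧ Commute (g 1) (g 4) ∧ Commute (g 2) (g 3) ∧
      Commute (g 2) (g 4) ∧ Commute (g 3) (g 4) := by
  simp only [Phi4Rels, Set.mem_insert_iff, Set.mem_singleton_iff, forall_eq_or_imp, forall_eq,
    map_mul, map_inv, map_pow, map_pcComm, FreeGroup.lift_apply_of, mul_inv_eq_one,
    pcComm_eq_one_iff]

theorem phi5_iff (p : ℕ) (g : Fin 5 → G) : (∀ r ∈ Phi5Rels p, FreeGroup.lift g r = 1) ↔
    pcComm (g 0) (g 1) = g 4 ∧ pcComm (g 2) (g 3) = g 4 ∧ g 0 ^ p = 1 ∧ g 1 ^ p = 1 ∧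
      g 2 ^ p = 1 ∧ g 3 ^ p = 1 ∧ g 4 ^ p = 1 ∧ Commute (g 0) (g 2) ∧ Commute (g 0) (g 3) ∧
      Commute (g 1) (g 2) ∧ Commute (g 1) (g 3) ∧ Commute (g 0) (g 4) ∧ Commute (g 1) (g 4) ∧
      Commute (g 2) (g 4) ∧ Commute (g 3) (g 4) := by
  simp only [Phi5Rels, Set.mem_insert_iff, Set.mem_singleton_iff, forall_eq_or_imp, forall_eq,
    map_mul, map_inv, map_pow, map_pcComm, FreeGroup.lift_apply_of, mul_inv_eq_one,
    pcComm_eq_one_iff]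

theorem phi6_iff (p : ℕ) (g : Fin 5 → G) : (∀ r ∈ Phi6Rels p, FreeGroup.lift g r = 1) ↔
    pcComm (g 0) (g 1) = g 2 ∧ pcComm (g 2) (g 0) = g 3 ∧ pcComm (g 2) (g 1) = g 4 ∧
      g 0 ^ p = 1 ∧ g 1 ^ p = 1 ∧ g 2 ^ p = 1 ∧ g 3 ^ p = 1 ∧ g 4 ^ p = 1 ∧
      Commute (g 0) (g 3) ∧ Commute (g 0) (g 4) ∧ Commute (g 1) (g 3) ∧ Commute (g 1) (g 4) ∧
      Commute (g 2) (g 3) ∧ Commute (g 2) (g 4) ∧ Commute (g 3) (g 4) := by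
  simp only [Phi6Rels, Set.mem_insert_iff, Set.mem_singleton_iff, forall_eq_or_imp, forall_eq,
    map_mul, map_inv, map_pow, map_pcComm, FreeGroup.lift_apply_of, mul_inv_eq_one,
    pcComm_eq_one_iff]

theorem phi7_iff (p : ℕ) (g : Fin 5 → G) : (∀ r ∈ Phi7Rels p, FreeGroup.lift g r = 1) ↔
    pcComm (g 1) (g 0) = g 2 ∧ pcComm (g 2) (g 0) = g 3 ∧ pcComm (g 1) (g 4) = g 3 ∧
      g 0 ^ p = 1 ∧ g 1 ^ p * g 2 ^ p.choose 2 * g 3 ^ p.choose 3 = 1 ∧ g 2 ^ p = 1 ∧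
      g 3 ^ p = 1 ∧ g 4 ^ p = 1 ∧ Commute (g 0) (g 3) ∧ Commute (g 0) (g 4) ∧
      Commute (g 1) (g 2) ∧ Commute (g 1) (g 3) ∧ Commute (g 2) (g 3) ∧ Commute (g 2) (g 4) ∧
      Commute (g 3) (g 4) := by
  simp only [Phi7Rels, Set.mem_insert_iff, Set.mem_singleton_iff, forall_eq_or_imp, forall_eq,
    map_mul, map_inv, map_pow, map_pcComm, FreeGroup.lift_apply_of, mul_inv_eq_one,
    pcComm_eq_one_iff]

theorem phi8_iff (p : ℕ) (g : Fin 3 → G) : (∀ r ∈ Phi8Rels p, FreeGroup.lift g r = 1) ↔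
    pcComm (g 0) (g 1) = g 2 ∧ g 2 = g 0 ^ p ∧ g 2 ^ p ^ 2 = 1 ∧ g 1 ^ p ^ 2 = 1 := by
  simp only [Phi8Rels, Set.mem_insert_iff, Set.mem_singleton_iff, forall_eq_or_imp, forall_eq,
    map_mul, map_inv, map_pow, map_pcComm, FreeGroup.lift_apply_of, mul_inv_eq_one]

theorem phi9_iff (p : ℕ) (g : Fin 5 → G) : (∀ r ∈ Phi9Rels p, FreeGroup.lift g r = 1) ↔
    pcComm (g 1) (g 0) = g 2 ∧ pcComm (g 2) (g 0) = g 3 ∧ pcComm (g 3) (g 0) = g 4 ∧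
      g 0 ^ p = 1 ∧
      g 1 ^ p * g 2 ^ p.choose 2 * g 3 ^ p.choose 3 * g 4 ^ p.choose 4 = 1 ∧
      g 2 ^ p * g 3 ^ p.choose 2 * g 4 ^ p.choose 3 = 1 ∧ g 3 ^ p * g 4 ^ p.choose 2 = 1 ∧
      g 4 ^ p = 1 ∧ Commute (g 0) (g 4) ∧ Commute (g 1) (g 2) ∧ Commute (g 1) (g 3) ∧
      Commute (g 1) (g 4) ∧ Commute (g 2) (g 3) ∧ Commute (g 2) (g 4) ∧ Commute (g 3) (g 4) := by
  simp only [Phi9Rels, Set.mem_insert_iff, Set.mem_singleton_iff, forall_eq_or_imp, forall_eq,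
    map_mul, map_inv, map_pow, map_pcComm, FreeGroup.lift_apply_of, mul_inv_eq_one,
    pcComm_eq_one_iff]

theorem phi10_iff (p : ℕ) (g : Fin 5 → G) : (∀ r ∈ Phi10Rels p, FreeGroup.lift g r = 1) ↔
    pcComm (g 1) (g 0) = g 2 ∧ pcComm (g 2) (g 0) = g 3 ∧ pcComm (g 3) (g 0) = g 4 ∧
      pcComm (g 1) (g 2) = g 4 ∧ g 0 ^ p = 1 ∧
      g 1 ^ p * g 2 ^ p.choose 2 * g 3 ^ p.choose 3 * g 4 ^ p.choose 4 = 1 ∧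
      g 2 ^ p * g 3 ^ p.choose 2 * g 4 ^ p.choose 3 = 1 ∧ g 3 ^ p * g 4 ^ p.choose 2 = 1 ∧
      g 4 ^ p = 1 ∧ Commute (g 0) (g 4) ∧ Commute (g 1) (g 3) ∧
      Commute (g 1) (g 4) ∧ Commute (g 2) (g 3) ∧ Commute (g 2) (g 4) ∧ Commute (g 3) (g 4) := by
  simp only [Phi10Rels, Set.mem_insert_iff, Set.mem_singleton_iff, forall_eq_or_imp, forall_eq,
    map_mul, map_inv, map_pow, map_pcComm, FreeGroup.lift_apply_of, mul_inv_eq_one,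
    pcComm_eq_one_iff]

theorem gamma4_iff (g : Fin 3 → G) : (∀ r ∈ Gamma4Rels, FreeGroup.lift g r = 1) ↔
    g 0 ^ 4 = 1 ∧ g 1 ^ 4 = 1 ∧ g 2 ^ 2 = 1 ∧ g 2 * g 0 * (g 2)⁻¹ = (g 0)⁻¹ ∧
      g 2 * g 1 * (g 2)⁻¹ = (g 1)⁻¹ ∧ Commute (g 0) (g 1) := by
  simp only [Gamma4Rels, Set.mem_insert_iff, Set.mem_singleton_iff, forall_eq_or_imp, forall_eq,
    map_mul, map_inv, map_pow, map_pcComm, FreeGroup.lift_apply_of, mul_inv_eq_one,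
    pcComm_eq_one_iff]

theorem gamma5_iff (g : Fin 5 → G) : (∀ r ∈ Gamma5Rels, FreeGroup.lift g r = 1) ↔
    g 0 ^ 2 = 1 ∧ g 1 ^ 2 = 1 ∧ g 2 ^ 2 = 1 ∧ g 3 ^ 2 = 1 ∧ g 4 ^ 2 = 1 ∧
      g 0 * g 1 * (g 0)⁻¹ = g 4 * (g 1)⁻¹ ∧ g 0 * g 3 * (g 0)⁻¹ = g 4 * (g 3)⁻¹ ∧
      g 1 * g 2 * (g 1)⁻¹ = g 4 * (g 2)⁻¹ ∧ Commute (g 0) (g 2) ∧ Commute (g 1) (g 3) ∧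
      Commute (g 2) (g 3) ∧ Commute (g 0) (g 4) ∧ Commute (g 1) (g 4) ∧ Commute (g 2) (g 4) ∧
      Commute (g 3) (g 4) := by
  simp only [Gamma5Rels, Set.mem_insert_iff, Set.mem_singleton_iff, forall_eq_or_imp, forall_eq,
    map_mul, map_inv, map_pow, map_pcComm, FreeGroup.lift_apply_of, mul_inv_eq_one,
    pcComm_eq_one_iff]

theorem gamma6_iff (g : Fin 3 → G) : (∀ r ∈ Gamma6Rels, FreeGroup.lift g r = 1) ↔
    g 0 ^ 8 = 1 ∧ g 1 ^ 2 = 1 ∧ g 2 ^ 2 = 1 ∧ g 1 * g 0 * (g 1)⁻¹ = (g 0)⁻¹ ∧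
      g 2 * g 0 * (g 2)⁻¹ = g 0 ^ 5 ∧ Commute (g 1) (g 2) := by
  simp only [Gamma6Rels, Set.mem_insert_iff, Set.mem_singleton_iff, forall_eq_or_imp, forall_eq,
    map_mul, map_inv, map_pow, map_pcComm, FreeGroup.lift_apply_of, mul_inv_eq_one,
    pcComm_eq_one_iff]

theorem gamma7_iff (g : Fin 4 → G) : (∀ r ∈ Gamma7Rels, FreeGroup.lift g r = 1) ↔
    g 1 ^ 2 = 1 ∧ g 2 ^ 2 = 1 ∧ g 3 ^ 2 = 1 ∧ g 0 ^ 4 = 1 ∧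
      g 0 * g 2 * (g 0)⁻¹ = g 1 * g 2 ∧ g 0 * g 3 * (g 0)⁻¹ = g 2 * g 3 ∧
      Commute (g 0) (g 1) ∧ Commute (g 1) (g 2) ∧ Commute (g 1) (g 3) ∧ Commute (g 2) (g 3) := by
  simp only [Gamma7Rels, Set.mem_insert_iff, Set.mem_singleton_iff, forall_eq_or_imp, forall_eq,
    map_mul, map_inv, map_pow, map_pcComm, FreeGroup.lift_apply_of, mul_inv_eq_one,
    pcComm_eq_one_iff]

end Presentations

/-! ### Affine maps over truncated polynomial rings -/

section AffineModel

open Subgroup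

/-- Evaluate at `0`. For exponent zero this would make `p` a unit; otherwise it shows that `X`
divides `b`, and cancelling one factor `X` lowers the exponent. -/
theorem pow_ne_mul_add_mul {p : ℤ} (hp : ¬ IsUnit p) (hp0 : p ≠ 0) (M : Polynomial ℤ) :
    ∀ (k : ℕ) (a b : Polynomial ℤ), Polynomial.X ^ k ≠
      a * Polynomial.X ^ (k + 1) + b * (Polynomial.C p + Polynomial.X * M) := by
  intro k
  induction k with
  | zero =>
    intro a b h
    have := congrArg (Polynomial.eval 0) h
    simp only [pow_zero, Polynomial.eval_one, zero_add, pow_one, Polynomial.eval_add,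
      Polynomial.eval_mul, Polynomial.eval_X, mul_zero, Polynomial.eval_C, zero_mul,
      add_zero] at this
    exact hp (IsUnit.of_mul_eq_one_right _ this.symm)
  | succ k ih =>
    intro a b h
    have h0 := congrArg (Polynomial.eval 0) h
    simp only [ne_eq, Nat.succ_ne_zero, not_false_eq_true, zero_pow, Polynomial.eval_pow,
      Polynomial.eval_X, Polynomial.eval_add, Polynomial.eval_mul, mul_zero, Polynomial.eval_C,
      zero_mul, add_zero, zero_add] at h0
    have hb : Polynomial.eval 0 b = 0 := (mul_eq_zero.1 h0.symm).resolve_right hp0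
    obtain ⟨c, rfl⟩ : Polynomial.X ∣ b := by
      rw [Polynomial.X_dvd_iff, Polynomial.coeff_zero_eq_eval_zero, hb]
    refine ih a c (mul_left_cancel₀ (Polynomial.X_ne_zero (R := ℤ)) ?_)
    linear_combination h

/-- The class of `X` in the ring `ℤ[X] / (X ^ (k + 1), p + X M)` has nonzero `k`-th power. -/
theorem exists_truncated_ring {p : ℕ} (hp : p.Prime) (k : ℕ) (M : Polynomial ℤ) :
    ∃ (R : Type) (_ : CommRing R) (x : R), x ^ (k + 1) = 0 ∧
      (p : R) + x * M.eval₂ (Int.castRingHom R) x = 0 ∧ x ^ k ≠ 0 := by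
  let I : Ideal (Polynomial ℤ) :=
    Ideal.span {Polynomial.X ^ (k + 1), Polynomial.C (p : ℤ) + Polynomial.X * M}
  have hx : M.eval₂ (Int.castRingHom (Polynomial ℤ ⧸ I)) (Ideal.Quotient.mk I Polynomial.X) =
      Ideal.Quotient.mk I M := by
    conv_rhs => rw [← Polynomial.eval₂_C_X (p := M), Polynomial.hom_eval₂]
    rw [RingHom.ext_int ((Ideal.Quotient.mk I).comp Polynomial.C) (Int.castRingHom _)]
  refine ⟨Polynomial ℤ ⧸ I, inferInstance, Ideal.Quotient.mk I Polynomial.X, ?_, ?_, ?_⟩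
  · rw [← map_pow, Ideal.Quotient.eq_zero_iff_mem]
    exact Ideal.subset_span (Set.mem_insert _ _)
  · rw [hx, ← map_mul, ← map_natCast (Ideal.Quotient.mk I), ← map_add,
      Ideal.Quotient.eq_zero_iff_mem]
    have : (p : Polynomial ℤ) = Polynomial.C (p : ℤ) := by simp
    rw [this]
    exact Ideal.subset_span (Set.mem_insert_of_mem _ rfl)
  · rw [← map_pow, Ne, Ideal.Quotient.eq_zero_iff_mem, Ideal.mem_span_pair]
    rintro ⟨a, b, h⟩
    exact pow_ne_mul_add_mul (Nat.prime_iff_prime_int.1 hp).not_isUnit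
      (Int.natCast_ne_zero.2 hp.ne_zero) M k a b h.symm

theorem add_pow_eq_sum_range {R : Type*} [CommRing R] {x : R} {p k : ℕ} (hk : k ≤ p + 1)
    (hx : x ^ k = 0) : (1 + x) ^ p = ∑ i ∈ Finset.range k, x ^ i * (p.choose i : R) := by
  rw [add_comm, add_pow]
  simp only [one_pow, mul_one]
  refine (Finset.sum_subset (Finset.range_mono hk) fun i _ hi => ?_).symm
  rw [pow_eq_zero_of_le (by simpa using hi) hx, zero_mul]

variable {R : Type} [CommRing R]

theorem addLeft_mul (v w : R) : Equiv.addLeft v * Equiv.addLeft w = Equiv.addLeft (v + w) := by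
  ext y
  simp

theorem addLeft_pow (v : R) (n : ℕ) : Equiv.addLeft v ^ n = Equiv.addLeft (n * v) := by
  induction n with
  | zero => ext; simp
  | succ n ih => rw [pow_succ, ih, addLeft_mul, Nat.cast_succ, add_one_mul]

theorem addLeft_eq_one_iff {v : R} : Equiv.addLeft v = 1 ↔ v = 0 := by
  constructor
  · intro h
    simpa using DFunLike.congr_fun h 0
  · rintro rfl
    ext y
    simp

theorem addLeft_commute (v w : R) : Commute (Equiv.addLeft v) (Equiv.addLeft w) := by
  change _ * _ = _ * _
  rw [addLeft_mul, addLeft_mul, add_comm]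

/-- Taking commutators with this multiplication map acts on translations as multiplication by `u -
1`. With `u = 1 + x` nilpotently close to `1`, iterated commutators are translations by `x v`, `x ^
2 v` and so on. The inverse `u⁻¹` fits the convention `[x, y] = x⁻¹ y⁻¹ x y`. -/
theorem pcComm_addLeft_toPerm (u : Rˣ) (v : R) :
    pcComm (Equiv.addLeft v) (MulAction.toPermHom Rˣ R u⁻¹) =
      Equiv.addLeft (((u : R) - 1) * v) := by
  rw [pcComm_eq_iff]
  ext y
  have h : u⁻¹ • ((u : R) * v) = v := by
    simp [Units.smul_def]
  simp only [Equiv.Perm.coe_mul, Function.comp_apply, Equiv.coe_addLeft,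
    MulAction.toPermHom_apply, MulAction.toPerm_apply]
  rw [← add_assoc, show v + ((u : R) - 1) * v = u * v by ring, smul_add, h]

theorem toPermHom_pow_eq_one {u : Rˣ} {n : ℕ} (h : (u : R) ^ n = 1) :
    MulAction.toPermHom Rˣ R u⁻¹ ^ n = 1 := by
  have : u ^ n = 1 := Units.ext (by simpa using h)
  rw [← map_pow, inv_pow, this, inv_one, map_one]

end AffineModel

/-! ### Models showing that the critical words are nontrivial -/

section Nontriviality

open Subgroup

variable {p : ℕ}

theorem phi9_of_four_ne_one (hp : p.Prime) (h2 : p ≠ 2) :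
    (PresentedGroup.of 4 : Phi9 p) ≠ 1 := by
  have hp3 : 3 ≤ p := by have := hp.two_le; omega
  -- The polynomial is chosen so that `p + x M` is `((1 + x) ^ p - 1) / x` truncated at `x ^ 4 = 0`.
  -- Its vanishing gives `(1 + x) ^ p = 1` and also the relations `αᵢ⁽ᵖ⁾ = 1`.
  obtain ⟨R, _, x, hx, hN, hx3⟩ := exists_truncated_ring hp 3
    ((p.choose 2 : Polynomial ℤ) + (p.choose 3 : Polynomial ℤ) * Polynomial.X +
      (p.choose 4 : Polynomial ℤ) * Polynomial.X ^ 2)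
  simp only [Polynomial.eval₂_add, Polynomial.eval₂_mul, Polynomial.eval₂_natCast,
    Polynomial.eval₂_pow, Polynomial.eval₂_X] at hN
  have hx : x ^ 4 = 0 := hx
  obtain ⟨u, hu⟩ : IsUnit (1 + x) := IsNilpotent.isUnit_one_add ⟨4, hx⟩
  have hux : (u : R) - 1 = x := by rw [hu]; ring
  have hup : (u : R) ^ p = 1 := by
    rw [hu, add_pow_eq_sum_range (by omega) hx]
    simp only [Finset.sum_range_succ, Finset.sum_range_zero, Nat.choose_zero_right,
      Nat.choose_one_right, Nat.cast_one]
    linear_combination x * hN - p.choose 4 * hx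
  have hc : ∀ v : R, pcComm (Equiv.addLeft v) (MulAction.toPermHom Rˣ R u⁻¹) =
      Equiv.addLeft (x * v) := fun v => by rw [pcComm_addLeft_toPerm, hux]
  -- The generator `αᵢ` becomes translation by `x ^ (i - 1)`, so its power relation is `x ^ (i - 1)`
  -- times `hN` modulo `x ^ 4`.
  refine PresentedGroup.of_ne_one (g := ![MulAction.toPermHom Rˣ R u⁻¹, Equiv.addLeft 1,
    Equiv.addLeft x, Equiv.addLeft (x ^ 2), Equiv.addLeft (x ^ 3)]) ((phi9_iff p _).2 ?_)
    (addLeft_eq_one_iff.not.2 hx3)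
  simp only [Matrix.cons_val, hc, addLeft_pow, addLeft_mul, addLeft_eq_one_iff, addLeft_commute]
  refine ⟨by ring_nf, by ring_nf, by ring_nf, toPermHom_pow_eq_one hup, ?_, ?_, ?_, ?_, ?_,
    trivial, trivial, trivial, trivial, trivial, trivial⟩
  · linear_combination hN
  · linear_combination x * hN - p.choose 4 * hx
  · linear_combination x ^ 2 * hN - (p.choose 3 + p.choose 4 * x) * hx
  · linear_combination x ^ 3 * hN - (p.choose 2 + p.choose 3 * x + p.choose 4 * x ^ 2) * hx
  · refine (pcComm_eq_one_iff.1 ?_).symm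
    rw [hc, addLeft_eq_one_iff]
    linear_combination hx

theorem pow_choose_two_eq_one {G : Type*} [Group G] (hp : p.Prime) (h2 : p ≠ 2) {x : G}
    (hx : x ^ p = 1) : x ^ p.choose 2 = 1 := by
  obtain ⟨k, hk⟩ := hp.dvd_choose_self (k := 2) (by omega) (by have := hp.two_le; omega)
  rw [hk, pow_mul, hx, one_pow]

/-- Dropping `α₁` and shifting indices maps `Φ₃` to `Φ₉`, because the relations of `Φ₉` among `α,
α₂, α₃, α₄` have the same shape. -/
theorem phi3_of_three_ne_one (hp : p.Prime) (h2 : p ≠ 2) :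
    (PresentedGroup.of 3 : Phi3 p) ≠ 1 := by
  obtain ⟨e1, e2, e3, e4, e5, e6, e7, e8, c1, c2, c3, c4, c5, c6, c7⟩ :=
    (phi9_iff p _).1 (PresentedGroup.lift_of_eq_one (Phi9Rels p))
  refine PresentedGroup.of_ne_one (g := ![.of 0, .of 2, .of 3, (.of 4 : Phi9 p)])
    ((phi3_iff p _).2 ?_) (phi9_of_four_ne_one hp h2)
  exact ⟨e2, e3, e4, e6, e7, e8, c1.symm, c5, c6, c7⟩

theorem phi2_of_two_ne_one (hp : p.Prime) (h2 : p ≠ 2) :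
    (PresentedGroup.of 2 : Phi2 p) ≠ 1 := by
  obtain ⟨e1, e2, e3, e4, e5, e6, e7, e8, c1, c2, c3, c4, c5, c6, c7⟩ :=
    (phi9_iff p _).1 (PresentedGroup.lift_of_eq_one (Phi9Rels p))
  refine PresentedGroup.of_ne_one (g := ![.of 0, .of 3, (.of 4 : Phi9 p)])
    ((phi2_iff p _).2 ?_) (phi9_of_four_ne_one hp h2)
  refine ⟨e3, e4, ?_, e8, c1.symm, c7⟩
  have := pow_choose_two_eq_one hp h2 e8
  rwa [this, mul_one] at e7

/-- There are two maps onto copies inside `Φ₂`, each killing one of the pairs `(αᵢ, βᵢ)`. The first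
detects `β₁`; the second kills `β₁` but not `β₂`, so `β₂` is not a power of `β₁`. -/
theorem phi4_nontrivial (hp : p.Prime) (h2 : p ≠ 2) :
    (PresentedGroup.of 3 : Phi4 p) ≠ 1 ∧
      (PresentedGroup.of 4 : Phi4 p) ∉ zpowers (PresentedGroup.of 3) := by
  obtain ⟨e1, e2, e3, e4, c1, c2⟩ :=
    (phi2_iff p _).1 (PresentedGroup.lift_of_eq_one (Phi2Rels p))
  have h1 : pcComm (1 : Phi2 p) (.of 0) = 1 := pcComm_eq_one_iff.2 (Commute.one_left _)
  constructor
  · have h : ∀ r ∈ Phi4Rels p,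
        FreeGroup.lift ![.of 0, .of 1, 1, .of 2, (1 : Phi2 p)] r = 1 := (phi4_iff p _).2
      ⟨e1, h1, e2, e3, one_pow p, e4, one_pow p, c1.symm, .one_right _, .one_right _, c2,
        .one_right _, .one_left _, .one_left _, .one_right _⟩
    exact PresentedGroup.of_ne_one h (i := 3) (phi2_of_two_ne_one hp h2)
  · have h : ∀ r ∈ Phi4Rels p,
        FreeGroup.lift ![.of 0, 1, .of 1, 1, (.of 2 : Phi2 p)] r = 1 := (phi4_iff p _).2
      ⟨h1, e1, e2, one_pow p, e3, one_pow p, e4, .one_right _, c1.symm, .one_left _, .one_left _,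
        .one_left _, .one_right _, c2, .one_left _⟩
    rintro ⟨i, hi⟩
    have hi := congrArg (PresentedGroup.toGroup h) hi
    simp only [map_zpow, PresentedGroup.toGroup.of] at hi
    exact phi2_of_two_ne_one hp h2 (hi.symm.trans (one_zpow i))

/-- A group of class three generated by two elements of order `p` in which one of them commutes
with the commutator. -/
theorem exists_class_three (hp : p.Prime) (h2 : p ≠ 2) :
    ∃ (H : Type) (_ : Group H) (s t c z : H), pcComm s t = c ∧ pcComm c s = z ∧ Commute c t ∧
      s ^ p = 1 ∧ t ^ p = 1 ∧ c ^ p = 1 ∧ z ^ p = 1 ∧ Commute s z ∧ Commute t z ∧ Commute c z ∧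
      z ≠ 1 := by
  have hp3 : 3 ≤ p := by have := hp.two_le; omega
  -- With `M = 0` the ring has `p = 0` and `x ^ 3 = 0` but `x ^ 2 ≠ 0`, so all translations have
  -- order dividing `p`.
  obtain ⟨R, _, x, hx, hN, hx2⟩ := exists_truncated_ring hp 2 0
  rw [Polynomial.eval₂_zero, mul_zero, add_zero] at hN
  have hx : x ^ 3 = 0 := hx
  obtain ⟨u, hu⟩ : IsUnit (1 + x) := IsNilpotent.isUnit_one_add ⟨3, hx⟩
  have hux : (u : R) - 1 = x := by rw [hu]; ring
  have hup : (u : R) ^ p = 1 := by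
    obtain ⟨k, hk⟩ := hp.dvd_choose_self (k := 2) (by omega) (by omega)
    rw [hu, add_pow_eq_sum_range (by omega) hx]
    simp only [Finset.sum_range_succ, Finset.sum_range_zero, Nat.choose_zero_right,
      Nat.choose_one_right, Nat.cast_one, hk, Nat.cast_mul, hN]
    ring
  have hc : ∀ v : R, pcComm (Equiv.addLeft v) (MulAction.toPermHom Rˣ R u⁻¹) =
      Equiv.addLeft (x * v) := fun v => by rw [pcComm_addLeft_toPerm, hux]
  have hpow : ∀ v : R, Equiv.addLeft v ^ p = 1 := fun v => by
    rw [addLeft_pow, hN, zero_mul, addLeft_eq_one_iff]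
  refine ⟨Equiv.Perm R, inferInstance, MulAction.toPermHom Rˣ R u⁻¹, Equiv.addLeft 1,
    Equiv.addLeft (-x), Equiv.addLeft (-x ^ 2), ?_, ?_, addLeft_commute _ _,
    toPermHom_pow_eq_one hup, hpow _, hpow _, hpow _, ?_, addLeft_commute _ _,
    addLeft_commute _ _, ?_⟩
  · have h1 : pcComm (MulAction.toPermHom Rˣ R u⁻¹) (Equiv.addLeft 1) =
        (pcComm (Equiv.addLeft 1) (MulAction.toPermHom Rˣ R u⁻¹))⁻¹ := by
      simp only [pcComm]; group
    rw [h1, hc, inv_eq_iff_mul_eq_one, addLeft_mul, addLeft_eq_one_iff]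
    ring
  · rw [hc]
    congr 1
    ring
  · refine (pcComm_eq_one_iff.1 ?_).symm
    rw [hc, addLeft_eq_one_iff]
    linear_combination -hx
  · rw [Ne, addLeft_eq_one_iff, neg_eq_zero]
    exact hx2

theorem pcComm_inv_swap {G : Type*} [Group G] (x y : G) : pcComm x y = (pcComm y x)⁻¹ := by
  simp only [pcComm]; group

/-- The class-three group is used twice, with the roles of `s` and `t` exchanged: one map kills `β₂`
and not `β₁`, the other kills `β₁` and not `β₂`. The exchange inverts `c` and `z`. -/
theorem phi6_nontrivial (hp : p.Prime) (h2 : p ≠ 2) :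
    (PresentedGroup.of 3 : Phi6 p) ≠ 1 ∧
      (PresentedGroup.of 4 : Phi6 p) ∉ zpowers (PresentedGroup.of 3) := by
  obtain ⟨H, _, s, t, c, z, e1, e2, c1, hs, ht, hc, hz, c2, c3, c4, hz1⟩ :=
    exists_class_three hp h2
  constructor
  · have h : ∀ r ∈ Phi6Rels p, FreeGroup.lift ![s, t, c, z, 1] r = 1 := (phi6_iff p _).2
      ⟨e1, e2, pcComm_eq_one_iff.2 c1, hs, ht, hc, hz, one_pow p, c2, .one_right _, c3,
        .one_right _, c4, .one_right _, .one_right _⟩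
    exact PresentedGroup.of_ne_one h (i := 3) hz1
  · have e2' : pcComm c⁻¹ s = z⁻¹ := by
      rw [pcComm_eq_iff] at e2 ⊢
      rw [inv_mul_eq_iff_eq_mul, ← mul_assoc, ← mul_assoc, e2, mul_assoc s c z, c4.eq]
      group
    have h : ∀ r ∈ Phi6Rels p, FreeGroup.lift ![t, s, c⁻¹, 1, z⁻¹] r = 1 := (phi6_iff p _).2
      ⟨by simp [pcComm_inv_swap t s, e1], pcComm_eq_one_iff.2 c1.inv_left, e2', ht, hs,
        by simp [hc], one_pow p, by simp [hz], .one_right _, c3.inv_right, .one_right _,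
        c2.inv_right, .one_right _, c4.inv_inv, .one_left _⟩
    rintro ⟨i, hi⟩
    have hi := congrArg (PresentedGroup.toGroup h) hi
    simp only [map_zpow, PresentedGroup.toGroup.of] at hi
    exact inv_ne_one.2 hz1 (hi.symm.trans (one_zpow i))

/-- Passing to the centralizer of `z` makes `z` central in the whole group, as a central product
requires. -/
theorem exists_class_three_of_central (hp : p.Prime) (h2 : p ≠ 2) :
    ∃ (H : Type) (_ : Group H) (s t c z : H), pcComm s t = c ∧ pcComm c s = z ∧ Commute c t ∧
      s ^ p = 1 ∧ t ^ p = 1 ∧ c ^ p = 1 ∧ z ^ p = 1 ∧ (∀ x, Commute x z) ∧ z ≠ 1 := by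
  obtain ⟨H, _, s, t, c, z, e1, e2, c1, hs, ht, hc, hz, c2, c3, c4, hz1⟩ :=
    exists_class_three hp h2
  have h {x : H} : x ∈ centralizer {z} ↔ Commute x z :=
    mem_centralizer_singleton_iff.trans Iff.rfl
  exact ⟨centralizer {z}, inferInstance, ⟨s, h.2 c2⟩, ⟨t, h.2 c3⟩, ⟨c, h.2 c4⟩,
    ⟨z, h.2 (.refl z)⟩, Subtype.ext e1, Subtype.ext e2, Subtype.ext c1.eq, Subtype.ext hs,
    Subtype.ext ht, Subtype.ext hc, Subtype.ext hz, fun x => Subtype.ext (h.1 x.2).eq,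
    fun h1 => hz1 (congrArg Subtype.val h1)⟩

theorem pcComm_one {G : Type*} [Group G] (x : G) : pcComm x 1 = 1 := by simp [pcComm]

theorem one_pcComm {G : Type*} [Group G] (x : G) : pcComm 1 x = 1 := by simp [pcComm]

/-- The central product of two groups in which two central elements of order `p` are
identified. -/
theorem exists_central_product (hp : p.Prime) {H₁ H₂ : Type} [Group H₁] [Group H₂] {z₁ : H₁}
    {z₂ : H₂} (hz₁ : ∀ x, Commute x z₁) (hz₂ : ∀ x, Commute x z₂) (hp₁ : z₁ ^ p = 1)
    (hp₂ : z₂ ^ p = 1) (h₁ : z₁ ≠ 1) (h₂ : z₂ ≠ 1) :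
    ∃ (Q : Type) (_ : Group Q) (f : H₁ × H₂ →* Q), f (1, z₂) = f (z₁, 1) ∧ f (z₁, 1) ≠ 1 := by
  have : (zpowers ((z₁⁻¹, z₂) : H₁ × H₂)).Normal := by
    refine ⟨?_⟩
    rintro _ ⟨i, rfl⟩ x
    have h : Commute x (z₁⁻¹, z₂) := Prod.ext (hz₁ x.1).inv_right.eq (hz₂ x.2).eq
    change x * (z₁⁻¹, z₂) ^ i * x⁻¹ ∈ _
    rw [(h.zpow_right i).eq, mul_inv_cancel_right]
    exact zpow_mem (mem_zpowers _) i
  refine ⟨(H₁ × H₂) ⧸ zpowers ((z₁⁻¹, z₂) : H₁ × H₂), inferInstance, QuotientGroup.mk' _,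
    (QuotientGroup.eq.2 ?_).symm, ?_⟩
  · convert mem_zpowers ((z₁⁻¹, z₂) : H₁ × H₂) using 1
    simp
  -- If `(z₁, 1)` were the `i`-th power of `(z₁⁻¹, z₂)`, then `p ∣ i` by the second component, and
  -- the first component would give `z₁ = 1`.
  · intro h
    obtain ⟨i, hi⟩ := (QuotientGroup.eq_one_iff _).1 h
    have hi1 : z₁⁻¹ ^ i = z₁ := congrArg Prod.fst hi
    have hi2 : z₂ ^ i = 1 := congrArg Prod.snd hi
    have := Fact.mk hp
    rw [← orderOf_dvd_iff_zpow_eq_one, orderOf_eq_prime hp₂ h₂] at hi2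
    obtain ⟨j, rfl⟩ := hi2
    rw [zpow_mul, zpow_natCast, inv_pow, hp₁, inv_one, one_zpow] at hi1
    exact h₁ hi1.symm

theorem Prod.pcComm_mk {G H : Type*} [Group G] [Group H] (a c : G) (b d : H) :
    pcComm (a, b) (c, d) = (pcComm a c, pcComm b d) := rfl

theorem phi2_commute_two (p : ℕ) (x : Phi2 p) : Commute x (.of 2) := by
  obtain ⟨e1, e2, e3, e4, c1, c2⟩ :=
    (phi2_iff p _).1 (PresentedGroup.lift_of_eq_one (Phi2Rels p))
  refine (mem_center_iff.1 (mem_center_of_closure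
    (closure_fin_three (PresentedGroup.closure_range_of (Phi2Rels p))) ?_) x)
  simp only [Set.mem_insert_iff, Set.mem_singleton_iff, forall_eq_or_imp, forall_eq]
  exact ⟨c1, c2.symm, .refl _⟩

theorem phi3_commute_three (p : ℕ) (x : Phi3 p) : Commute x (.of 3) := by
  obtain ⟨e1, e2, e3, e4, e5, e6, c1, c2, c3, c4⟩ :=
    (phi3_iff p _).1 (PresentedGroup.lift_of_eq_one (Phi3Rels p))
  refine (mem_center_iff.1 (mem_center_of_closure
    (closure_fin_four (PresentedGroup.closure_range_of (Phi3Rels p))) ?_) x)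
  simp only [Set.mem_insert_iff, Set.mem_singleton_iff, forall_eq_or_imp, forall_eq]
  exact ⟨c1, c3.symm, c4.symm, .refl _⟩

theorem phi9_commute_four (p : ℕ) (x : Phi9 p) : Commute x (.of 4) := by
  obtain ⟨e1, e2, e3, e4, e5, e6, e7, e8, c1, c2, c3, c4, c5, c6, c7⟩ :=
    (phi9_iff p _).1 (PresentedGroup.lift_of_eq_one (Phi9Rels p))
  refine (mem_center_iff.1 (mem_center_of_closure
    (closure_fin_five (PresentedGroup.closure_range_of (Phi9Rels p))) ?_) x)
  simp only [Set.mem_insert_iff, Set.mem_singleton_iff, forall_eq_or_imp, forall_eq]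
  exact ⟨c1.symm, c4.symm, c6.symm, c7.symm, .refl _⟩

/-- The model is the central product of two copies of `Φ₂`. -/
theorem phi5_of_four_ne_one (hp : p.Prime) (h2 : p ≠ 2) :
    (PresentedGroup.of 4 : Phi5 p) ≠ 1 := by
  obtain ⟨e1, e2, e3, e4, c1, c2⟩ :=
    (phi2_iff p _).1 (PresentedGroup.lift_of_eq_one (Phi2Rels p))
  obtain ⟨Q, _, f, hz, hz1⟩ := exists_central_product hp (phi2_commute_two p)
    (phi2_commute_two p) e4 e4 (phi2_of_two_ne_one hp h2) (phi2_of_two_ne_one hp h2)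
  have h : ∀ r ∈ Phi5Rels p, FreeGroup.lift
      ![f (.of 1, 1), f (.of 0, 1), f (1, .of 1), f (1, .of 0), f (.of 2, 1)] r = 1 := by
    refine (phi5_iff p _).2 ?_
    simp only [Matrix.cons_val, ← map_pcComm, ← map_pow, Prod.pcComm_mk, Prod.pow_mk, e1, e2, e3,
      e4, one_pow, pcComm_one, hz, ← Prod.one_eq_mk, map_one, true_and]
    exact ⟨.map (.prod (.one_right _) (.one_left _)) f, .map (.prod (.one_right _) (.one_left _)) f,
      .map (.prod (.one_right _) (.one_left _)) f, .map (.prod (.one_right _) (.one_left _)) f,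
      .map (.prod c2 (.one_left _)) f, .map (.prod c1.symm (.one_left _)) f,
      .map (.prod (.one_left _) (.one_right _)) f, .map (.prod (.one_left _) (.one_right _)) f⟩
  exact PresentedGroup.of_ne_one h (i := 4) hz1

/-- The model is the central product of `Φ₃` and `Φ₂` with `α₁` placed diagonally. The
`Φ₂`-component of `α₁` produces `[α₁, β]`, which the identification of centres turns into `α₃`. -/
theorem phi7_of_three_ne_one (hp : p.Prime) (h2 : p ≠ 2) :
    (PresentedGroup.of 3 : Phi7 p) ≠ 1 := by
  obtain ⟨e1, e2, e3, e4, c1, c2⟩ :=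
    (phi2_iff p _).1 (PresentedGroup.lift_of_eq_one (Phi2Rels p))
  obtain ⟨d1, d2, d3, d4, d5, d6, k1, k2, k3, k4⟩ :=
    (phi3_iff p _).1 (PresentedGroup.lift_of_eq_one (Phi3Rels p))
  rw [pow_choose_two_eq_one hp h2 d6, mul_one] at d5
  obtain ⟨Q, _, f, hz, hz1⟩ := exists_central_product hp (phi3_commute_three p)
    (phi2_commute_two p) d6 e4 (phi3_of_three_ne_one hp h2) (phi2_of_two_ne_one hp h2)
  have h : ∀ r ∈ Phi7Rels p, FreeGroup.lift
      ![f (.of 0, 1), f (.of 1, .of 1), f (.of 2, 1), f (.of 3, 1), f (1, .of 0)] r = 1 := by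
    refine (phi7_iff p _).2 ?_
    simp only [Matrix.cons_val, ← map_pcComm, ← map_pow, ← map_mul, Prod.pcComm_mk, Prod.pow_mk,
      Prod.mk_mul_mk, d1, d2, d3, d4, d5, d6, e1, e2, e3, one_pow, mul_one, pcComm_one, hz,
      ← Prod.one_eq_mk, map_one, true_and]
    exact ⟨.map (.prod k1.symm (.one_left _)) f, .map (.prod (.one_right _) (.one_left _)) f,
      .map (.prod k2 (.one_right _)) f, .map (.prod k3 (.one_right _)) f,
      .map (.prod k4 (.one_right _)) f, .map (.prod (.one_right _) (.one_left _)) f,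
      .map (.prod (.one_right _) (.one_left _)) f⟩
  exact PresentedGroup.of_ne_one h (i := 3) hz1

/-- The relation `[α₁, α₂] = α₄`, absent from `Φ₉`, is supplied by the second factor of a central
product with the class-three group. There `[s, c] = z⁻¹`, so `z⁻¹` is identified with `α₄`. -/
theorem phi10_of_four_ne_one (hp : p.Prime) (h2 : p ≠ 2) :
    (PresentedGroup.of 4 : Phi10 p) ≠ 1 := by
  obtain ⟨e1, e2, e3, e4, e5, e6, e7, e8, c1, c2, c3, c4, c5, c6, c7⟩ :=
    (phi9_iff p _).1 (PresentedGroup.lift_of_eq_one (Phi9Rels p))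
  obtain ⟨H, _, s, t, c, z, d1, d2, k1, hs, ht, hc, hz, hzH, hz1⟩ :=
    exists_class_three_of_central hp h2
  have d3 : pcComm s c = z⁻¹ := by rw [pcComm_inv_swap, d2]
  have hc2 := pow_choose_two_eq_one hp h2 hc
  obtain ⟨Q, _, f, hz, hz1⟩ := exists_central_product hp (phi9_commute_four p)
    (fun x => (hzH x).inv_right) e8 (by rw [inv_pow, hz, inv_one]) (phi9_of_four_ne_one hp h2)
    (inv_ne_one.2 hz1)
  have h : ∀ r ∈ Phi10Rels p, FreeGroup.lift
      ![f (.of 0, t), f (.of 1, s), f (.of 2, c), f (.of 3, 1), f (.of 4, 1)] r = 1 := by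
    refine (phi10_iff p _).2 ?_
    simp only [Matrix.cons_val, ← map_pcComm, ← map_pow, ← map_mul, Prod.pcComm_mk, Prod.pow_mk,
      Prod.mk_mul_mk, d1, d3, e1, e2, e3, e4, e5, e6, e7, e8, hs, ht, hc, hc2, one_pow, mul_one,
      one_pcComm, pcComm_eq_one_iff.2 k1, pcComm_eq_one_iff.2 c2, hz,
      ← Prod.one_eq_mk, map_one, true_and]
    exact ⟨.map (.prod c1 (.one_right _)) f, .map (.prod c3 (.one_right _)) f,
      .map (.prod c4 (.one_right _)) f, .map (.prod c5 (.one_right _)) f,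
      .map (.prod c6 (.one_right _)) f, .map (.prod c7 (.one_right _)) f⟩
  exact PresentedGroup.of_ne_one h (i := 4) hz1

/-- The model consists of affine maps of `ℤ / p ^ 3`: `α₁` is translation by `1`, `β` translation by
`p`, and `α₂` multiplication by `(1 + p)⁻¹`. For odd `p` the unit `1 + p` has order `p ^ 2`. -/
theorem phi8_not_commute (hp : p.Prime) (h2 : p ≠ 2) :
    ¬ Commute (.of 1 : Phi8 p) (.of 2) ∧ ¬ Commute ((.of 1 : Phi8 p) ^ p) (.of 0) := by
  have ho : orderOf (1 + p : ZMod (p ^ (2 + 1))) = p ^ 2 := ZMod.orderOf_one_add_prime hp h2 2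
  have hpn : ((p ^ 3 : ℕ) : ZMod (p ^ (2 + 1))) = 0 := ZMod.natCast_self _
  obtain ⟨u, hu⟩ : IsUnit (1 + p : ZMod (p ^ (2 + 1))) :=
    IsUnit.of_pow_eq_one (orderOf_dvd_iff_pow_eq_one.1 ho.dvd) (pow_ne_zero 2 hp.ne_zero)
  have hpp : (p : ZMod (p ^ (2 + 1))) * p ≠ 0 := by
    rw [← Nat.cast_mul, Ne, ZMod.natCast_eq_zero_iff, ← sq, Nat.pow_dvd_pow_iff_le_right hp.one_lt]
    omega
  have hup : (1 + p : ZMod (p ^ (2 + 1))) ^ p - 1 ≠ 0 := by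
    rw [sub_ne_zero, Ne, ← orderOf_dvd_iff_pow_eq_one, ho]
    intro h
    have := Nat.le_of_dvd hp.pos h
    nlinarith [hp.one_lt]
  have h : ∀ r ∈ Phi8Rels p, FreeGroup.lift ![Equiv.addLeft (1 : ZMod (p ^ (2 + 1))),
      MulAction.toPermHom _ (ZMod (p ^ (2 + 1))) u⁻¹, Equiv.addLeft (p : ZMod (p ^ (2 + 1)))] r =
      1 := by
    refine (phi8_iff p _).2 ⟨?_, ?_, ?_, ?_⟩
    · refine (pcComm_addLeft_toPerm u 1).trans ?_
      rw [hu, add_sub_cancel_left, mul_one]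
      rfl
    · exact ((addLeft_pow 1 p).trans (by rw [mul_one]; rfl)).symm
    · refine (addLeft_pow _ _).trans (addLeft_eq_one_iff.2 ?_)
      rw [← hpn]
      push_cast
      ring
    · exact toPermHom_pow_eq_one (by rw [hu, orderOf_dvd_iff_pow_eq_one.1 ho.dvd])
  constructor
  · intro hc
    have hc := (hc.map (PresentedGroup.toGroup h)).symm
    simp only [PresentedGroup.toGroup.of, Matrix.cons_val] at hc
    rw [← pcComm_eq_one_iff, pcComm_addLeft_toPerm, hu, addLeft_eq_one_iff, add_sub_cancel_left]
      at hc
    exact hpp hc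
  · intro hc
    have hc := (hc.map (PresentedGroup.toGroup h)).symm
    simp only [map_pow, PresentedGroup.toGroup.of, Matrix.cons_val] at hc
    rw [← map_pow, inv_pow, ← pcComm_eq_one_iff, pcComm_addLeft_toPerm, Units.val_pow_eq_pow_val,
      hu, addLeft_eq_one_iff, mul_one] at hc
    exact hup hc

instance Commute.decidable {G : Type*} [Mul G] [DecidableEq G] (x y : G) :
    Decidable (Commute x y) :=
  inferInstanceAs (Decidable (x * y = y * x))

/-- Two maps to the dihedral group of order `8`, each killing one of `α₁`, `α₂`. -/
theorem gamma4_nontrivial :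
    (.of 0 : Gamma4) ^ 2 ≠ 1 ∧ (.of 1 : Gamma4) ^ 2 ∉ zpowers ((.of 0 : Gamma4) ^ 2) := by
  constructor
  · have h : ∀ r ∈ Gamma4Rels,
        FreeGroup.lift ![DihedralGroup.r (1 : ZMod 4), 1, DihedralGroup.sr 0] r = 1 :=
      (gamma4_iff _).2 (by decide)
    intro hi
    have hi := congrArg (PresentedGroup.toGroup h) hi
    simp only [map_pow, map_one, PresentedGroup.toGroup.of] at hi
    revert hi
    decide
  · have h : ∀ r ∈ Gamma4Rels,
        FreeGroup.lift ![1, DihedralGroup.r (1 : ZMod 4), DihedralGroup.sr 0] r = 1 :=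
      (gamma4_iff _).2 (by decide)
    rintro ⟨i, hi⟩
    have hi := congrArg (PresentedGroup.toGroup h) hi
    simp only [map_zpow, map_pow, PresentedGroup.toGroup.of, Matrix.cons_val, one_pow,
      one_zpow] at hi
    revert hi
    decide

/-- The Pauli operators `X ⊗ 1`, `Z ⊗ 1`, `X ⊗ Z` and `Z ⊗ X`, acting on signed basis vectors of two
qubits. The first coordinate records the sign, and `E` is multiplication by `-1`. -/
theorem gamma5_of_four_ne_one : (.of 4 : Gamma5) ≠ 1 := by
  let X : Equiv.Perm (ZMod 2 × ZMod 2 × ZMod 2) :=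
    ⟨fun x => (x.1, x.2.1 + 1, x.2.2), fun x => (x.1, x.2.1 + 1, x.2.2), by decide, by decide⟩
  let Z : Equiv.Perm (ZMod 2 × ZMod 2 × ZMod 2) :=
    ⟨fun x => (x.1 + x.2.1, x.2.1, x.2.2),
      fun x => (x.1 + x.2.1, x.2.1, x.2.2), by decide, by decide⟩
  let U : Equiv.Perm (ZMod 2 × ZMod 2 × ZMod 2) :=
    ⟨fun x => (x.1 + x.2.2, x.2.1 + 1, x.2.2),
      fun x => (x.1 + x.2.2, x.2.1 + 1, x.2.2), by decide, by decide⟩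
  let V : Equiv.Perm (ZMod 2 × ZMod 2 × ZMod 2) :=
    ⟨fun x => (x.1 + x.2.1, x.2.1, x.2.2 + 1),
      fun x => (x.1 + x.2.1, x.2.1, x.2.2 + 1), by decide, by decide⟩
  let E : Equiv.Perm (ZMod 2 × ZMod 2 × ZMod 2) :=
    ⟨fun x => (x.1 + 1, x.2.1, x.2.2), fun x => (x.1 + 1, x.2.1, x.2.2), by decide, by decide⟩
  refine PresentedGroup.of_ne_one (g := ![X, Z, U, V, E]) ((gamma5_iff _).2 ?_) (i := 4) (by decide)
  refine ⟨?_, ?_, ?_, ?_, ?_, ?_, ?_, ?_, ?_, ?_, ?_, ?_, ?_, ?_, ?_⟩ <;> decide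

theorem gamma6_of_zero_pow_ne_one : (.of 0 : Gamma6) ^ 4 ≠ 1 := by
  -- Affine maps of `ℤ / 8`: translation by `1`, negation, and multiplication by `5`.
  have h : ∀ r ∈ Gamma6Rels, FreeGroup.lift ![Equiv.addLeft (1 : ZMod 8), Equiv.neg _,
      ⟨fun x => 5 * x, fun x => 5 * x, by decide, by decide⟩] r = 1 := (gamma6_iff _).2 (by decide)
  intro hi
  have hi := congrArg (PresentedGroup.toGroup h) hi
  simp only [map_pow, map_one, PresentedGroup.toGroup.of] at hi
  revert hi
  decide

theorem gamma7_of_one_ne_one : (.of 1 : Gamma7) ≠ 1 := by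
  -- A single unipotent Jordan block over the field with two elements; the `βᵢ` are translations by
  -- the standard basis vectors.
  let a : Equiv.Perm (ZMod 2 × ZMod 2 × ZMod 2) :=
    ⟨fun x => (x.1 + x.2.1, x.2.1 + x.2.2, x.2.2),
      fun x => (x.1 + x.2.1 + x.2.2, x.2.1 + x.2.2, x.2.2), by decide, by decide⟩
  refine PresentedGroup.of_ne_one (g := ![a, Equiv.addLeft (1, 0, 0), Equiv.addLeft (0, 1, 0),
    Equiv.addLeft (0, 0, 1)]) ((gamma7_iff _).2 ?_) (i := 1) (by decide)
  refine ⟨?_, ?_, ?_, ?_, ?_, ?_, ?_, ?_, ?_, ?_⟩ <;> decide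

end Nontriviality

/-! ### The individual families -/

section Families

open Subgroup

variable {p : ℕ}

/-- One step up a polycyclic series: the two membership hypotheses are supplied by the power
relation of `g` and its commutator relations with the generators already adjoined. -/
theorem card_closure_insert_dvd_pow_succ {G : Type*} [Group G] {S : Set G} {g : G} {k : ℕ}
    (hp : p.Prime) (hS : Nat.card (closure S) ∣ p ^ k) (hm : g ^ p ∈ closure S)
    (hg : ∀ s ∈ S, pcComm s g ∈ closure S) : Nat.card (closure (insert g S)) ∣ p ^ (k + 1) :=
  card_closure_insert_dvd_pow hp.ne_zero hS hm
    (fun s hs => conj_mem_of_pcComm_mem (mem_closure_of_mem hs) (hg s hs)) (pow_succ' p k).symm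

theorem card_closure_singleton_dvd {G : Type*} [Group G] {g : G} {m : ℕ} (hg : g ^ m = 1) :
    Nat.card (closure {g}) ∣ m := by
  rw [← zpowers_eq_closure, Nat.card_zpowers]
  exact orderOf_dvd_of_pow_eq_one hg

theorem card_closure_singleton_dvd_pow_one {G : Type*} [Group G] {g : G} (hg : g ^ p = 1) :
    Nat.card (closure {g}) ∣ p ^ 1 :=
  (card_closure_singleton_dvd hg).trans (pow_one p).symm.dvd

theorem card_dvd_of_closure_eq_top {G : Type*} [Group G] {S : Set G} {n : ℕ}
    (hS : closure S = ⊤) (h : Nat.card (closure S) ∣ n) : Nat.card G ∣ n := by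
  rwa [hS, card_top] at h

theorem mem_of_mul_eq_one {G : Type*} [Group G] {H : Subgroup G} {x y : G} (h : x * y = 1)
    (hy : y ∈ H) : x ∈ H := by
  rw [eq_inv_of_mul_eq_one_left h]
  exact inv_mem hy

theorem phi2_family (hp : p.Prime) (h2 : p ≠ 2) :
    HasFamilyRank p (Phi2 p) 3 ∧ FamilyHasInvariants.{u} (Phi2 p) (rowA2 p) (rowB2 p) := by
  have : Fact p.Prime := ⟨hp⟩
  have hgen := closure_fin_three (PresentedGroup.closure_range_of (Phi2Rels p))
  have hne := phi2_of_two_ne_one hp h2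
  have hZ := mem_center_iff.2 fun x => (phi2_commute_two p x).eq
  obtain ⟨e1, e2, e3, e4, c1, c2⟩ :=
    (phi2_iff p _).1 (PresentedGroup.lift_of_eq_one (Phi2Rels p))
  -- From here on only the relations, the generation statement and the nontrivial word matter, so
  -- the generators are made opaque.
  generalize (.of 0 : Phi2 p) = a, (.of 1 : Phi2 p) = a₁, (.of 2 : Phi2 p) = a₂ at *
  simp only [← pcComm_eq_one_iff] at c1 c2
  refine family2_of_card_dvd (card_dvd_of_closure_eq_top hgen ?_) (e1 ▸ hZ) (e1 ▸ hne)
  have k1 := card_closure_singleton_dvd_pow_one e4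
  have k2 := card_closure_insert_dvd_pow_succ hp k1 (g := a₁)
    (by simp [e3, one_mem]) (by simp [pcComm_inv_swap a₂, c2, one_mem])
  exact card_closure_insert_dvd_pow_succ hp k2 (by simp [e2, one_mem])
    (by simp [e1, c1, one_mem, mem_closure_of_mem])

theorem phi3_family (hp : p.Prime) (h2 : p ≠ 2) :
    HasFamilyRank p (Phi3 p) 4 ∧ FamilyHasInvariants.{u} (Phi3 p) (rowA3 p) (rowB3 p) := by
  have : Fact p.Prime := ⟨hp⟩
  have hgen := closure_fin_four (PresentedGroup.closure_range_of (Phi3Rels p))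
  have hne := phi3_of_three_ne_one hp h2
  have hZ := mem_center_iff.2 fun x => (phi3_commute_three p x).eq
  obtain ⟨e1, e2, e3, e4, e5, e6, c1, c2, c3, c4⟩ :=
    (phi3_iff p _).1 (PresentedGroup.lift_of_eq_one (Phi3Rels p))
  generalize (.of 0 : Phi3 p) = a, (.of 1 : Phi3 p) = a₁, (.of 2 : Phi3 p) = a₂,
    (.of 3 : Phi3 p) = a₃ at *
  simp only [← pcComm_eq_one_iff] at c1 c2 c3 c4
  rw [mul_assoc] at e4
  have e21 : pcComm (pcComm a₁ a) a = a₃ := by rw [e1, e2]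
  refine family3_of_card_dvd (card_dvd_of_closure_eq_top hgen ?_) (e21 ▸ hZ) (e21 ▸ hne)
  have k1 := card_closure_singleton_dvd_pow_one e6
  have k2 := card_closure_insert_dvd_pow_succ hp k1 (g := a₂)
    (by simp [eq_inv_of_mul_eq_one_left e5, pow_mem, mem_closure_of_mem])
    (by simp [pcComm_inv_swap a₃, c4, one_mem])
  have k3 := card_closure_insert_dvd_pow_succ hp k2 (g := a₁)
    (mem_of_mul_eq_one e4 (mul_mem (pow_mem (mem_closure_of_mem (by simp)) _)
      (pow_mem (mem_closure_of_mem (by simp)) _)))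
    (by simp [pcComm_inv_swap _ a₁, c2, c3, one_mem])
  exact card_closure_insert_dvd_pow_succ hp k3 (by simp [e3, one_mem])
    (by simp [e1, e2, c1, one_mem, mem_closure_of_mem])

theorem phi4_family (hp : p.Prime) (h2 : p ≠ 2) :
    HasFamilyRank p (Phi4 p) 5 ∧ FamilyHasInvariants.{u} (Phi4 p) (rowA3 p) (rowB3 p) := by
  have : Fact p.Prime := ⟨hp⟩
  have hgen := closure_fin_five (PresentedGroup.closure_range_of (Phi4Rels p))
  obtain ⟨hne, hne'⟩ := phi4_nontrivial hp h2
  obtain ⟨e1, e2, e3, e4, e5, e6, e7, c1, c2, c3, c4, c5, c6, c7, c8⟩ :=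
    (phi4_iff p _).1 (PresentedGroup.lift_of_eq_one (Phi4Rels p))
  generalize (.of 0 : Phi4 p) = a, (.of 1 : Phi4 p) = a₁, (.of 2 : Phi4 p) = a₂,
    (.of 3 : Phi4 p) = b₁, (.of 4 : Phi4 p) = b₂ at *
  have hb₁ : b₁ ∈ center (Phi4 p) := mem_center_of_closure hgen
    (by simp [c1.symm, c4.symm, c6.symm, c8])
  have hb₂ : b₂ ∈ center (Phi4 p) := mem_center_of_closure hgen
    (by simp [c2.symm, c5.symm, c7.symm, c8.symm])
  have hab := commute_of_mem_closure (S := {a₁, a₂, b₁, b₂})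
    (by simp [c3, c4, c5, c6, c7, c8, c3.symm, c4.symm, c5.symm, c6.symm, c7.symm, c8.symm])
  simp only [← pcComm_eq_one_iff] at c1 c2 c3 c4 c5 c6 c7 c8
  have k1 := card_closure_singleton_dvd_pow_one e7
  have k2 := card_closure_insert_dvd_pow_succ hp k1 (g := b₁)
    (by simp [e6, one_mem]) (by simp [pcComm_inv_swap b₂, c8, one_mem])
  have k3 := card_closure_insert_dvd_pow_succ hp k2 (g := a₂)
    (by simp [e5, one_mem]) (by simp [pcComm_inv_swap _ a₂, c6, c7, one_mem])
  have k4 := card_closure_insert_dvd_pow_succ hp k3 (g := a₁)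
    (by simp [e4, one_mem]) (by simp [pcComm_inv_swap _ a₁, c3, c4, c5, one_mem])
  -- The last step keeps the factor `|A|` instead of bounding it by `p ^ 4`: the criterion also
  -- needs `|K| ∣ p |A|`, which bounds the abelian subgroup from below.
  have k5 := card_closure_insert_dvd (g := a) (m := p)
    (fun h => pow_ne_zero 4 hp.ne_zero (zero_dvd_iff.1 (h ▸ k4))) (by simp [e3, one_mem])
    fun s hs => conj_mem_of_pcComm_mem (mem_closure_of_mem hs) (by
      revert s
      simp [e1, e2, pcComm_inv_swap b₁, pcComm_inv_swap b₂, c1, c2, one_mem, mem_closure_of_mem])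
  have k5 := card_dvd_of_closure_eq_top hgen k5
  exact family4_of_card_dvd
    (k5.trans ((Nat.mul_dvd_mul_left p k4).trans (pow_succ' p 4).symm.dvd)) hb₁ hb₂
    (e1 ▸ pcComm_mem_commutator _ _) (e2 ▸ pcComm_mem_commutator _ _) hne hne' k4 k5 hab

theorem phi5_family (hp : p.Prime) (h2 : p ≠ 2) :
    HasFamilyRank p (Phi5 p) 5 ∧ FamilyHasInvariants.{u} (Phi5 p) (rowA5 p) (rowB5 p) := by
  have : Fact p.Prime := ⟨hp⟩
  have hgen := closure_fin_five (PresentedGroup.closure_range_of (Phi5Rels p))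
  have hne := phi5_of_four_ne_one hp h2
  obtain ⟨e1, e2, e3, e4, e5, e6, e7, c1, c2, c3, c4, c5, c6, c7, c8⟩ :=
    (phi5_iff p _).1 (PresentedGroup.lift_of_eq_one (Phi5Rels p))
  generalize (.of 0 : Phi5 p) = a₁, (.of 1 : Phi5 p) = a₂, (.of 2 : Phi5 p) = a₃,
    (.of 3 : Phi5 p) = a₄, (.of 4 : Phi5 p) = b at *
  have hb : b ∈ center (Phi5 p) := mem_center_of_closure hgen
    (by simp [c5.symm, c6.symm, c7.symm, c8.symm])
  have n1 : ¬ Commute a₁ a₂ := fun h => hne (e1.symm.trans (pcComm_eq_one_iff.2 h))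
  have n2 : ¬ Commute a₃ a₄ := fun h => hne (e2.symm.trans (pcComm_eq_one_iff.2 h))
  have hcard : Nat.card (Phi5 p) ∣ p ^ 5 := by
    simp only [← pcComm_eq_one_iff] at c1 c2 c3 c4 c5 c6 c7 c8
    have k1 := card_closure_singleton_dvd_pow_one e7
    have k2 := card_closure_insert_dvd_pow_succ hp k1 (g := a₄)
      (by simp [e6, one_mem]) (by simp [pcComm_inv_swap b, c8, one_mem])
    have k3 := card_closure_insert_dvd_pow_succ hp k2 (g := a₃)
      (by simp [e5, one_mem])
      (by simp [pcComm_inv_swap _ a₃, e2, c7, one_mem, mem_closure_of_mem])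
    have k4 := card_closure_insert_dvd_pow_succ hp k3 (g := a₂)
      (by simp [e4, one_mem]) (by simp [pcComm_inv_swap _ a₂, c3, c4, c6, one_mem])
    have k5 := card_closure_insert_dvd_pow_succ hp k4 (g := a₁)
      (by simp [e3, one_mem])
      (by simp [pcComm_inv_swap _ a₁, e1, c1, c2, c5, one_mem, mem_closure_of_mem])
    exact card_dvd_of_closure_eq_top hgen k5
  refine family5_of_card (card_of_centralizer_chain hcard (u₁ := a₁) (u₂ := a₂) (u₃ := a₃)
    (u₄ := a₄) (w₁ := a₂) (w₂ := a₁) (w₃ := a₄) (w₄ := a₃) (fun h => n1 h.symm) (.refl _) n1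
    ⟨c2.symm, c4.symm⟩ (fun h => n2 h.symm) ⟨c1.symm, c3.symm, .refl _⟩ n2)
    (commutator_le_of_closure hgen ?_) (x := a₁) (y := a₂) (e1 ▸ hne)
  simp only [← pcComm_eq_one_iff] at c1 c2 c3 c4 c5 c6 c7 c8
  have hself : ∀ x : Phi5 p, pcComm x x = 1 := fun x => pcComm_eq_one_iff.2 (.refl x)
  simp [pcComm_inv_swap b a₁, pcComm_inv_swap b a₂, pcComm_inv_swap b a₃,
    pcComm_inv_swap b a₄, pcComm_inv_swap a₂ a₁, pcComm_inv_swap a₃ a₁, pcComm_inv_swap a₄ a₁,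
    pcComm_inv_swap a₃ a₂, pcComm_inv_swap a₄ a₂, pcComm_inv_swap a₄ a₃, hself, e1, e2, hb, c1, c2,
    c3, c4, c5, c6, c7, c8, one_mem]

theorem phi6_family (hp : p.Prime) (h2 : p ≠ 2) :
    HasFamilyRank p (Phi6 p) 5 ∧ FamilyHasInvariants.{u} (Phi6 p) (rowA6 p) (rowB6 p) := by
  have : Fact p.Prime := ⟨hp⟩
  have hgen := closure_fin_five (PresentedGroup.closure_range_of (Phi6Rels p))
  obtain ⟨hne, hne'⟩ := phi6_nontrivial hp h2
  obtain ⟨e1, e2, e3, e4, e5, e6, e7, e8, c1, c2, c3, c4, c5, c6, c7⟩ :=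
    (phi6_iff p _).1 (PresentedGroup.lift_of_eq_one (Phi6Rels p))
  generalize (.of 0 : Phi6 p) = a₁, (.of 1 : Phi6 p) = a₂, (.of 2 : Phi6 p) = b,
    (.of 3 : Phi6 p) = b₁, (.of 4 : Phi6 p) = b₂ at *
  have hb₁ : b₁ ∈ center (Phi6 p) := mem_center_of_closure hgen
    (by simp [c1.symm, c3.symm, c5.symm, c7])
  have hb₂ : b₂ ∈ center (Phi6 p) := mem_center_of_closure hgen
    (by simp [c2.symm, c4.symm, c6.symm, c7.symm])
  simp only [← pcComm_eq_one_iff] at c1 c2 c3 c4 c5 c6 c7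
  refine family6_of_card_dvd (card_dvd_of_closure_eq_top hgen ?_) hb₁ hb₂
    (e2 ▸ pcComm_mem_commutator _ _) (e3 ▸ pcComm_mem_commutator _ _) hne hne'
    (e1 ▸ pcComm_mem_commutator _ _) (notMem_center_of_pcComm_ne_one (y := a₁) (e2 ▸ hne))
  have k1 := card_closure_singleton_dvd_pow_one e8
  have k2 := card_closure_insert_dvd_pow_succ hp k1 (g := b₁)
    (by simp [e7, one_mem]) (by simp [pcComm_inv_swap b₂, c7, one_mem])
  have k3 := card_closure_insert_dvd_pow_succ hp k2 (g := b)
    (by simp [e6, one_mem]) (by simp [pcComm_inv_swap _ b, c5, c6, one_mem])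
  have k4 := card_closure_insert_dvd_pow_succ hp k3 (g := a₂)
    (by simp [e5, one_mem])
    (by simp [e3, pcComm_inv_swap b₁, pcComm_inv_swap b₂, c3, c4, one_mem, mem_closure_of_mem])
  exact card_closure_insert_dvd_pow_succ hp k4 (by simp [e4, one_mem])
    (by simp [e2, pcComm_inv_swap a₂, pcComm_inv_swap b₁, pcComm_inv_swap b₂, e1, c1, c2, one_mem,
      mem_closure_of_mem])

theorem phi7_family (hp : p.Prime) (h2 : p ≠ 2) :
    HasFamilyRank p (Phi7 p) 5 ∧ FamilyHasInvariants.{u} (Phi7 p) (rowA7 p) (rowB7 p) := by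
  have : Fact p.Prime := ⟨hp⟩
  have hgen := closure_fin_five (PresentedGroup.closure_range_of (Phi7Rels p))
  have hne := phi7_of_three_ne_one hp h2
  obtain ⟨e1, e2, e3, e4, e5, e6, e7, e8, c1, c2, c3, c4, c5, c6, c7⟩ :=
    (phi7_iff p _).1 (PresentedGroup.lift_of_eq_one (Phi7Rels p))
  generalize (.of 0 : Phi7 p) = a, (.of 1 : Phi7 p) = a₁, (.of 2 : Phi7 p) = a₂,
    (.of 3 : Phi7 p) = a₃, (.of 4 : Phi7 p) = b at *
  have hZ : a₃ ∈ center (Phi7 p) := mem_center_of_closure hgen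
    (by simp [c1.symm, c4.symm, c5.symm, c7])
  have n1 : ¬ Commute a₁ b := fun h => hne (e3.symm.trans (pcComm_eq_one_iff.2 h))
  have n2 : ¬ Commute a₂ a := fun h => hne (e2.symm.trans (pcComm_eq_one_iff.2 h))
  have hcard : Nat.card (Phi7 p) ∣ p ^ 5 := by
    simp only [← pcComm_eq_one_iff] at c1 c2 c3 c4 c5 c6 c7
    rw [mul_assoc] at e5
    have k1 := card_closure_singleton_dvd_pow_one e8
    have k2 := card_closure_insert_dvd_pow_succ hp k1 (g := a₃)
      (by simp [e7, one_mem]) (by simp [pcComm_inv_swap b, c7, one_mem])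
    have k3 := card_closure_insert_dvd_pow_succ hp k2 (g := a₂)
      (by simp [e6, one_mem]) (by simp [pcComm_inv_swap _ a₂, c5, c6, one_mem])
    have k4 := card_closure_insert_dvd_pow_succ hp k3 (g := a₁)
      (mem_of_mul_eq_one e5 (mul_mem (pow_mem (mem_closure_of_mem (by simp)) _)
      (pow_mem (mem_closure_of_mem (by simp)) _)))
      (by simp [pcComm_inv_swap _ a₁, e3, c3, c4, one_mem, mem_closure_of_mem])
    have k5 := card_closure_insert_dvd_pow_succ hp k4 (g := a)
      (by simp [e4, one_mem])
      (by simp [e1, e2, pcComm_inv_swap a₃, pcComm_inv_swap b, c1, c2, one_mem,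
        mem_closure_of_mem])
    exact card_dvd_of_closure_eq_top hgen k5
  -- Both `a₂` and `b` lie in the second centre, and `a₁` separates them: it commutes with `a₂` but
  -- not with `b`.
  refine family7_of_card (card_of_centralizer_chain hcard (u₁ := b) (u₂ := a₂) (u₃ := a₁)
    (u₄ := a) (w₁ := a₁) (w₂ := a) (w₃ := b) (w₄ := a₂) n1 c2 (fun h => n2 h.symm)
    ⟨.refl _, c6.symm⟩ (fun h => n1 h.symm) ⟨c6, .refl _, c3.symm⟩ n2) hZ
    (e2 ▸ pcComm_mem_commutator _ _) hne (s := a₂) (t := b) (w := a₁) (x := a₁) (y := a)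
    (mem_secondCenter_of_closure hgen ?_) (notMem_center_of_pcComm_ne_one (y := a) (e2 ▸ hne))
    c3.symm
    (mem_secondCenter_of_closure hgen ?_) (fun h => n1 h.symm)
    (e1 ▸ notMem_center_of_pcComm_ne_one (y := a) (e2 ▸ hne))
  all_goals simp only [← pcComm_eq_one_iff] at c1 c2 c3 c4 c5 c6 c7
  all_goals have hself : ∀ x : Phi7 p, pcComm x x = 1 := fun x => pcComm_eq_one_iff.2 (.refl x)
  · simp [hself, e2, hZ, pcComm_inv_swap a₂ a₁, c3, c5, c6, one_mem]
  · simp [hself, pcComm_inv_swap b a, pcComm_inv_swap b a₁, pcComm_inv_swap b a₂,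
      pcComm_inv_swap b a₃, e3, hZ, c2, c6, c7, one_mem]

theorem phi9_family (hp : p.Prime) (h2 : p ≠ 2) :
    HasFamilyRank p (Phi9 p) 5 ∧ FamilyHasInvariants.{u} (Phi9 p) (rowA9 p) (rowB9 p) := by
  have : Fact p.Prime := ⟨hp⟩
  have hgen := closure_fin_five (PresentedGroup.closure_range_of (Phi9Rels p))
  have hne := phi9_of_four_ne_one hp h2
  have hZ := mem_center_iff.2 fun x => (phi9_commute_four p x).eq
  obtain ⟨e1, e2, e3, e4, e5, e6, e7, e8, c1, c2, c3, c4, c5, c6, c7⟩ :=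
    (phi9_iff p _).1 (PresentedGroup.lift_of_eq_one (Phi9Rels p))
  generalize (.of 0 : Phi9 p) = a, (.of 1 : Phi9 p) = a₁, (.of 2 : Phi9 p) = a₂,
    (.of 3 : Phi9 p) = a₃, (.of 4 : Phi9 p) = a₄ at *
  have hab := commute_of_mem_closure (S := {a₁, a₂, a₃, a₄})
    (by simp [c2, c3, c4, c5, c6, c7, c2.symm, c3.symm, c4.symm, c5.symm, c6.symm, c7.symm])
  simp only [← pcComm_eq_one_iff] at c1 c2 c3 c4 c5 c6 c7
  rw [mul_assoc, mul_assoc] at e5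
  rw [mul_assoc] at e6
  have k1 := card_closure_singleton_dvd_pow_one e8
  have k2 := card_closure_insert_dvd_pow_succ hp k1 (g := a₃)
    (by simp [eq_inv_of_mul_eq_one_left e7, pow_mem, mem_closure_of_mem])
    (by simp [pcComm_inv_swap a₄, c7, one_mem])
  have k3 := card_closure_insert_dvd_pow_succ hp k2 (g := a₂)
    (mem_of_mul_eq_one e6 (mul_mem (pow_mem (mem_closure_of_mem (by simp)) _)
      (pow_mem (mem_closure_of_mem (by simp)) _)))
    (by simp [pcComm_inv_swap _ a₂, c5, c6, one_mem])
  have k4 := card_closure_insert_dvd_pow_succ hp k3 (g := a₁)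
    (mem_of_mul_eq_one e5 (mul_mem (pow_mem (mem_closure_of_mem (by simp)) _)
      (mul_mem (pow_mem (mem_closure_of_mem (by simp)) _)
        (pow_mem (mem_closure_of_mem (by simp)) _))))
    (by simp [pcComm_inv_swap _ a₁, c2, c3, c4, one_mem])
  have k5 := card_closure_insert_dvd (g := a) (m := p)
    (fun h => pow_ne_zero 4 hp.ne_zero (zero_dvd_iff.1 (h ▸ k4))) (by simp [e4, one_mem])
    fun s hs => conj_mem_of_pcComm_mem (mem_closure_of_mem hs) (by
      revert s
      simp [e1, e2, e3, pcComm_inv_swap a₄, c1, one_mem, mem_closure_of_mem])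
  have k5 := card_dvd_of_closure_eq_top hgen k5
  have e31 : pcComm (pcComm (pcComm a₁ a) a) a = a₄ := by rw [e1, e2, e3]
  exact family9_of_card_dvd
    (k5.trans ((Nat.mul_dvd_mul_left p k4).trans (pow_succ' p 4).symm.dvd)) (e31 ▸ hZ)
    (e31 ▸ hne) k4 k5 hab

theorem phi10_family (hp : p.Prime) (h2 : p ≠ 2) :
    HasFamilyRank p (Phi10 p) 5 ∧ FamilyHasInvariants.{u} (Phi10 p) (rowA10 p) (rowB10 p) := by
  have : Fact p.Prime := ⟨hp⟩
  have hgen := closure_fin_five (PresentedGroup.closure_range_of (Phi10Rels p))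
  have hne := phi10_of_four_ne_one hp h2
  obtain ⟨e1, e2, e3, e9, e4, e5, e6, e7, e8, c1, c3, c4, c5, c6, c7⟩ :=
    (phi10_iff p _).1 (PresentedGroup.lift_of_eq_one (Phi10Rels p))
  generalize (.of 0 : Phi10 p) = a, (.of 1 : Phi10 p) = a₁, (.of 2 : Phi10 p) = a₂,
    (.of 3 : Phi10 p) = a₃, (.of 4 : Phi10 p) = a₄ at *
  have hZ : a₄ ∈ center (Phi10 p) := mem_center_of_closure hgen
    (by simp [c1.symm, c4.symm, c6.symm, c7.symm])
  refine family10_of_card_dvd (card_dvd_of_closure_eq_top hgen ?_) e1 e2 e3 e9 c3 hZ hne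
  simp only [← pcComm_eq_one_iff] at c1 c3 c4 c5 c6 c7
  rw [mul_assoc, mul_assoc] at e5
  rw [mul_assoc] at e6
  have k1 := card_closure_singleton_dvd_pow_one e8
  have k2 := card_closure_insert_dvd_pow_succ hp k1 (g := a₃)
    (by simp [eq_inv_of_mul_eq_one_left e7, pow_mem, mem_closure_of_mem])
    (by simp [pcComm_inv_swap a₄, c7, one_mem])
  have k3 := card_closure_insert_dvd_pow_succ hp k2 (g := a₂)
    (mem_of_mul_eq_one e6 (mul_mem (pow_mem (mem_closure_of_mem (by simp)) _)
      (pow_mem (mem_closure_of_mem (by simp)) _)))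
    (by simp [pcComm_inv_swap _ a₂, c5, c6, one_mem])
  have k4 := card_closure_insert_dvd_pow_succ hp k3 (g := a₁)
    (mem_of_mul_eq_one e5 (mul_mem (pow_mem (mem_closure_of_mem (by simp)) _)
      (mul_mem (pow_mem (mem_closure_of_mem (by simp)) _)
        (pow_mem (mem_closure_of_mem (by simp)) _))))
    (by simp [pcComm_inv_swap _ a₁, e9, c3, c4, one_mem, mem_closure_of_mem])
  exact card_closure_insert_dvd_pow_succ hp k4 (by simp [e4, one_mem])
    (by simp [e1, e2, e3, pcComm_inv_swap a₄, c1, one_mem, mem_closure_of_mem])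

/-- Conjugation by `g` raises `x` to the power `n`, so conjugation by `g ^ k` raises it to the power
`n ^ k`. -/
theorem mul_pow_eq_of_mul_eq {G : Type*} [Group G] {x g : G} {n : ℕ} (h : x * g = g * x ^ n)
    (k : ℕ) : x * g ^ k = g ^ k * x ^ n ^ k := by
  have h1 : SemiconjBy g (x ^ n) x := h.symm
  suffices SemiconjBy (g ^ k) (x ^ n ^ k) x from this.eq.symm
  induction k with
  | zero => simp
  | succ k ih =>
    rw [pow_succ, pow_succ', pow_mul]
    refine ih.mul_left ?_
    have := h1.pow_right (n ^ k)
    exact this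

theorem pow_mul_eq_of_mul_eq {G : Type*} [Group G] {x g : G} {n : ℕ} (h : x * g = g * x ^ n)
    (k : ℕ) : x ^ k * g = g * x ^ (k * n) := by
  have h1 : SemiconjBy g (x ^ n) x := h.symm
  rw [mul_comm, pow_mul]
  exact (h1.pow_right k).eq.symm

/-- Raising a congruence modulo `p` to the `p`-th power makes it a congruence modulo `p ^ 2`. -/
theorem one_add_pow_eq_one_add_sq_mul (p : ℕ) : ∃ k, (1 + p) ^ p = 1 + p ^ 2 * k := by
  have h : ((p ^ 2 : ℕ) : ℤ) ∣ ((1 + p) ^ p : ℕ) - (1 : ℕ) := by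
    have := dvd_sub_pow_of_dvd_sub (R := ℤ) (p := p) (a := 1 + p) (b := 1) (by simp) 1
    simpa using this
  obtain ⟨k, hk⟩ := (Nat.modEq_iff_dvd' (Nat.one_le_pow _ _ (by omega))).1
    (Nat.modEq_iff_dvd.2 h)
  exact ⟨k, by rw [← hk]; have := Nat.one_le_pow p (1 + p) (by omega); omega⟩

theorem phi8_family (hp : p.Prime) (h2 : p ≠ 2) :
    HasFamilyRank p (Phi8 p) 5 ∧ FamilyHasInvariants.{u} (Phi8 p) (rowA7 p) (rowB7 p) := by
  have : Fact p.Prime := ⟨hp⟩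
  have hgen := closure_fin_three (PresentedGroup.closure_range_of (Phi8Rels p))
  obtain ⟨n1, n2⟩ := phi8_not_commute hp h2
  obtain ⟨e1, e2, e3, e4⟩ := (phi8_iff p _).1 (PresentedGroup.lift_of_eq_one (Phi8Rels p))
  generalize (.of 0 : Phi8 p) = a₁, (.of 1 : Phi8 p) = a₂, (.of 2 : Phi8 p) = b at *
  obtain ⟨k, hk⟩ := one_add_pow_eq_one_add_sq_mul p
  have h1 : a₁ * a₂ = a₂ * a₁ ^ (1 + p) := by
    rw [pcComm_eq_iff, e2] at e1
    rw [e1, pow_add, pow_one, mul_assoc]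
  have hb : b * a₂ = a₂ * b * b ^ p := by
    rw [mul_assoc, ← pow_succ', e2, pow_mul_eq_of_mul_eq h1, ← pow_mul, add_comm 1 p]
  have hbp : pcComm b a₂ = b ^ p := pcComm_eq_iff.2 hb
  have c1 : Commute b a₁ := e2 ▸ Commute.pow_self a₁ p
  -- Conjugation by `a₂ ^ p` raises `a₁` to the power `1 + p ^ 2 k`, and `a₁ ^ (p ^ 2) = b ^ p`. As
  -- `b ^ p` turns out to be central, this puts `a₂ ^ p` in the second centre.
  have hap : pcComm a₁ (a₂ ^ p) = (b ^ p) ^ k := by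
    have hb2 : b ^ p = a₁ ^ p ^ 2 := by rw [e2, ← pow_mul, sq]
    rw [pcComm_eq_iff, mul_pow_eq_of_mul_eq h1, hk, hb2, ← pow_mul, pow_add, pow_one, mul_assoc]
  have hb' : b * a₂ = a₂ * b ^ (1 + p) := by rw [hb, mul_assoc, pow_add, pow_one]
  have c2 : Commute b (a₂ ^ p) := by
    change _ = _
    rw [mul_pow_eq_of_mul_eq hb', hk, pow_add, pow_one, pow_mul, e3, one_pow, mul_one]
  have hZ : b ^ p ∈ center (Phi8 p) := by
    refine mem_center_of_closure hgen ?_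
    simp only [Set.mem_insert_iff, Set.mem_singleton_iff, forall_eq_or_imp, forall_eq]
    refine ⟨c1.pow_left p, ?_, .pow_self b p⟩
    change _ = _
    rw [pow_mul_eq_of_mul_eq hb', mul_add, mul_one, ← sq, pow_add, e3, mul_one]
  have hcard : Nat.card (Phi8 p) ∣ p ^ 5 := by
    -- Since `b = a₁ ^ p` is redundant, the group is the cyclic `⟨a₁⟩`, of order dividing `p ^ 3`,
    -- extended by `a₂`, which contributes at most `p ^ 2`.
    have hgen' : closure ({a₂, a₁} : Set (Phi8 p)) = ⊤ := by
      rw [eq_top_iff, ← hgen, closure_le]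
      have h3 : a₁ ∈ closure ({a₂, a₁} : Set (Phi8 p)) := mem_closure_of_mem (by simp)
      simp [Set.insert_subset_iff, h3, mem_closure_of_mem, e2, pow_mem]
    have k1 : Nat.card (closure {a₁}) ∣ p ^ 3 := card_closure_singleton_dvd
      (by rw [pow_succ', pow_mul, ← e2, e3])
    refine card_dvd_of_closure_eq_top hgen' (card_closure_insert_dvd_pow (m := p ^ 2) hp.ne_zero k1
      (by rw [e4]; exact one_mem _) ?_ (pow_add p 2 3).symm)
    intro s hs
    rw [Set.mem_singleton_iff.1 hs, mul_assoc, h1, inv_mul_cancel_left]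
    exact pow_mem (mem_closure_of_mem (Set.mem_singleton a₁)) _
  have hne : b ^ p ≠ 1 := fun h => n1 (pcComm_eq_one_iff.1 (hbp.trans h)).symm
  have hbK : b ^ p ∈ commutator (Phi8 p) := by
    rw [← hbp]
    exact pcComm_mem_commutator _ _
  have hbZ : b ∉ center (Phi8 p) := fun h => n1 (mem_center_iff.1 h a₂)
  refine family7_of_card (card_of_centralizer_chain hcard (u₁ := b) (u₂ := a₁) (u₃ := a₂ ^ p)
    (u₄ := a₂) (w₁ := a₂) (w₂ := a₂ ^ p) (w₃ := a₁) (w₄ := b) n1 c2.symm n2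
    ⟨c1.symm, .refl _⟩ (fun h => n2 h.symm) ⟨.refl _, c1, c2⟩ fun h => n1 h.symm) hZ
    hbK hne (s := b) (t := a₂ ^ p) (w := a₁) (x := a₁) (y := a₂)
    (mem_secondCenter_of_closure hgen ?_) hbZ c1
    (mem_secondCenter_of_closure hgen ?_) n2 (by rwa [e1])
  · simp [pcComm_eq_one_iff.2 c1, hbp, hZ, pcComm_eq_one_iff.2 (.refl b), one_mem]
  · simp [pcComm_inv_swap _ a₁, hap, pow_mem hZ, pcComm_eq_one_iff.2 (Commute.pow_self a₂ p),
      pcComm_eq_one_iff.2 c2.symm, one_mem]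

theorem gamma2_family :
    HasFamilyRank 2 Gamma2 3 ∧ FamilyHasInvariants.{u} Gamma2 (rowA2 2) (rowB2 2) := by
  have h := family2_of_card_dvd.{u} (K := Gamma2) (p := 2) (x := .r 1) (y := .sr 0)
    (by rw [DihedralGroup.nat_card]; norm_num) (mem_center_iff.2 (by decide)) (by decide)
  simpa using h

theorem gamma3_family :
    HasFamilyRank 2 Gamma3 4 ∧ FamilyHasInvariants.{u} Gamma3 (rowA3 2) (rowB3 2) := by
  have h := family3_of_card_dvd.{u} (K := Gamma3) (p := 2) (x := .r 1) (y := .sr 0) (z := .sr 0)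
    (by rw [DihedralGroup.nat_card]; norm_num) (mem_center_iff.2 (by decide)) (by decide)
  simpa using h

theorem gamma8_family :
    HasFamilyRank 2 Gamma8 5 ∧ FamilyHasInvariants.{u} Gamma8 (rowA9 2) (rowB9 2) := by
  -- The rotations are the abelian subgroup of index `2`.
  have hA : Nat.card (zpowers (DihedralGroup.r 1 : Gamma8)) = 16 := by
    rw [Nat.card_zpowers, DihedralGroup.orderOf_r_one]
  have h := family9_of_card_dvd.{u} (K := Gamma8) (p := 2) (x := .r 1) (y := .sr 0) (z := .sr 0)
    (w := .sr 0) (by rw [DihedralGroup.nat_card]; norm_num) (mem_center_iff.2 (by decide))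
    (by decide)
    (A := zpowers (.r 1)) (by rw [hA]; norm_num) (by rw [hA, DihedralGroup.nat_card]) (by
      rintro _ ⟨i, rfl⟩ _ ⟨j, rfl⟩
      exact (Commute.refl _).zpow_zpow i j)
  simpa using h

theorem mul_eq_of_conj_eq_inv {G : Type*} [Group G] {a b : G} (h : b * a * b⁻¹ = a⁻¹) :
    a * b = b * a⁻¹ := by
  rw [mul_inv_eq_iff_eq_mul] at h
  rw [eq_mul_inv_iff_mul_eq, mul_assoc, h, mul_inv_cancel_left]

theorem gamma4_family :
    HasFamilyRank 2 Gamma4 5 ∧ FamilyHasInvariants.{u} Gamma4 (rowA3 2) (rowB3 2) := by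
  have hgen := closure_fin_three (PresentedGroup.closure_range_of Gamma4Rels)
  obtain ⟨hne, hne'⟩ := gamma4_nontrivial
  obtain ⟨e1, e2, e3, e4, e5, c1⟩ := (gamma4_iff _).1 (PresentedGroup.lift_of_eq_one Gamma4Rels)
  generalize (.of 0 : Gamma4) = a₁, (.of 1 : Gamma4) = a₂, (.of 2 : Gamma4) = b at *
  have hgen' : closure ({b, a₁, a₂} : Set Gamma4) = ⊤ := by
    rw [← hgen]
    congr 1
    ext x
    simp only [Set.mem_insert_iff, Set.mem_singleton_iff]
    tauto
  have f1 := mul_eq_of_conj_eq_inv e4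
  have f2 := mul_eq_of_conj_eq_inv e5
  -- Inverting an element of order dividing `4` multiplies it by its square; so the squares of `a₁`
  -- and `a₂` are the central commutators.
  have key : ∀ x : Gamma4, x ^ 4 = 1 → x * b = b * x⁻¹ → pcComm x b = x ^ 2 ∧
      Commute (x ^ 2) b := by
    intro x hx h
    have h3 : x⁻¹ = x * x ^ 2 := by
      rw [inv_eq_iff_mul_eq_one, ← pow_succ', ← pow_succ']
      exact hx
    refine ⟨pcComm_eq_iff.2 (by rw [h, h3, mul_assoc]), ?_⟩
    change _ = _
    rw [sq, mul_assoc, h, ← mul_assoc, h, mul_assoc, h3, ← pow_succ', ← pow_add, ← sq]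
    rw [show 2 + 1 + (2 + 1) = 4 + 2 from rfl, pow_add, hx, one_mul]
  obtain ⟨g1, d1⟩ := key a₁ e1 f1
  obtain ⟨g2, d2⟩ := key a₂ e2 f2
  have k1 : Nat.card (closure {a₂}) ∣ 2 ^ 2 := card_closure_singleton_dvd e2
  have k2 := card_closure_insert_dvd_pow (g := a₁) (m := 4) (j := 4) two_ne_zero k1
    (by rw [e1]; exact one_mem _)
    (by
      rintro _ rfl
      exact conj_mem_of_commute (mem_closure_of_mem rfl) c1.symm) rfl
  have k3 := card_closure_insert_dvd (g := b) (m := 2)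
    (fun h => pow_ne_zero 4 two_ne_zero (zero_dvd_iff.1 (h ▸ k2)))
    (by rw [e3]; exact one_mem _) (by
      simp only [Set.mem_insert_iff, Set.mem_singleton_iff, forall_eq_or_imp, forall_eq,
        mul_assoc, f1, f2, inv_mul_cancel_left, inv_mem_iff]
      exact ⟨mem_closure_of_mem (by simp), mem_closure_of_mem (by simp)⟩)
  have k3 := card_dvd_of_closure_eq_top hgen' k3
  have h := family4_of_card_dvd.{u} (p := 2)
    (k3.trans ((Nat.mul_dvd_mul_left 2 k2).trans (pow_succ' 2 4).symm.dvd))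
    (mem_center_of_closure hgen (by simp [c1.pow_left, d1]))
    (mem_center_of_closure hgen (by simp [c1.symm.pow_left, d2]))
    (g1 ▸ pcComm_mem_commutator _ _) (g2 ▸ pcComm_mem_commutator _ _) hne hne' k2 k3
    (commute_of_mem_closure (by simp [c1, c1.symm]))
  simpa using h

theorem gamma5_family :
    HasFamilyRank 2 Gamma5 5 ∧ FamilyHasInvariants.{u} Gamma5 (rowA5 2) (rowB5 2) := by
  have hgen := closure_fin_five (PresentedGroup.closure_range_of Gamma5Rels)
  have hne := gamma5_of_four_ne_one
  obtain ⟨o1, o2, o3, o4, o5, e1, e2, e3, c1, c2, c3, d1, d2, d3, d4⟩ :=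
    (gamma5_iff _).1 (PresentedGroup.lift_of_eq_one Gamma5Rels)
  generalize (.of 0 : Gamma5) = a₁, (.of 1 : Gamma5) = a₂, (.of 2 : Gamma5) = a₃,
    (.of 3 : Gamma5) = a₄, (.of 4 : Gamma5) = b at *
  have key : ∀ x y : Gamma5, y ^ 2 = 1 → x * y * x⁻¹ = b * y⁻¹ → Commute x b → Commute y b →
      pcComm x y = b := by
    intro x y hy h hx hyb
    rw [mul_inv_eq_iff_eq_mul, inv_eq_of_mul_eq_one_left ((sq y).symm.trans hy)] at h
    rw [pcComm_eq_iff, h, mul_assoc]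
    exact (hyb.mul_left hx).eq.symm
  have f1 := key a₁ a₂ o2 e1 d1 d2
  have f2 := key a₁ a₄ o4 e2 d1 d4
  have f3 := key a₂ a₃ o3 e3 d2 d3
  have hb : b ∈ center Gamma5 := mem_center_of_closure hgen
    (by simp [d1.symm, d2.symm, d3.symm, d4.symm])
  have n1 : ¬ Commute a₁ a₂ := fun h => hne (f1.symm.trans (pcComm_eq_one_iff.2 h))
  have n2 : ¬ Commute a₁ a₄ := fun h => hne (f2.symm.trans (pcComm_eq_one_iff.2 h))
  have n3 : ¬ Commute a₂ a₃ := fun h => hne (f3.symm.trans (pcComm_eq_one_iff.2 h))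
  -- Moving `a₂` past `a₁` and past `a₃` costs a factor `b` each time, and `b ^ 2 = 1`. Thus `a₁ *
  -- a₃` centralizes `a₁`, `a₂` and `a₃` but not `a₄`, as the last link of the chain requires.
  have h13 : Commute (a₁ * a₃) a₂ := by
    have g1 := pcComm_eq_iff.1 f1
    have g3 : a₃ * a₂ = a₂ * a₃ * b := pcComm_eq_iff.1
      (by rw [pcComm_inv_swap, f3, inv_eq_of_mul_eq_one_left ((sq b).symm.trans o5)])
    calc a₁ * a₃ * a₂ = a₁ * a₂ * (a₃ * b) := by rw [mul_assoc, g3, mul_assoc, mul_assoc]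
      _ = a₂ * (a₁ * a₃) := by
        rw [g1, d3.eq, mul_assoc (a₂ * a₁), ← mul_assoc b b, ← sq, o5, one_mul, mul_assoc]
  have hcard : Nat.card Gamma5 ∣ 2 ^ 5 := by
    simp only [← pcComm_eq_one_iff] at c1 c2 c3 d1 d2 d3 d4
    have hp := Nat.prime_two
    have k1 := card_closure_singleton_dvd_pow_one o5
    have k2 := card_closure_insert_dvd_pow_succ hp k1 (g := a₄)
      (by simp [o4, one_mem]) (by simp [pcComm_inv_swap b, d4, one_mem])
    have k3 := card_closure_insert_dvd_pow_succ hp k2 (g := a₃)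
      (by simp [o3, one_mem]) (by simp [pcComm_inv_swap _ a₃, c3, d3, one_mem])
    have k4 := card_closure_insert_dvd_pow_succ hp k3 (g := a₂)
      (by simp [o2, one_mem])
      (by simp [pcComm_inv_swap _ a₂, f3, c2, d2, one_mem, mem_closure_of_mem])
    have k5 := card_closure_insert_dvd_pow_succ hp k4 (g := a₁)
      (by simp [o1, one_mem])
      (by simp [pcComm_inv_swap _ a₁, f1, f2, c1, d1, one_mem, mem_closure_of_mem])
    exact card_dvd_of_closure_eq_top hgen k5
  have h := family5_of_card.{u} (card_of_centralizer_chain hcard (u₁ := a₃) (u₂ := a₂) (u₃ := a₁)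
    (u₄ := a₄) (w₁ := a₂) (w₂ := a₃) (w₃ := a₄) (w₄ := a₁ * a₃) n3 (.refl _) (fun h => n3 h.symm)
    ⟨c3.symm, c2.symm⟩ (fun h => n2 h.symm)
    ⟨c1.mul_left (.refl _), h13, (Commute.refl _).mul_left c1.symm⟩
    fun h => n2 (by simpa using h.mul_left c3.inv_left))
    (commutator_le_of_closure hgen (by
      simp only [← pcComm_eq_one_iff] at c1 c2 c3 d1 d2 d3 d4
      have hself : ∀ x : Gamma5, pcComm x x = 1 := fun x => pcComm_eq_one_iff.2 (.refl x)
      simp [pcComm_inv_swap b a₁, pcComm_inv_swap b a₂, pcComm_inv_swap b a₃,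
        pcComm_inv_swap b a₄, pcComm_inv_swap a₂ a₁, pcComm_inv_swap a₃ a₁, pcComm_inv_swap a₄ a₁,
        pcComm_inv_swap a₃ a₂, pcComm_inv_swap a₄ a₂, pcComm_inv_swap a₄ a₃, hself, f1, f2, f3, hb,
        c1, c2, c3, d1, d2, d3, d4, one_mem])) (x := a₁) (y := a₂) (by rwa [f1])
  simpa using h

theorem gamma6_family :
    HasFamilyRank 2 Gamma6 5 ∧ FamilyHasInvariants.{u} Gamma6 (rowA7 2) (rowB7 2) := by
  have hgen := closure_fin_three (PresentedGroup.closure_range_of Gamma6Rels)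
  have hne := gamma6_of_zero_pow_ne_one
  obtain ⟨o1, o2, o3, e1, e2, c1⟩ :=
    (gamma6_iff _).1 (PresentedGroup.lift_of_eq_one Gamma6Rels)
  generalize (.of 0 : Gamma6) = a, (.of 1 : Gamma6) = b₁, (.of 2 : Gamma6) = b₂ at *
  have f1 : a * b₁ = b₁ * a ^ 7 := by
    rw [mul_eq_of_conj_eq_inv e1, inv_eq_of_mul_eq_one_right ((pow_succ' a 7).symm.trans o1)]
  have f2 : a * b₂ = b₂ * a ^ 5 := by
    rw [mul_inv_eq_iff_eq_mul] at e2
    rw [← one_mul (a * b₂), ← o3, sq, mul_assoc, ← mul_assoc b₂ a, e2, mul_assoc, ← sq, o3, mul_one]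
  -- Inversion on `⟨a⟩` is the seventh power, so the commutator exponent is `7 - 1`; for `b₂` it is
  -- `5 - 1`.
  have h1 : ∀ k, pcComm (a ^ k) b₁ = a ^ (k * 6) := fun k => by
    rw [pcComm_eq_iff, pow_mul_eq_of_mul_eq f1, mul_assoc, ← pow_add]
    congr 2
    ring
  have h2 : ∀ k, pcComm (a ^ k) b₂ = a ^ (k * 4) := fun k => by
    rw [pcComm_eq_iff, pow_mul_eq_of_mul_eq f2, mul_assoc, ← pow_add]
    congr 2
    ring
  have h8 : ∀ k, a ^ (8 * k) = 1 := fun k => by rw [pow_mul, o1, one_pow]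
  have n1 : ¬ Commute (a ^ 2) b₁ := fun h => by
    rw [← pcComm_eq_one_iff, h1, show 2 * 6 = 8 * 1 + 4 from rfl, pow_add, h8, one_mul] at h
    exact hne h
  have h2' : pcComm a b₂ = a ^ 4 := by simpa using h2 1
  have n2 : ¬ Commute a b₂ := fun h => hne (h2'.symm.trans (pcComm_eq_one_iff.2 h))
  have c2 : Commute (a ^ 2) b₂ := pcComm_eq_one_iff.1 ((h2 2).trans (h8 1))
  have hZ : a ^ 4 ∈ center Gamma6 := by
    refine mem_center_of_closure hgen ?_
    simp only [Set.mem_insert_iff, Set.mem_singleton_iff, forall_eq_or_imp, forall_eq]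
    exact ⟨.pow_self a 4, pcComm_eq_one_iff.1 ((h1 4).trans (h8 3)),
      pcComm_eq_one_iff.1 ((h2 4).trans (h8 2))⟩
  have hK : a ^ 4 ∈ commutator Gamma6 := by
    rw [← h2']
    exact pcComm_mem_commutator _ _
  have hZ2 : a ^ 2 ∉ center Gamma6 := fun h => n1 (mem_center_iff.1 h b₁).symm
  have hcard : Nat.card Gamma6 ∣ 2 ^ 5 := by
    have hgen' : closure ({b₁, b₂, a} : Set Gamma6) = ⊤ := by
      rw [← hgen]
      congr 1
      ext x
      simp only [Set.mem_insert_iff, Set.mem_singleton_iff]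
      tauto
    have k1 : Nat.card (closure {a}) ∣ 2 ^ 3 := card_closure_singleton_dvd o1
    have k2 := card_closure_insert_dvd_pow (g := b₂) (m := 2) (j := 4) two_ne_zero k1
      (by rw [o3]; exact one_mem _)
      (by simp only [Set.mem_singleton_iff, forall_eq, mul_assoc, f2, inv_mul_cancel_left]
          exact pow_mem (mem_closure_of_mem (Set.mem_singleton a)) 5) rfl
    refine card_dvd_of_closure_eq_top hgen' (card_closure_insert_dvd_pow (m := 2) two_ne_zero k2
      (by rw [o2]; exact one_mem _) ?_ rfl)
    simp only [Set.mem_insert_iff, Set.mem_singleton_iff, forall_eq_or_imp, forall_eq, mul_assoc,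
      f1, c1.symm.eq, inv_mul_cancel_left]
    exact ⟨mem_closure_of_mem (by simp), pow_mem (mem_closure_of_mem (by simp)) 7⟩
  have h := family7_of_card.{u} (card_of_centralizer_chain hcard (u₁ := a ^ 2) (u₂ := a)
    (u₃ := b₂) (u₄ := b₁) (w₁ := b₁) (w₂ := b₂) (w₃ := a) (w₄ := a ^ 2) (fun h => n1 h.symm)
    c2.symm (fun h => n2 h.symm) ⟨.self_pow a 2, .refl a⟩ n2 ⟨.refl _, .pow_self a 2, c2⟩ n1)
    hZ hK hne (s := a ^ 2) (t := b₂) (w := a) (x := a) (y := b₁)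
    (mem_secondCenter_of_closure hgen ?_) hZ2 (.pow_self a 2)
    (mem_secondCenter_of_closure hgen ?_) (fun h => n2 h.symm) ?_
  · simpa using h
  · simp only [Set.mem_insert_iff, Set.mem_singleton_iff, forall_eq_or_imp, forall_eq]
    refine ⟨?_, ?_, ?_⟩
    · rw [pcComm_eq_one_iff.2 (Commute.pow_self a 2)]
      exact one_mem _
    · rw [h1, show 2 * 6 = 4 * 3 from rfl, pow_mul]
      exact pow_mem hZ 3
    · rw [pcComm_eq_one_iff.2 c2]
      exact one_mem _
  · simp [pcComm_inv_swap _ a, h2', hZ, pcComm_eq_one_iff.2 c1.symm,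
      pcComm_eq_one_iff.2 (Commute.refl b₂), one_mem]
  · have h6 : pcComm a b₁ = a ^ 4 * a ^ 2 := by simpa [← pow_add] using h1 1
    rwa [h6, mul_mem_cancel_left hZ]

theorem gamma7_family :
    HasFamilyRank 2 Gamma7 5 ∧ FamilyHasInvariants.{u} Gamma7 (rowA7 2) (rowB7 2) := by
  have hgen := closure_fin_four (PresentedGroup.closure_range_of Gamma7Rels)
  have hne := gamma7_of_one_ne_one
  obtain ⟨o1, o2, o3, o4, e1, e2, c1, c2, c3, c4⟩ :=
    (gamma7_iff _).1 (PresentedGroup.lift_of_eq_one Gamma7Rels)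
  generalize (.of 0 : Gamma7) = a, (.of 1 : Gamma7) = b₁, (.of 2 : Gamma7) = b₂,
    (.of 3 : Gamma7) = b₃ at *
  have hZ : b₁ ∈ center Gamma7 := mem_center_of_closure hgen (by simp [c1.symm, c2, c3])
  rw [mul_inv_eq_iff_eq_mul] at e1 e2
  have f1 : b₂ * a = a * b₂ * b₁ := by
    rw [e1, c2.eq, mul_assoc, mul_assoc, c1.eq, ← mul_assoc b₁, ← sq, o1, one_mul]
  have f2 : b₃ * a = a * b₃ * (b₂ * b₁) := by
    have q1 : b₁ * (b₂ * b₁) = b₂ := by rw [c2.symm.eq, ← mul_assoc, ← sq, o1, one_mul]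
    have q2 : b₂ * (b₃ * b₂) = b₃ := by rw [c4.symm.eq, ← mul_assoc, ← sq, o2, one_mul]
    calc b₃ * a = b₂ * b₃ * (b₁ * (b₂ * b₁)) * a := by rw [q1, mul_assoc b₂, q2]
      _ = b₂ * b₃ * (b₁ * b₂ * (a * b₁)) := by rw [c1.eq]; simp only [mul_assoc]
      _ = a * b₃ * (b₂ * b₁) := by rw [← mul_assoc (b₁ * b₂), ← e1, e2]; simp only [mul_assoc]
  have g1 : pcComm b₂ a = b₁ := pcComm_eq_iff.2 f1
  have g2 : pcComm b₃ a = b₂ * b₁ := pcComm_eq_iff.2 f2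
  have hs2 : Commute b₂ (a ^ 2) := by
    change _ = _
    rw [sq, ← mul_assoc, f1, mul_assoc (a * b₂), c1.symm.eq, ← mul_assoc, mul_assoc a, f1]
    simp only [mul_assoc]
    rw [← sq b₁, o1, mul_one]
  -- Together with `hs2` this shows that `a ^ 2` lies in the second centre but not in the centre.
  have g3 : pcComm b₃ (a ^ 2) = b₁ := by
    have q1 : b₂ * b₁ * a = a * b₂ := by
      rw [mul_assoc, c1.symm.eq, ← mul_assoc, f1, mul_assoc, ← sq, o1, mul_one]
    have q2 : b₂ * b₁ * b₂ = b₁ := by rw [mul_assoc, c2.eq, ← mul_assoc, ← sq, o2, one_mul]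
    rw [pcComm_eq_iff, sq, ← mul_assoc, f2, mul_assoc (a * b₃), q1, ← mul_assoc, mul_assoc a b₃ a,
      f2, mul_assoc a, mul_assoc (a * b₃), q2]
    simp only [mul_assoc]
  have n1 : ¬ Commute b₂ a := fun h => hne (g1.symm.trans (pcComm_eq_one_iff.2 h))
  have n2 : ¬ Commute b₃ (a ^ 2) := fun h => hne (g3.symm.trans (pcComm_eq_one_iff.2 h))
  have hK : b₁ ∈ commutator Gamma7 := by
    rw [← g1]
    exact pcComm_mem_commutator _ _
  have hZ2 : a ^ 2 ∉ center Gamma7 := fun h => n2 (mem_center_iff.1 h b₃)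
  have hcard : Nat.card Gamma7 ∣ 2 ^ 5 := by
    have k1 := card_closure_singleton_dvd_pow_one o3
    have k2 := card_closure_insert_dvd_pow_succ Nat.prime_two k1 (g := b₂)
      (by simp [o2, one_mem]) (by simp [pcComm_eq_one_iff.2 c4.symm, one_mem])
    have k3 := card_closure_insert_dvd_pow_succ Nat.prime_two k2 (g := b₁)
      (by simp [o1, one_mem])
      (by simp [pcComm_eq_one_iff.2 c2.symm, pcComm_eq_one_iff.2 c3.symm, one_mem])
    refine card_dvd_of_closure_eq_top hgen (card_closure_insert_dvd_pow (m := 4) two_ne_zero k3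
      (by rw [o4]; exact one_mem _) ?_ rfl)
    intro s hs
    refine conj_mem_of_pcComm_mem (mem_closure_of_mem hs) ?_
    revert s
    simp only [Set.mem_insert_iff, Set.mem_singleton_iff, forall_eq_or_imp, forall_eq, g1, g2,
      pcComm_eq_one_iff.2 c1.symm]
    exact ⟨one_mem _, mem_closure_of_mem (by simp),
      mul_mem (mem_closure_of_mem (by simp)) (mem_closure_of_mem (by simp))⟩
  have h := family7_of_card.{u} (card_of_centralizer_chain hcard (u₁ := b₂) (u₂ := b₃)
    (u₃ := a ^ 2) (u₄ := a) (w₁ := a) (w₂ := a ^ 2) (w₃ := b₃) (w₄ := b₂) (fun h => n1 h.symm)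
    hs2.symm (fun h => n2 h.symm) ⟨c4.symm, .refl _⟩ n2 ⟨.refl _, c4, hs2⟩ n1)
    hZ hK hne (s := a ^ 2) (t := b₂) (w := a) (x := b₃) (y := a)
    (mem_secondCenter_of_closure hgen ?_) hZ2 (.pow_self a 2)
    (mem_secondCenter_of_closure hgen ?_) n1 ?_
  · simpa using h
  · simp [pcComm_eq_one_iff.2 (Commute.pow_self a 2), pcComm_eq_one_iff.2 (c1.pow_left 2),
      pcComm_eq_one_iff.2 hs2.symm, pcComm_inv_swap _ b₃, g3, hZ, one_mem]
  · simp [g1, hZ, pcComm_eq_one_iff.2 c2.symm, pcComm_eq_one_iff.2 c4,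
      pcComm_eq_one_iff.2 (Commute.refl b₂), one_mem]
  · rw [g2, mul_mem_cancel_right hZ]
    exact fun h => n1 (mem_center_iff.1 h a).symm

end Families

/-! ### Coincidences between families, and families of rank three and four -/

section MainTheorem

theorem series_eq_of_rescale_eq {f g : PowerSeries ℚ} {a : ℚ} (ha : a ≠ 0)
    (h : PowerSeries.rescale a f = PowerSeries.rescale a g) : f = g := by
  ext n
  have := congrArg (PowerSeries.coeff n) h
  rw [PowerSeries.coeff_rescale, PowerSeries.coeff_rescale] at this
  exact mul_left_cancel₀ (pow_ne_zero n ha) this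

/-- For groups of equal order the two normalizations are the same rescaling by a nonzero factor,
which can be cancelled. -/
theorem familiesAgree_of_invariants {K L : Type} [Group K] [Group L] {a b : PowerSeries ℚ}
    (hK : FamilyHasInvariants.{u} K a b) (hL : FamilyHasInvariants.{v} L a b) :
    FamiliesAgree.{u, v} K L := by
  intro G H _ _ _ _ hG hH
  obtain ⟨hA, hB⟩ := hK G hG
  obtain ⟨hA', hB'⟩ := hL H hH
  refine ⟨hA.trans hA'.symm, hB.trans hB'.symm, fun h => ?_⟩
  have h0 : (Nat.card G : ℚ)⁻¹ ≠ 0 := inv_ne_zero (Nat.cast_ne_zero.2 Nat.card_pos.ne')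
  rw [normA] at hA hA'
  rw [normB] at hB hB'
  rw [← h] at hA' hB'
  exact ⟨series_eq_of_rescale_eq h0 (hA.trans hA'.symm),
    series_eq_of_rescale_eq h0 (hB.trans hB'.symm)⟩

theorem exists_stem_of_familyRank {p r : ℕ} (hp : p.Prime) {G : Type u} [Group G] [Finite G]
    (h : HasFamilyRank p G r) : ∃ (H : Type) (_ : Group H) (_ : Finite H), IsStemGroup H ∧
      Nat.card H = p ^ r ∧ normA G = normA H ∧ normB G = normB H := by
  obtain ⟨H, _, hGH, hs, hH⟩ := h
  -- Finiteness of the stem group is not part of `HasFamilyRank`; it follows because `Nat.card` of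
  -- an infinite type is `0`, not a prime power.
  have : Finite H := Nat.finite_of_card_ne_zero (hH ▸ pow_ne_zero r hp.ne_zero)
  exact ⟨H, inferInstance, this, hs, hH, hGH.norm_eq⟩

theorem norm_of_familyRank_three {p : ℕ} (hp : p.Prime) {G : Type u} [Group G] [Finite G]
    (h : HasFamilyRank p G 3) : normA G = rowA2 p ∧ normB G = rowB2 p := by
  have : Fact p.Prime := ⟨hp⟩
  obtain ⟨H, _, _, hs, hH, hA, hB⟩ := exists_stem_of_familyRank hp h
  rw [hA, hB]
  exact row2_of_isStemGroup hs hH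

theorem norm_of_familyRank_four {p : ℕ} (hp : p.Prime) {G : Type u} [Group G] [Finite G]
    (h : HasFamilyRank p G 4) : normA G = rowA3 p ∧ normB G = rowB3 p := by
  have : Fact p.Prime := ⟨hp⟩
  obtain ⟨H, _, _, hs, hH, hA, hB⟩ := exists_stem_of_familyRank hp h
  rw [hA, hB]
  exact row3_of_isStemGroup hs hH

end MainTheorem

theorem mainTheorem9 :
    -- abelian groups
    (∀ (G : Type u) [CommGroup G] [Finite G], normA G = pole 1 1 ∧ normB G = pole 1 1) ∧
    -- families of rank 3 and of rank 4, for every prime (including 2)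
    (∀ p : ℕ, p.Prime → ∀ (G : Type u) [Group G] [Finite G],
      (HasFamilyRank p G 3 → normA G = rowA2 p ∧ normB G = rowB2 p) ∧
      (HasFamilyRank p G 4 → normA G = rowA3 p ∧ normB G = rowB3 p)) ∧
    -- the families Φ₂, …, Φ₁₀, for odd primes
    (∀ p : ℕ, p.Prime → p ≠ 2 →
      (HasFamilyRank p (Phi2 p) 3 ∧ FamilyHasInvariants.{u} (Phi2 p) (rowA2 p) (rowB2 p)) ∧
      (HasFamilyRank p (Phi3 p) 4 ∧ FamilyHasInvariants.{u} (Phi3 p) (rowA3 p) (rowB3 p)) ∧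
      (HasFamilyRank p (Phi4 p) 5 ∧ FamilyHasInvariants.{u} (Phi4 p) (rowA3 p) (rowB3 p)) ∧
      (HasFamilyRank p (Phi5 p) 5 ∧ FamilyHasInvariants.{u} (Phi5 p) (rowA5 p) (rowB5 p)) ∧
      (HasFamilyRank p (Phi6 p) 5 ∧ FamilyHasInvariants.{u} (Phi6 p) (rowA6 p) (rowB6 p)) ∧
      (HasFamilyRank p (Phi7 p) 5 ∧ FamilyHasInvariants.{u} (Phi7 p) (rowA7 p) (rowB7 p)) ∧
      (HasFamilyRank p (Phi8 p) 5 ∧ FamilyHasInvariants.{u} (Phi8 p) (rowA7 p) (rowB7 p)) ∧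
      (HasFamilyRank p (Phi9 p) 5 ∧ FamilyHasInvariants.{u} (Phi9 p) (rowA9 p) (rowB9 p)) ∧
      (HasFamilyRank p (Phi10 p) 5 ∧ FamilyHasInvariants.{u} (Phi10 p) (rowA10 p) (rowB10 p))) ∧
    -- the families Γ₂, …, Γ₈ of 2-groups
    ((HasFamilyRank 2 Gamma2 3 ∧ FamilyHasInvariants.{u} Gamma2 (rowA2 2) (rowB2 2)) ∧
      (HasFamilyRank 2 Gamma3 4 ∧ FamilyHasInvariants.{u} Gamma3 (rowA3 2) (rowB3 2)) ∧
      (HasFamilyRank 2 Gamma4 5 ∧ FamilyHasInvariants.{u} Gamma4 (rowA3 2) (rowB3 2)) ∧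
      (HasFamilyRank 2 Gamma5 5 ∧ FamilyHasInvariants.{u} Gamma5 (rowA5 2) (rowB5 2)) ∧
      (HasFamilyRank 2 Gamma6 5 ∧ FamilyHasInvariants.{u} Gamma6 (rowA7 2) (rowB7 2)) ∧
      (HasFamilyRank 2 Gamma7 5 ∧ FamilyHasInvariants.{u} Gamma7 (rowA7 2) (rowB7 2)) ∧
      (HasFamilyRank 2 Gamma8 5 ∧ FamilyHasInvariants.{u} Gamma8 (rowA9 2) (rowB9 2))) ∧
    -- coincidences
    (∀ p : ℕ, p.Prime → p ≠ 2 →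
      FamiliesAgree.{u, v} (Phi3 p) (Phi4 p) ∧ FamiliesAgree.{u, v} (Phi7 p) (Phi8 p)) ∧
    (FamiliesAgree.{u, v} Gamma3 Gamma4 ∧ FamiliesAgree.{u, v} Gamma6 Gamma7) :=
  ⟨fun _ _ _ => norm_of_comm fun _ _ => mul_comm _ _,
    fun _ hp _ _ _ => ⟨norm_of_familyRank_three hp, norm_of_familyRank_four hp⟩,
    fun _ hp h2 => ⟨phi2_family hp h2, phi3_family hp h2, phi4_family hp h2, phi5_family hp h2,
      phi6_family hp h2, phi7_family hp h2, phi8_family hp h2, phi9_family hp h2,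
      phi10_family hp h2⟩,
    ⟨gamma2_family, gamma3_family, gamma4_family, gamma5_family, gamma6_family, gamma7_family,
      gamma8_family⟩,
    fun _ hp h2 =>
      ⟨familiesAgree_of_invariants (phi3_family hp h2).2 (phi4_family hp h2).2,
        familiesAgree_of_invariants (phi7_family hp h2).2 (phi8_family hp h2).2⟩,
    ⟨familiesAgree_of_invariants gamma3_family.2 gamma4_family.2,
      familiesAgree_of_invariants gamma6_family.2 gamma7_family.2⟩⟩
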